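/- Let $\mathcal C=(\mathcal C,\otimes,\mathbf 1,\Psi)$ be a braided monoidal category and $\overline{\mathcal C}=(\mathcal C,\otimes,\mathbf 1,\Psi^{-1})$ the same monoidal category with the inverse braiding (associativity and unit isomorphisms are suppressed below). A \emph{quasitriangular bialgebra} $(A,\overline A,\mathcal R)$ in $\mathcal C$ consists of a bialgebra $A=(A,m,\eta,\Delta,\varepsilon)$ in $\mathcal C$, a bialgebra $\overline A=(A,m,\eta,\overline\Delta,\varepsilon)$ in $\overline{\mathcal C}$ which differs from $A$ only in its comultiplication, and a convolution invertible morphism $\mathcal R:\mathbf 1\to A\otimes A$ (invertible for the product of the tensor product algebra $A\otimes A$ in $\mathcal C$) which is a bialgebra copairing between $\overline A_{\rm op}=(A,m,\eta,\Psi_{A,A}\circ\overline\Delta,\varepsilon)$ and $A$, i.e. $$(\varepsilon\otimes{\rm id})\mathcal R=\eta=({\rm id}\otimes\varepsilon)\mathcal R,\quad (\Psi_{A,A}\overline\Delta\otimes{\rm id})\mathcal R=({\rm id}\otimes{\rm id}\otimes m)({\rm id}\otimes\mathcal R\otimes{\rm id})\mathcal R,\quad ({\rm id}\otimes\Delta)\mathcal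 R=(m\otimes{\rm id}\otimes{\rm id})({\rm id}\otimes\mathcal R\otimes{\rm id})\mathcal R,$$ such that $(\Psi_{A,A}\circ\overline\Delta)\cdot\mathcal R=\mathcal R\cdot\Delta$, where $\cdot$ is the convolution product. It is a \emph{quasitriangular Hopf algebra} if in addition $A$ has an antipode in $\mathcal C$ and $\overline A$ has an antipode in $\overline{\mathcal C}$. Let $\mathcal C_{\mathcal O(A,\overline A)}$ be the full subcategory of the category of right $A$-modules in $\mathcal C$ whose objects $(X,\mu)$ satisfy $$({\rm id}_A\otimes\mu)(\Psi_{X,A}\otimes{\rm id}_A)({\rm id}_X\otimes\Delta)=({\rm id}_A\otimes\mu)((\Psi_{A,X})^{-1}\otimes{\rm id}_A)({\rm id}_X\otimes\overline\Delta).$$ It is a braided monoidal category with the diagonal action on tensor products and the braiding $({\rm id}_Y\otimes\mu_X)(\Psi_{X,Y}\otimes{\rm id}_A)({\rm id}_X\otimes\nu_Y)$, where $\nu_Y=(\mu_Y\otimes{\rm id}_A)({\rm id}_Y\otimes\mathcal R)$. Its objects are also crossed modules over $\overline A$ in $\overline{\mathcal C}$, with the coaction $\overline\nu_X=(\mu_X\otimes{\rm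 id}_A)({\rm id}_X\otimes\Psi_{A,A}^{-1}\mathcal R^{-1})$. Given a bialgebra $A$ in $\mathcal C$ and an object $B$ with an action $\mu$ and a coaction $\nu$ of $A$, an algebra structure and a coalgebra structure, the cross product $A\ltimes B$ is $A\otimes B$ with unit $\eta_A\otimes\eta_B$, counit $\varepsilon_A\otimes\varepsilon_B$ and $$m_{A\ltimes B}=(m_A\otimes m_B)\big({\rm id}_A\otimes({\rm id}_A\otimes\mu)(\Psi_{B,A}\otimes{\rm id}_A)({\rm id}_B\otimes\Delta_A)\otimes{\rm id}_B\big),$$ $$\Delta_{A\ltimes B}=\big({\rm id}_A\otimes({\rm id}_B\otimes m_A)(\Psi_{A,B}\otimes{\rm id}_A)({\rm id}_A\otimes\nu)\otimes{\rm id}_B\big)(\Delta_A\otimes\Delta_B).$$ \textbf{Theorem (generalized bosonization).} Let $(A,\overline A,\mathcal R_A)$ be a quasitriangular bialgebra in $\mathcal C$ and let $(B,\overline B,\mathcal R_B)$ be a quasitriangular bialgebra in $\mathcal C_{\mathcal O(A,\overline A)}$. Then $(A\ltimes B,\overline A\ltimes\overline B,\mathcal R_{A\ltimes B})$ is a quasitriangular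 bialgebra in $\mathcal C$, where $A\ltimes B$ is formed in $\mathcal C$ with the coaction $\nu_B$, $\overline A\ltimes\overline B$ is formed in $\overline{\mathcal C}$ with the coaction $\overline\nu_B$, and $$\mathcal R_{A\ltimes B}=(m_{A\ltimes B}\otimes m_{A\ltimes B})\circ(\iota_B\otimes(\iota_A\otimes\iota_A)\mathcal R_A\otimes\iota_B)\circ\mathcal R_B;$$ here $\iota_A={\rm id}_A\otimes\eta_B:A\to A\ltimes B$ and $\iota_B=\eta_A\otimes{\rm id}_B:B\to A\ltimes B$ are the canonical morphisms, which are algebra monomorphisms. If moreover $(A,\overline A,\mathcal R_A)$ and $(B,\overline B,\mathcal R_B)$ are quasitriangular Hopf algebras, then so is $(A\ltimes B,\overline A\ltimes\overline B,\mathcal R_{A\ltimes B})$. -/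

import Mathlib

open CategoryTheory MonoidalCategory BraidedCategory
open scoped MonObj ComonObj

universe v u

namespace BraidedQuantum

section Monoidal

variable {C : Type u} [Category.{v} C] [MonoidalCategory C] {A X : C}

/-- The coaction `(μ ⊗ id) ∘ (id ⊗ R)` on a right module `(X, μ)` given by `R : 𝟙 ⟶ A ⊗ A`. -/
def coaction (R : 𝟙_ C ⟶ A ⊗ A) (a : X ⊗ A ⟶ X) : X ⟶ X ⊗ A :=
  (ρ_ X).inv ≫ X ◁ R ≫ (α_ X A A).inv ≫ a ▷ A

lemma unit_act_mul (m : A ⊗ A ⟶ A) (e : A ⟶ 𝟙_ C) (h : m ≫ e = (e ⊗ₘ e) ≫ (λ_ (𝟙_ C)).hom) :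
    ((λ_ A).hom ≫ e) ▷ A ≫ (λ_ A).hom ≫ e =
      (α_ (𝟙_ C) A A).hom ≫ 𝟙_ C ◁ m ≫ (λ_ A).hom ≫ e := by
  calc
    _ = 𝟙 _ ⊗≫ (e ▷ A ≫ (𝟙_ C) ◁ e) ⊗≫ 𝟙 _ := by monoidal
    _ = _ := by
      rw [← MonoidalCategory.tensorHom_def, leftUnitor_naturality_assoc, h]
      monoidal

lemma act_conv {M W T : C} [MonObj M] (e : W ⊗ M ⟶ W)
    (he : e ▷ M ≫ e = (α_ W M M).hom ≫ W ◁ μ[M] ≫ e) (f : T ⟶ M) (g : 𝟙_ C ⟶ M) :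
    (W ◁ f ≫ e) ≫ (ρ_ W).inv ≫ W ◁ g ≫ e = W ◁ ((ρ_ T).inv ≫ (f ⊗ₘ g) ≫ μ[M]) ≫ e := by
  calc
    _ = 𝟙 _ ⊗≫ W ◁ f ⊗≫ (e ▷ (𝟙_ C) ≫ W ◁ g) ⊗≫ e := by monoidal
    _ = 𝟙 _ ⊗≫ W ◁ f ⊗≫ W ◁ M ◁ g ⊗≫ (e ▷ M ≫ e) := by
      rw [← whisker_exchange]; monoidal
    _ = _ := by
      rw [he, MonoidalCategory.tensorHom_def]; monoidal

lemma act_conv' {M W T : C} [MonObj M] (e : W ⊗ M ⟶ W)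
    (he : e ▷ M ≫ e = (α_ W M M).hom ≫ W ◁ μ[M] ≫ e) (f : T ⟶ M) (g : 𝟙_ C ⟶ M) :
    ((ρ_ W).inv ≫ W ◁ g ≫ e) ▷ T ≫ W ◁ f ≫ e = W ◁ ((λ_ T).inv ≫ (g ⊗ₘ f) ≫ μ[M]) ≫ e := by
  calc
    _ = 𝟙 _ ⊗≫ W ◁ g ▷ T ⊗≫ (e ▷ T ≫ W ◁ f) ⊗≫ e := by monoidal
    _ = 𝟙 _ ⊗≫ W ◁ g ▷ T ⊗≫ W ◁ M ◁ f ⊗≫ (e ▷ M ≫ e) := by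
      rw [← whisker_exchange]; monoidal
    _ = _ := by
      rw [he, MonoidalCategory.tensorHom_def]; monoidal

lemma coaction_coassoc [MonObj A] (R : 𝟙_ C ⟶ A ⊗ A) (δ : A ⟶ A ⊗ A)
    (hR : R ≫ A ◁ δ = R ≫ ((ρ_ A).inv ≫ A ◁ R ≫ (α_ A A A).inv ≫ μ[A] ▷ A) ▷ A ≫ (α_ A A A).hom)
    (a : X ⊗ A ⟶ X) (ha : a ▷ A ≫ a = (α_ X A A).hom ≫ X ◁ μ[A] ≫ a) :
    coaction R a ≫ coaction R a ▷ A ≫ (α_ X A A).hom = coaction R a ≫ X ◁ δ := by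
  calc
    _ = 𝟙 _ ⊗≫ X ◁ R ⊗≫ (a ▷ (𝟙_ C) ≫ X ◁ R) ▷ A ⊗≫ a ▷ A ▷ A ⊗≫ 𝟙 _ := by
      simp only [coaction]; monoidal
    _ = 𝟙 _ ⊗≫ X ◁ R ⊗≫ X ◁ A ◁ R ▷ A ⊗≫ (a ▷ A ≫ a) ▷ A ▷ A ⊗≫ 𝟙 _ := by
      rw [← whisker_exchange]; monoidal
    _ = 𝟙 _ ⊗≫ X ◁ (R ≫ ((ρ_ A).inv ≫ A ◁ R ≫ (α_ A A A).inv ≫ μ[A] ▷ A) ▷ A ≫ (α_ A A A).hom)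
          ⊗≫ a ▷ A ▷ A ⊗≫ 𝟙 _ := by
      rw [ha]; monoidal
    _ = 𝟙 _ ⊗≫ X ◁ R ⊗≫ ((X ⊗ A) ◁ δ ≫ a ▷ (A ⊗ A)) := by
      rw [← hR]; monoidal
    _ = _ := by
      rw [whisker_exchange, coaction]; monoidal

end Monoidal

section Braided
variable {C : Type u} [Category.{v} C] [MonoidalCategory C] [BraidedCategory C] {A X Y : C}

/-- For a right action `a` of `A` on `X` and a comultiplication `δ`, the morphism
`(id ⊗ a) ∘ (Ψ_{X,A} ⊗ id) ∘ (id ⊗ δ) : X ⊗ A ⟶ A ⊗ X`. -/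
def swapAct (δ : A ⟶ A ⊗ A) (a : X ⊗ A ⟶ X) : X ⊗ A ⟶ A ⊗ X :=
  X ◁ δ ≫ (α_ X A A).inv ≫ (β_ X A).hom ▷ A ≫ (α_ A X A).hom ≫ A ◁ a

/-- The diagonal right action
`(a ⊗ b) ∘ (id ⊗ Ψ_{Y,A} ⊗ id) ∘ (id ⊗ id ⊗ δ)` of `A` on `X ⊗ Y`. -/
def diagAct (δ : A ⟶ A ⊗ A) (a : X ⊗ A ⟶ X) (b : Y ⊗ A ⟶ Y) : (X ⊗ Y) ⊗ A ⟶ X ⊗ Y :=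
  (X ⊗ Y) ◁ δ ≫ tensorμ X Y A A ≫ (a ⊗ₘ b)

lemma diagAct_eq (δ : A ⟶ A ⊗ A) (a : X ⊗ A ⟶ X) (b : Y ⊗ A ⟶ Y) :
    diagAct δ a b = (α_ X Y A).hom ≫ X ◁ swapAct δ b ≫ (α_ X A Y).inv ≫ a ▷ Y := by
  simp only [diagAct, swapAct, tensorμ, tensorHom_def']
  monoidal

lemma swapAct_diagAct (δ : A ⟶ A ⊗ A) (hδ : δ ≫ δ ▷ A ≫ (α_ A A A).hom = δ ≫ A ◁ δ)
    (a : X ⊗ A ⟶ X) (b : Y ⊗ A ⟶ Y) :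
    swapAct δ (diagAct δ a b) =
      (α_ X Y A).hom ≫ X ◁ swapAct δ b ≫ (α_ X A Y).inv ≫ swapAct δ a ▷ Y ≫ (α_ A X Y).hom := by
  symm
  calc
    _ = 𝟙 _ ⊗≫ X ◁ (Y ◁ δ ⊗≫ (β_ Y A).hom ▷ A) ⊗≫ (X ◁ (A ◁ b ≫ δ ▷ Y)) ⊗≫
          ((β_ X A).hom ▷ A ⊗≫ A ◁ a) ▷ Y ⊗≫ 𝟙 _ := by
        simp only [swapAct]; monoidal
    _ = 𝟙 _ ⊗≫ X ◁ (Y ◁ δ ⊗≫ ((β_ Y A).hom ≫ δ ▷ Y) ▷ A) ⊗≫ X ◁ ((A ⊗ A) ◁ b) ⊗≫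
          ((β_ X A).hom ▷ A ⊗≫ A ◁ a) ▷ Y ⊗≫ 𝟙 _ := by
        rw [whisker_exchange]; monoidal
    _ = 𝟙 _ ⊗≫ X ◁ Y ◁ (δ ≫ δ ▷ A ≫ (α_ A A A).hom) ⊗≫ X ◁ (β_ Y A).hom ▷ A ▷ A ⊗≫
          (X ◁ A ◁ (β_ Y A).hom ▷ A) ⊗≫
          ((X ⊗ A) ◁ A ◁ b  ≫ ((β_ X A).hom ▷ (A ⊗ Y))) ⊗≫ A ◁ a ▷ Y ⊗≫ 𝟙 _ := by
        rw [← braiding_naturality_right Y δ, braiding_tensor_right_hom Y A A]; monoidal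
    _ = 𝟙 _ ⊗≫ X ◁ Y ◁ δ ⊗≫ (X ◁ ((Y ⊗ A) ◁ δ ≫ (β_ Y A).hom ▷ (A ⊗ A))) ⊗≫
          ((X ⊗ A) ◁ ((β_ Y A).hom ▷ A) ≫
          ((β_ X A).hom ▷ ((A ⊗ Y) ⊗ A))) ⊗≫ (A ◁ X ◁ A ◁ b) ⊗≫ A ◁ a ▷ Y ⊗≫ 𝟙 _ := by
        rw [hδ, whisker_exchange (β_ X A).hom (A ◁ b)]; monoidal
    _ = 𝟙 _ ⊗≫ X ◁ Y ◁ δ ⊗≫ X ◁ (β_ Y A).hom ▷ A ⊗≫ ((X ⊗ A) ◁ Y ◁ δ ≫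
          ((β_ X A).hom ▷ (Y ⊗ (A ⊗ A)))) ⊗≫
          (A ◁ X ◁ (β_ Y A).hom ▷ A) ⊗≫ (A ◁ X ◁ A ◁ b) ⊗≫ A ◁ a ▷ Y ⊗≫ 𝟙 _ := by
        rw [whisker_exchange (β_ Y A).hom δ, whisker_exchange (β_ X A).hom ((β_ Y A).hom ▷ A)]; monoidal
    _ = _ := by
        rw [whisker_exchange (β_ X A).hom (Y ◁ δ), diagAct_eq]
        simp only [swapAct, braiding_tensor_left_hom]
        monoidal


/-- The crossed-module braiding `(id ⊗ a) ∘ (Ψ_{X,Y} ⊗ id) ∘ (id ⊗ c) : X ⊗ Y ⟶ Y ⊗ X` for a right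
action `a` on `X` and a right coaction `c` on `Y`. -/
def crossedBraiding (a : X ⊗ A ⟶ X) (c : Y ⟶ Y ⊗ A) : X ⊗ Y ⟶ Y ⊗ X :=
  X ◁ c ≫ (α_ X Y A).inv ≫ (β_ X Y).hom ▷ A ≫ (α_ Y X A).hom ≫ Y ◁ a

lemma crossedBraiding_coaction (R : 𝟙_ C ⟶ A ⊗ A) (a : X ⊗ A ⟶ X) (b : Y ⊗ A ⟶ Y) :
    crossedBraiding a (coaction R b) =
      (β_ X Y).hom ≫ (ρ_ (Y ⊗ X)).inv ≫ (Y ⊗ X) ◁ R ≫ tensorμ Y X A A ≫ (b ⊗ₘ a) := by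
  calc
    _ = 𝟙 _ ⊗≫ X ◁ Y ◁ R ⊗≫ (X ◁ b ≫ (β_ X Y).hom) ▷ A ⊗≫ Y ◁ a := by
        simp only [crossedBraiding, coaction]; monoidal
    _ = 𝟙 _ ⊗≫ ((X ⊗ Y) ◁ R ≫ (β_ X Y).hom ▷ (A ⊗ A)) ⊗≫ Y ◁ (β_ X A).hom ▷ A ⊗≫
          b ▷ X ▷ A ⊗≫ Y ◁ a := by
        rw [braiding_naturality_right, braiding_tensor_right_hom]; monoidal
    _ = _ := by
        rw [whisker_exchange, tensorμ, MonoidalCategory.tensorHom_def]; monoidal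

lemma tensorμ_reverse_braiding (X Y U V : C) :
    @tensorμ C _ _ (reverseBraiding C) X Y U V ≫ (β_ (X ⊗ U) (Y ⊗ V)).hom =
      ((β_ X Y).hom ⊗ₘ (β_ U V).hom) ≫ tensorμ Y X V U := by
  calc
    _ = 𝟙 _ ⊗≫ X ◁ ((β_ U Y).inv ≫ (β_ U Y).hom) ▷ V ⊗≫ (β_ X Y).hom ▷ (U ⊗ V) ⊗≫
         (Y ⊗ X) ◁ (β_ U V).hom ⊗≫ Y ◁ (β_ X V).hom ▷ U ⊗≫ 𝟙 _ := by
        simp only [tensorμ, braiding_tensor_left_hom, braiding_tensor_right_hom]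
        monoidal
    _ = _ := by
        rw [Iso.inv_hom_id, tensorμ, MonoidalCategory.tensorHom_def]
        monoidal

lemma ext_one [MonObj A] (a : X ⊗ A ⟶ X) (b : Y ⊗ A ⟶ Y)
    (ha : X ◁ η[A] ≫ a = (ρ_ X).hom) (hb : Y ◁ η[A] ≫ b = (ρ_ Y).hom) :
    (X ⊗ Y) ◁ η[A ⊗ A] ≫ tensorμ X Y A A ≫ (a ⊗ₘ b) = (ρ_ (X ⊗ Y)).hom := by
  rw [MonObj.tensorObj.one_def, whiskerLeft_comp, Category.assoc, tensorμ_natural_right_assoc,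
    tensorHom_comp_tensorHom, ha, hb, tensor_right_unitality]

lemma ext_mul [MonObj A] (a : X ⊗ A ⟶ X) (b : Y ⊗ A ⟶ Y)
    (ha : a ▷ A ≫ a = (α_ X A A).hom ≫ X ◁ μ[A] ≫ a)
    (hb : b ▷ A ≫ b = (α_ Y A A).hom ≫ Y ◁ μ[A] ≫ b) :
    (tensorμ X Y A A ≫ (a ⊗ₘ b)) ▷ (A ⊗ A) ≫ tensorμ X Y A A ≫ (a ⊗ₘ b) =
      (α_ (X ⊗ Y) (A ⊗ A) (A ⊗ A)).hom ≫ (X ⊗ Y) ◁ μ[A ⊗ A] ≫ tensorμ X Y A A ≫ (a ⊗ₘ b) := by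
  rw [MonObj.tensorObj.mul_def, comp_whiskerRight, Category.assoc, tensorμ_natural_left_assoc,
    tensorHom_comp_tensorHom, ha, hb, ← tensorHom_comp_tensorHom, ← tensorHom_comp_tensorHom,
    tensor_associativity_assoc, whiskerLeft_comp, Category.assoc, tensorμ_natural_right_assoc]


lemma swapAct_unit (δ : A ⟶ A ⊗ A) (e : A ⟶ 𝟙_ C) (h : δ ≫ A ◁ e = (ρ_ A).inv) :
    swapAct δ ((λ_ A).hom ≫ e) = (λ_ A).hom ≫ (ρ_ A).inv := by
  rw [← h]
  simp only [swapAct, braiding_tensorUnit_left]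
  monoidal

lemma swapAct_counit (δ : A ⟶ A ⊗ A) (e : A ⟶ 𝟙_ C) (h : δ ≫ e ▷ A = (λ_ A).inv)
    (b : Y ⊗ A ⟶ Y) : swapAct δ b ≫ e ▷ Y ≫ (λ_ Y).hom = b := by
  calc
    _ = 𝟙 _ ⊗≫ Y ◁ δ ⊗≫ (β_ Y A).hom ▷ A ⊗≫ (A ◁ b ≫ e ▷ Y) ⊗≫ 𝟙 _ := by
        simp only [swapAct]; monoidal
    _ = 𝟙 _ ⊗≫ Y ◁ δ ⊗≫ ((β_ Y A).hom ≫ e ▷ Y) ▷ A ⊗≫ b := by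
        rw [whisker_exchange]; monoidal
    _ = 𝟙 _ ⊗≫ Y ◁ (δ ≫ e ▷ A) ⊗≫ b := by
        rw [← braiding_naturality_right, braiding_tensorUnit_right]; monoidal
    _ = _ := by rw [h]; monoidal

lemma diagAct_naturality {X' Y' : C} (δ : A ⟶ A ⊗ A) {a : X ⊗ A ⟶ X} {b : Y ⊗ A ⟶ Y}
    {a' : X' ⊗ A ⟶ X'} {b' : Y' ⊗ A ⟶ Y'} (f : X ⟶ X') (g : Y ⟶ Y')
    (hf : a ≫ f = f ▷ A ≫ a') (hg : b ≫ g = g ▷ A ≫ b') :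
    diagAct δ a b ≫ (f ⊗ₘ g) = (f ⊗ₘ g) ▷ A ≫ diagAct δ a' b' := by
  simp only [diagAct, Category.assoc, tensorHom_comp_tensorHom, hf, hg]
  rw [← tensorHom_comp_tensorHom, ← tensorμ_natural_left_assoc, whisker_exchange_assoc]

lemma diagAct_assoc {Z : C} (δ : A ⟶ A ⊗ A) (hδ : δ ≫ δ ▷ A ≫ (α_ A A A).hom = δ ≫ A ◁ δ)
    (a : X ⊗ A ⟶ X) (b : Y ⊗ A ⟶ Y) (c : Z ⊗ A ⟶ Z) :
    diagAct δ (diagAct δ a b) c ≫ (α_ X Y Z).hom =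
      (α_ X Y Z).hom ▷ A ≫ diagAct δ a (diagAct δ b c) := by
  rw [diagAct_eq δ _ c, diagAct_eq δ a b, diagAct_eq δ a, swapAct_diagAct δ hδ]
  monoidal


lemma diagAct_leftUnitor (δ : A ⟶ A ⊗ A) (e : A ⟶ 𝟙_ C) (h : δ ≫ e ▷ A = (λ_ A).inv)
    (b : Y ⊗ A ⟶ Y) :
    diagAct δ ((λ_ A).hom ≫ e) b ≫ (λ_ Y).hom = (λ_ Y).hom ▷ A ≫ b := by
  rw [diagAct_eq]
  conv_rhs => rw [← swapAct_counit δ e h b]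
  monoidal

lemma diagAct_rightUnitor (δ : A ⟶ A ⊗ A) (e : A ⟶ 𝟙_ C) (h : δ ≫ A ◁ e = (ρ_ A).inv)
    (b : Y ⊗ A ⟶ Y) :
    diagAct δ b ((λ_ A).hom ≫ e) ≫ (ρ_ Y).hom = (ρ_ Y).hom ▷ A ≫ b := by
  rw [diagAct_eq, swapAct_unit δ e h]
  monoidal

lemma diagAct_reverse_braiding (δ : A ⟶ A ⊗ A) (a : X ⊗ A ⟶ X) (b : Y ⊗ A ⟶ Y) :
    @diagAct C _ _ (reverseBraiding C) A X Y δ a b ≫ (β_ X Y).hom =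
      (β_ X Y).hom ▷ A ≫ (Y ⊗ X) ◁ (δ ≫ (β_ A A).hom) ≫ tensorμ Y X A A ≫ (b ⊗ₘ a) := by
  simp only [diagAct, Category.assoc, braiding_naturality]
  rw [reassoc_of% (tensorμ_reverse_braiding X Y A A), MonoidalCategory.tensorHom_def (β_ X Y).hom]
  rw [Category.assoc, whisker_exchange_assoc, whiskerLeft_comp_assoc]

lemma swapAct_reverse (δ : A ⟶ A ⊗ A) (b : Y ⊗ A ⟶ Y) :
    @swapAct C _ _ (reverseBraiding C) A Y δ b =
      Y ◁ (δ ≫ (β_ A A).hom) ≫ (α_ Y A A).inv ≫ b ▷ A ≫ (β_ A Y).inv := by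
  rw [braiding_inv_naturality_left, braiding_tensor_right_inv]
  calc
    _ = 𝟙 _ ⊗≫ Y ◁ (δ ≫ (β_ A A).hom ≫ (β_ A A).inv) ⊗≫ (β_ A Y).inv ▷ A ⊗≫ A ◁ b := by
      simp [swapAct, monoidalComp]
      rfl
    _ = _ := by monoidal

lemma crossedBraiding_coaction_naturality {X' Y' : C} (R : 𝟙_ C ⟶ A ⊗ A) {a : X ⊗ A ⟶ X}
    {b : Y ⊗ A ⟶ Y} {a' : X' ⊗ A ⟶ X'} {b' : Y' ⊗ A ⟶ Y'} (f : X ⟶ X') (g : Y ⟶ Y')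
    (hf : a ≫ f = f ▷ A ≫ a') (hg : b ≫ g = g ▷ A ≫ b') :
    (f ⊗ₘ g) ≫ crossedBraiding a' (coaction R b') =
      crossedBraiding a (coaction R b) ≫ (g ⊗ₘ f) := by
  rw [crossedBraiding_coaction, crossedBraiding_coaction, braiding_naturality_assoc,
    rightUnitor_inv_naturality_assoc, ← whisker_exchange_assoc, tensorμ_natural_left_assoc,
    tensorHom_comp_tensorHom, ← hf, ← hg, ← tensorHom_comp_tensorHom]
  simp only [Category.assoc]

lemma slide_R (R : 𝟙_ C ⟶ A ⊗ A) :
    𝟙 _ ⊗≫ R ▷ Y ⊗≫ A ◁ (β_ A Y).hom ⊗≫ 𝟙 ((A ⊗ Y) ⊗ A) =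
      (λ_ Y).hom ≫ (ρ_ Y).inv ≫ Y ◁ R ≫ (α_ Y A A).inv ≫ (β_ A Y).inv ▷ A := by
  have h := braiding_naturality_left R Y
  rw [braiding_tensorUnit_left, braiding_tensor_left_hom] at h
  simp only [Category.assoc] at h
  rw [← reassoc_of% h]
  calc
    _ = 𝟙 _ ⊗≫ R ▷ Y ⊗≫ A ◁ (β_ A Y).hom ⊗≫ ((β_ A Y).hom ≫ (β_ A Y).inv) ▷ A := by
      rw [Iso.hom_inv_id]; monoidal
    _ = _ := by monoidal

lemma coaction_tensor [MonObj A] (R : 𝟙_ C ⟶ A ⊗ A) (δ : A ⟶ A ⊗ A)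
    (hR : R ≫ δ ▷ A =
      R ≫ A ◁ ((λ_ A).inv ≫ R ▷ A ≫ (α_ A A A).hom ≫ A ◁ μ[A]) ≫ (α_ A A A).inv)
    (a : X ⊗ A ⟶ X) (b : Y ⊗ A ⟶ Y) :
    coaction R ((α_ X Y A).hom ≫ X ◁ (Y ◁ δ ≫ (α_ Y A A).inv ≫ b ▷ A ≫ (β_ A Y).inv) ≫
        (α_ X A Y).inv ≫ a ▷ Y) =
      coaction R a ▷ Y ≫ (α_ X A Y).hom ≫ X ◁ (A ◁ coaction R b ≫ (α_ A Y A).inv ≫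
        (β_ A Y).hom ▷ A ≫ (α_ Y A A).hom ≫ Y ◁ μ[A]) ≫ (α_ X Y A).inv := by
  calc
    _ = 𝟙 _ ⊗≫ X ◁ Y ◁ (R ≫ δ ▷ A) ⊗≫ X ◁ b ▷ A ▷ A ⊗≫ X ◁ (β_ A Y).inv ▷ A ⊗≫ a ▷ Y ▷ A := by
      simp only [coaction]; monoidal
    _ = 𝟙 _ ⊗≫ X ◁ Y ◁ R ⊗≫ X ◁ ((Y ⊗ A) ◁ ((λ_ A).inv ≫ R ▷ A ≫ (α_ A A A).hom ≫ A ◁ μ[A]) ≫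
          b ▷ (A ⊗ A)) ⊗≫ X ◁ (β_ A Y).inv ▷ A ⊗≫ a ▷ Y ▷ A := by
      rw [hR]; monoidal
    _ = 𝟙 _ ⊗≫ X ◁ Y ◁ R ⊗≫ X ◁ b ▷ A ⊗≫ X ◁ (Y ◁ R) ▷ A ⊗≫ X ◁ ((Y ⊗ A) ◁ μ[A] ≫
          (β_ A Y).inv ▷ A) ⊗≫ a ▷ Y ▷ A := by
      rw [whisker_exchange]; monoidal
    _ = 𝟙 _ ⊗≫ X ◁ Y ◁ R ⊗≫ X ◁ b ▷ A ⊗≫ X ◁ ((λ_ Y).hom ≫ (ρ_ Y).inv ≫ Y ◁ R ≫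
          (α_ Y A A).inv ≫ (β_ A Y).inv ▷ A) ▷ A ⊗≫
          ((X ⊗ A) ◁ Y ◁ μ[A] ≫ a ▷ (Y ⊗ A)) ⊗≫ 𝟙 _ := by
      rw [whisker_exchange]; monoidal
    _ = 𝟙 _ ⊗≫ X ◁ coaction R b ⊗≫ X ◁ R ▷ Y ▷ A ⊗≫ X ◁ A ◁ (β_ A Y).hom ▷ A ⊗≫
          (a ▷ Y ▷ A ▷ A) ⊗≫ X ◁ Y ◁ μ[A] ⊗≫ 𝟙 _ := by
      rw [whisker_exchange, ← slide_R, coaction]; monoidal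
    _ = 𝟙 _ ⊗≫ X ◁ ((𝟙_ C) ◁ coaction R b ≫ R ▷ (Y ⊗ A)) ⊗≫ ((X ⊗ A) ◁ (β_ A Y).hom ≫
          a ▷ (Y ⊗ A)) ▷ A ⊗≫ X ◁ Y ◁ μ[A] ⊗≫ 𝟙 _ := by
      monoidal
    _ = 𝟙 _ ⊗≫ X ◁ R ▷ Y ⊗≫ ((X ⊗ A) ◁ A ◁ coaction R b ≫ a ▷ (A ⊗ Y ⊗ A)) ⊗≫
          X ◁ (β_ A Y).hom ▷ A ⊗≫ X ◁ Y ◁ μ[A] ⊗≫ 𝟙 _ := by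
      rw [whisker_exchange, whisker_exchange a]; monoidal
    _ = 𝟙 _ ⊗≫ (X ◁ R ⊗≫ a ▷ A) ▷ Y ⊗≫ X ◁ A ◁ coaction R b ⊗≫
          X ◁ (β_ A Y).hom ▷ A ⊗≫ X ◁ Y ◁ μ[A] ⊗≫ 𝟙 _ := by
      rw [whisker_exchange]; monoidal
    _ = _ := by
      rw [show coaction R a = 𝟙 _ ⊗≫ X ◁ R ⊗≫ a ▷ A by simp only [coaction]; monoidal]
      monoidal


lemma crossed_hexagon_forward {Z : C} [MonObj A] (a : X ⊗ A ⟶ X)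
    (ha : a ▷ A ≫ a = (α_ X A A).hom ≫ X ◁ μ[A] ≫ a) (c : Y ⟶ Y ⊗ A) (d : Z ⟶ Z ⊗ A) :
    (α_ X Y Z).hom ≫ crossedBraiding a (c ▷ Z ≫ (α_ Y A Z).hom ≫ Y ◁ (A ◁ d ≫ (α_ A Z A).inv ≫
        (β_ A Z).hom ▷ A ≫ (α_ Z A A).hom ≫ Z ◁ μ[A]) ≫ (α_ Y Z A).inv) ≫ (α_ Y Z X).hom =
      crossedBraiding a c ▷ Z ≫ (α_ Y X Z).hom ≫ Y ◁ crossedBraiding a d := by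
  symm
  calc
    _ = 𝟙 _ ⊗≫ X ◁ c ▷ Z ⊗≫ (β_ X Y).hom ▷ A ▷ Z ⊗≫ Y ◁ (a ▷ Z ≫ X ◁ d) ⊗≫
          Y ◁ (β_ X Z).hom ▷ A ⊗≫ Y ◁ Z ◁ a := by
      simp only [crossedBraiding]; monoidal
    _ = 𝟙 _ ⊗≫ X ◁ c ▷ Z ⊗≫ (β_ X Y).hom ▷ A ▷ Z ⊗≫ Y ◁ X ◁ A ◁ d ⊗≫
          Y ◁ (a ▷ Z ≫ (β_ X Z).hom) ▷ A ⊗≫ Y ◁ Z ◁ a := by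
      rw [← whisker_exchange]; monoidal
    _ = 𝟙 _ ⊗≫ X ◁ c ▷ Z ⊗≫ (β_ X Y).hom ▷ A ▷ Z ⊗≫ Y ◁ X ◁ A ◁ d ⊗≫
          Y ◁ X ◁ (β_ A Z).hom ▷ A ⊗≫ Y ◁ (β_ X Z).hom ▷ A ▷ A ⊗≫ Y ◁ Z ◁ (a ▷ A ≫ a) := by
      rw [braiding_naturality_left, braiding_tensor_left_hom]; monoidal
    _ = 𝟙 _ ⊗≫ X ◁ c ▷ Z ⊗≫ ((β_ X Y).hom ▷ (A ⊗ Z) ≫ (Y ⊗ X) ◁ (A ◁ d ⊗≫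
          (β_ A Z).hom ▷ A ⊗≫ 𝟙 (Z ⊗ A ⊗ A))) ⊗≫ Y ◁ ((β_ X Z).hom ▷ (A ⊗ A) ≫ (Z ⊗ X) ◁ μ[A]) ⊗≫
          Y ◁ Z ◁ a := by
      rw [ha]; monoidal
    _ = _ := by
      rw [← whisker_exchange, ← whisker_exchange, crossedBraiding, braiding_tensor_right_hom]
      have := whisker_exchange (β_ X Y).hom (Z ◁ μ[A])
      calc
        _ = 𝟙 _ ⊗≫ X ◁ c ▷ Z ⊗≫ X ◁ Y ◁ (A ◁ d ⊗≫ (β_ A Z).hom ▷ A ⊗≫ 𝟙 (Z ⊗ A ⊗ A)) ⊗≫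
              ((β_ X Y).hom ▷ (Z ⊗ A ⊗ A) ≫ (Y ⊗ X) ◁ (Z ◁ μ[A])) ⊗≫
              Y ◁ (β_ X Z).hom ▷ A ⊗≫ Y ◁ Z ◁ a := by monoidal
        _ = _ := by rw [← this]; monoidal

lemma crossed_hexagon_reverse {Z : C} (δ : A ⟶ A ⊗ A) (a : X ⊗ A ⟶ X) (b : Y ⊗ A ⟶ Y)
    (c : Z ⟶ Z ⊗ A) (hc : c ≫ c ▷ A ≫ (α_ Z A A).hom = c ≫ Z ◁ δ) :
    (α_ X Y Z).inv ≫ crossedBraiding (diagAct δ a b) c ≫ (α_ Z X Y).inv =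
      X ◁ crossedBraiding b c ≫ (α_ X Z Y).inv ≫ crossedBraiding a c ▷ Y := by
  calc
    _ = 𝟙 _ ⊗≫ X ◁ Y ◁ c ⊗≫ (β_ (X ⊗ Y) Z).hom ▷ A ⊗≫ Z ◁ diagAct δ a b ⊗≫ 𝟙 _ := by
      simp only [crossedBraiding]; monoidal
    _ = 𝟙 _ ⊗≫ X ◁ Y ◁ c ⊗≫ ((β_ (X ⊗ Y) Z).hom ▷ A ≫ (Z ⊗ X ⊗ Y) ◁ δ) ⊗≫
          Z ◁ X ◁ (β_ Y A).hom ▷ A ⊗≫ Z ◁ X ◁ A ◁ b ⊗≫ Z ◁ a ▷ Y ⊗≫ 𝟙 _ := by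
      rw [diagAct_eq, swapAct]; monoidal
    _ = 𝟙 _ ⊗≫ X ◁ Y ◁ (c ≫ Z ◁ δ) ⊗≫ (β_ (X ⊗ Y) Z).hom ▷ (A ⊗ A) ⊗≫
          Z ◁ X ◁ (β_ Y A).hom ▷ A ⊗≫ Z ◁ X ◁ A ◁ b ⊗≫ Z ◁ a ▷ Y ⊗≫ 𝟙 _ := by
      rw [← whisker_exchange]; monoidal
    _ = 𝟙 _ ⊗≫ X ◁ Y ◁ (c ≫ c ▷ A) ⊗≫ X ◁ (β_ Y Z).hom ▷ A ▷ A ⊗≫ ((β_ X Z).hom ▷ (Y ⊗ A ⊗ A) ≫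
          (Z ⊗ X) ◁ ((α_ Y A A).inv ≫ (β_ Y A).hom ▷ A)) ⊗≫ Z ◁ X ◁ A ◁ b ⊗≫ Z ◁ a ▷ Y ⊗≫ 𝟙 _ := by
      rw [← hc, braiding_tensor_left_hom]; monoidal
    _ = 𝟙 _ ⊗≫ X ◁ Y ◁ (c ≫ c ▷ A) ⊗≫ X ◁ (β_ Y Z).hom ▷ A ▷ A ⊗≫ X ◁ Z ◁ (β_ Y A).hom ▷ A ⊗≫
          ((β_ X Z).hom ▷ (A ⊗ Y ⊗ A) ≫ (Z ⊗ X) ◁ A ◁ b) ⊗≫ Z ◁ a ▷ Y ⊗≫ 𝟙 _ := by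
      rw [← whisker_exchange]; monoidal
    _ = 𝟙 _ ⊗≫ X ◁ Y ◁ c ⊗≫ X ◁ (Y ◁ c ≫ (β_ Y (Z ⊗ A)).hom) ▷ A ⊗≫
          X ◁ (Z ⊗ A) ◁ b ⊗≫ (β_ X Z).hom ▷ (A ⊗ Y) ⊗≫ Z ◁ a ▷ Y ⊗≫ 𝟙 _ := by
      rw [← whisker_exchange, braiding_tensor_right_hom]; monoidal
    _ = 𝟙 _ ⊗≫ X ◁ Y ◁ c ⊗≫ X ◁ (β_ Y Z).hom ▷ A ⊗≫ X ◁ (c ▷ (Y ⊗ A) ≫ (Z ⊗ A) ◁ b) ⊗≫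
          (β_ X Z).hom ▷ (A ⊗ Y) ⊗≫ Z ◁ a ▷ Y ⊗≫ 𝟙 _ := by
      rw [braiding_naturality_right]; monoidal
    _ = _ := by
      rw [← whisker_exchange]
      simp only [crossedBraiding]; monoidal

end Braided

section QT
variable {C : Type u} [Category.{v} C] [MonoidalCategory C] [BraidedCategory C]

/-- A braided quasitriangular bialgebra `(A, Ā, R)` in a braided category with braiding `Ψ`.
`A` is a bialgebra in `C`, and `bar` is a bialgebra `Ā` in the category `C` with inverse braiding
which differs from `A` only in its comultiplication.  `R` is a convolution invertible copairing
between `Ā_op` (the bialgebra in `C` with the algebra structure of `A` and the comultiplication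
`Ψ_{A,A} ∘ Δ̄`) and `A`.  Convolution of morphisms into `A ⊗ A` uses the multiplication of the tensor
product algebra `A ⊗ A` in `C`. -/
class QuasitriangularBialgebra (A : C) extends BimonObj A where
  /-- the bialgebra `Ā` in the category with inverse braiding -/
  bar : @BimonObj C _ _ (reverseBraiding C) A
  bar_mul : bar.mul = μ[A]
  bar_one : bar.one = η[A]
  bar_counit : bar.counit = ε[A]
  /-- the R-matrix -/
  R : 𝟙_ C ⟶ A ⊗ A
  /-- the convolution inverse of the R-matrix -/
  Rinv : 𝟙_ C ⟶ A ⊗ A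
  R_mul_Rinv : (λ_ (𝟙_ C)).inv ≫ (R ⊗ₘ Rinv) ≫ μ[A ⊗ A] = η[A ⊗ A]
  Rinv_mul_R : (λ_ (𝟙_ C)).inv ≫ (Rinv ⊗ₘ R) ≫ μ[A ⊗ A] = η[A ⊗ A]
  R_counit_left : R ≫ ε[A] ▷ A ≫ (λ_ A).hom = η[A]
  R_counit_right : R ≫ A ◁ ε[A] ≫ (ρ_ A).hom = η[A]
  R_comul_left : R ≫ (bar.comul ≫ (β_ A A).hom) ▷ A =
    R ≫ A ◁ ((λ_ A).inv ≫ R ▷ A ≫ (α_ A A A).hom ≫ A ◁ μ[A]) ≫ (α_ A A A).inv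
  R_comul_right : R ≫ A ◁ Δ[A] =
    R ≫ ((ρ_ A).inv ≫ A ◁ R ≫ (α_ A A A).inv ≫ μ[A] ▷ A) ▷ A ≫ (α_ A A A).hom
  /-- `(Ψ ∘ Δ̄) · R = R · Δ` (the convolution of `f : A ⟶ A ⊗ A` with `R ∘ ε`). -/
  comul_R : (ρ_ A).inv ≫ ((bar.comul ≫ (β_ A A).hom) ⊗ₘ R) ≫ μ[A ⊗ A] =
    (λ_ A).inv ≫ (R ⊗ₘ Δ[A]) ≫ μ[A ⊗ A]

open QuasitriangularBialgebra (R Rinv)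

/-- `(A, Ā, R)` is a quasitriangular Hopf algebra: `A` has an antipode in `C`, and `Ā` has an antipode
in `C` with inverse braiding. -/
def IsHopf (A : C) [QuasitriangularBialgebra A] : Prop :=
  (∃ H : HopfObj A, H.toBimonObj = QuasitriangularBialgebra.toBimonObj) ∧
  (∃ H : @HopfObj C _ _ (reverseBraiding C) A,
    @HopfObj.toBimonObj C _ _ (reverseBraiding C) A H = QuasitriangularBialgebra.bar)

variable (A : C) [QuasitriangularBialgebra A]

/-- The comultiplication `Δ̄` of `Ā`. -/
abbrev comulBar : A ⟶ A ⊗ A := (QuasitriangularBialgebra.bar (A := A)).comul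

/-- `Ψ⁻¹ ∘ R⁻¹`, the R-matrix of `(Ā, A)` in the category with inverse braiding. -/
abbrev Rbar : 𝟙_ C ⟶ A ⊗ A := Rinv ≫ (β_ A A).inv

/-- Objects of the category `C_{O(A, Ā)}`: right `A`-modules `(X, μ)` for which
`(id ⊗ μ) ∘ (Ψ_{X,A} ⊗ id) ∘ (id ⊗ Δ) = (id ⊗ μ) ∘ (Ψ⁻¹_{X,A} ⊗ id) ∘ (id ⊗ Δ̄)`. -/
structure ModO where
  /-- the underlying object -/
  obj : C
  /-- the right action -/
  act : obj ⊗ A ⟶ obj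
  act_one : obj ◁ η[A] ≫ act = (ρ_ obj).hom
  act_mul : act ▷ A ≫ act = (α_ obj A A).hom ≫ obj ◁ μ[A] ≫ act
  swap_eq : swapAct Δ[A] act = @swapAct C _ _ (reverseBraiding C) A obj (comulBar A) act


namespace ModO
variable {A}

/-- Morphisms of `A`-modules. -/
@[ext]
structure Hom (X Y : ModO A) where
  /-- the underlying morphism -/
  hom : X.obj ⟶ Y.obj
  comm : X.act ≫ hom = hom ▷ A ≫ Y.act

instance : Category (ModO A) where
  Hom := Hom
  id X := ⟨𝟙 X.obj, by simp⟩
  comp f g := ⟨f.hom ≫ g.hom, by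
    rw [← Category.assoc, f.comm, Category.assoc, g.comm, comp_whiskerRight, Category.assoc]⟩

@[ext]
lemma hom_ext {X Y : ModO A} (f g : X ⟶ Y) (h : f.hom = g.hom) : f = g := Hom.ext h

@[simp] lemma id_hom (X : ModO A) : (𝟙 X : X ⟶ X).hom = 𝟙 X.obj := rfl
@[simp] lemma comp_hom {X Y Z : ModO A} (f : X ⟶ Y) (g : Y ⟶ Z) :
    (f ≫ g).hom = f.hom ≫ g.hom := rfl

@[simp]
lemma act_hom {X Y : ModO A} (f : X ⟶ Y) : X.act ≫ f.hom = f.hom ▷ A ≫ Y.act := Hom.comm f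

/-- An isomorphism of modules from an isomorphism of underlying objects. -/
@[simps]
def isoMk {X Y : ModO A} (e : X.obj ≅ Y.obj) (h : X.act ≫ e.hom = e.hom ▷ A ≫ Y.act) : X ≅ Y where
  hom := ⟨e.hom, h⟩
  inv := ⟨e.inv, by rw [Iso.comp_inv_eq, Category.assoc, h, ← comp_whiskerRight_assoc,
    Iso.inv_hom_id, id_whiskerRight, Category.id_comp]⟩

lemma comul_coassoc' : Δ[A] ≫ Δ[A] ▷ A ≫ (α_ A A A).hom = Δ[A] ≫ A ◁ Δ[A] := by simp

lemma comulBar_coassoc :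
    comulBar A ≫ comulBar A ▷ A ≫ (α_ A A A).hom = comulBar A ≫ A ◁ comulBar A := by
  let _ := (QuasitriangularBialgebra.bar (A := A)).toComonObj
  exact (ComonObj.comul_assoc A).symm

lemma counit_comulBar : comulBar A ≫ ε[A] ▷ A = (λ_ A).inv := by
  rw [← QuasitriangularBialgebra.bar_counit]
  let _ := (QuasitriangularBialgebra.bar (A := A)).toComonObj
  exact ComonObj.counit_comul A

lemma comulBar_counit : comulBar A ≫ A ◁ ε[A] = (ρ_ A).inv := by
  rw [← QuasitriangularBialgebra.bar_counit]
  let _ := (QuasitriangularBialgebra.bar (A := A)).toComonObj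
  exact ComonObj.comul_counit A

lemma diagAct_bar (X Y : ModO A) : diagAct Δ[A] X.act Y.act =
    @diagAct C _ _ (reverseBraiding C) A X.obj Y.obj (comulBar A) X.act Y.act := by
  rw [diagAct_eq, Y.swap_eq, ← @diagAct_eq C _ _ (reverseBraiding C)]

/-- The unit object with the action given by the counit. -/
@[simps]
def tensorUnit : ModO A where
  obj := 𝟙_ C
  act := (λ_ A).hom ≫ ε[A]
  act_one := by simp [unitors_equal]
  act_mul := unit_act_mul _ _ (by rw [BimonObj.mul_counit]; rfl)
  swap_eq := by
    rw [swapAct_unit _ _ (by simp), @swapAct_unit C _ _ (reverseBraiding C) _ _ _ comulBar_counit]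

/-- The tensor product with the diagonal action. -/
@[simps]
def tensorObj (X Y : ModO A) : ModO A where
  obj := X.obj ⊗ Y.obj
  act := diagAct Δ[A] X.act Y.act
  act_one := by
    rw [diagAct, ← whiskerLeft_comp_assoc, BimonObj.one_comul, ext_one _ _ X.act_one Y.act_one]
  act_mul := by
    have h := ext_mul _ _ X.act_mul Y.act_mul
    simp only [diagAct, comp_whiskerRight, Category.assoc]
    rw [← whiskerLeft_comp_assoc _ μ[A], BimonObj.mul_comul]
    have h2 := whisker_exchange (tensorμ X.obj Y.obj A A ≫ (X.act ⊗ₘ Y.act)) Δ[A]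
    simp only [comp_whiskerRight, Category.assoc] at h h2
    rw [← reassoc_of% h2, h, MonObj.tensorObj.mul_def, MonoidalCategory.tensorHom_def Δ[A] Δ[A]]
    monoidal
  swap_eq := by
    rw [swapAct_diagAct _ comul_coassoc', diagAct_bar,
      @swapAct_diagAct C _ _ (reverseBraiding C) _ _ _ _ comulBar_coassoc, X.swap_eq, Y.swap_eq]

instance : MonoidalCategoryStruct (ModO A) where
  tensorUnit := tensorUnit
  tensorObj := tensorObj
  whiskerLeft X _ _ f := ⟨X.obj ◁ f.hom, by
    rw [← id_tensorHom]
    exact diagAct_naturality _ _ _ (by simp) (by simp)⟩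
  whiskerRight f Y := ⟨f.hom ▷ Y.obj, by
    rw [← tensorHom_id]
    exact diagAct_naturality _ _ _ (by simp) (by simp)⟩
  associator X Y Z := isoMk (α_ X.obj Y.obj Z.obj) (diagAct_assoc _ comul_coassoc' _ _ _)
  leftUnitor X := isoMk (λ_ X.obj) (diagAct_leftUnitor _ _ (by simp) _)
  rightUnitor X := isoMk (ρ_ X.obj) (diagAct_rightUnitor _ _ (by simp) _)

@[simp] lemma whiskerLeft_hom (X : ModO A) {Y Z : ModO A} (f : Y ⟶ Z) :
    (X ◁ f).hom = X.obj ◁ f.hom := rfl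
@[simp] lemma whiskerRight_hom {Y Z : ModO A} (f : Y ⟶ Z) (X : ModO A) :
    (f ▷ X).hom = f.hom ▷ X.obj := rfl
@[simp] lemma tensor_obj (X Y : ModO A) : (X ⊗ Y).obj = X.obj ⊗ Y.obj := rfl
@[simp] lemma tensorHom_hom {X Y X' Y' : ModO A} (f : X ⟶ Y) (g : X' ⟶ Y') :
    (f ⊗ₘ g).hom = f.hom ⊗ₘ g.hom := (MonoidalCategory.tensorHom_def _ _).symm
@[simp] lemma unit_obj : (𝟙_ (ModO A)).obj = 𝟙_ C := rfl
@[simp] lemma associator_hom_hom (X Y Z : ModO A) :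
    (α_ X Y Z).hom.hom = (α_ X.obj Y.obj Z.obj).hom := rfl
@[simp] lemma associator_inv_hom (X Y Z : ModO A) :
    (α_ X Y Z).inv.hom = (α_ X.obj Y.obj Z.obj).inv := rfl
@[simp] lemma leftUnitor_hom_hom (X : ModO A) : (λ_ X).hom.hom = (λ_ X.obj).hom := rfl
@[simp] lemma leftUnitor_inv_hom (X : ModO A) : (λ_ X).inv.hom = (λ_ X.obj).inv := rfl
@[simp] lemma rightUnitor_hom_hom (X : ModO A) : (ρ_ X).hom.hom = (ρ_ X.obj).hom := rfl
@[simp] lemma rightUnitor_inv_hom (X : ModO A) : (ρ_ X).inv.hom = (ρ_ X.obj).inv := rfl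

instance : MonoidalCategory (ModO A) where
  tensorHom_def f g := by ext; simp [MonoidalCategory.tensorHom_def]
  id_tensorHom_id _ _ := by ext; simp
  tensorHom_comp_tensorHom _ _ _ _ := by ext; simp
  whiskerLeft_id _ _ := by ext; simp
  id_whiskerRight _ _ := by ext; simp
  associator_naturality _ _ _ := by ext; simp
  leftUnitor_naturality _ := by ext; simp
  rightUnitor_naturality _ := by ext; simp
  pentagon _ _ _ _ := by ext; simp
  triangle _ _ := by ext; simp


/-- The coaction `(μ ⊗ id) ∘ (id ⊗ R)` making an object of `C_{O(A, Ā)}` a crossed module over `A`. -/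
abbrev coact (X : ModO A) : X.obj ⟶ X.obj ⊗ A := coaction (R (A := A)) X.act

/-- The coaction of `Ā` on an object of `C_{O(A, Ā)}` given by the R-matrix of `(Ā, A)`, making it a
crossed module over `Ā` in `C` with inverse braiding. -/
abbrev coactBar (X : ModO A) : X.obj ⟶ X.obj ⊗ A := coaction (Rbar A) X.act

/-- The action of the algebra `A ⊗ A` on `X ⊗ Y`. -/
abbrev extAct (X Y : ModO A) : (X.obj ⊗ Y.obj) ⊗ (A ⊗ A) ⟶ X.obj ⊗ Y.obj :=
  tensorμ X.obj Y.obj A A ≫ (X.act ⊗ₘ Y.act)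

lemma extAct_one (X Y : ModO A) : (X.obj ⊗ Y.obj) ◁ η[A ⊗ A] ≫ extAct X Y = (ρ_ _).hom :=
  ext_one _ _ X.act_one Y.act_one

lemma extAct_mul (X Y : ModO A) : extAct X Y ▷ (A ⊗ A) ≫ extAct X Y =
    (α_ (X.obj ⊗ Y.obj) (A ⊗ A) (A ⊗ A)).hom ≫ (X.obj ⊗ Y.obj) ◁ μ[A ⊗ A] ≫ extAct X Y :=
  ext_mul _ _ X.act_mul Y.act_mul

lemma coact_tensor (X Y : ModO A) : coact (X ⊗ Y) =
    coact X ▷ Y.obj ≫ (α_ X.obj A Y.obj).hom ≫ X.obj ◁ (A ◁ coact Y ≫ (α_ A Y.obj A).inv ≫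
        (β_ A Y.obj).hom ▷ A ≫ (α_ Y.obj A A).hom ≫ Y.obj ◁ μ[A]) ≫ (α_ X.obj Y.obj A).inv := by
  rw [← coaction_tensor _ _ QuasitriangularBialgebra.R_comul_left, ← swapAct_reverse, ← Y.swap_eq,
    ← diagAct_eq]
  rfl

/-- The action of an element `f : 𝟙 ⟶ A ⊗ A` on `X ⊗ Y`. -/
def actBy (X Y : ModO A) (f : 𝟙_ C ⟶ A ⊗ A) : X.obj ⊗ Y.obj ⟶ X.obj ⊗ Y.obj :=
  (ρ_ (X.obj ⊗ Y.obj)).inv ≫ (X.obj ⊗ Y.obj) ◁ f ≫ extAct X Y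

lemma crossedBraiding_bar (X Y : ModO A) :
    @crossedBraiding C _ _ (reverseBraiding C) A Y.obj X.obj Y.act (coactBar X) =
      actBy Y X Rinv ≫ (β_ X.obj Y.obj).inv := by
  have h := tensorμ_reverse_braiding X.obj Y.obj A A
  rw [actBy, @crossedBraiding_coaction C _ _ (reverseBraiding C), Iso.eq_comp_inv]
  simp only [Category.assoc, braiding_naturality]
  rw [reassoc_of% h]
  have h2 := whisker_exchange (β_ X.obj Y.obj).hom (β_ A A).hom
  change (β_ X.obj Y.obj).inv ≫ _ = _
  rw [Iso.inv_comp_eq]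
  calc
    _ = 𝟙 _ ⊗≫ (X.obj ⊗ Y.obj) ◁ (Rinv ≫ (β_ A A).inv ≫ (β_ A A).hom) ⊗≫
          (β_ X.obj Y.obj).hom ▷ (A ⊗ A) ⊗≫ extAct Y X := by
      rw [MonoidalCategory.tensorHom_def', extAct]; monoidal
    _ = 𝟙 _ ⊗≫ ((X.obj ⊗ Y.obj) ◁ Rinv ≫
          (β_ X.obj Y.obj).hom ▷ (A ⊗ A)) ⊗≫ extAct Y X := by
      rw [Iso.inv_hom_id, Category.comp_id]; monoidal
    _ = _ := by
      rw [whisker_exchange]; monoidal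

lemma crossedBraiding_hom (X Y : ModO A) :
    crossedBraiding X.act (coact Y) = (β_ X.obj Y.obj).hom ≫
      actBy Y X R :=
  crossedBraiding_coaction _ _ _

lemma actR_comp (X Y : ModO A) (f g : 𝟙_ C ⟶ A ⊗ A)
    (h : (λ_ (𝟙_ C)).inv ≫ (f ⊗ₘ g) ≫ μ[A ⊗ A] = η[A ⊗ A]) :
    actBy X Y f ≫ actBy X Y g = 𝟙 _ := by
  have := act_conv (extAct X Y) (extAct_mul X Y) f g
  rw [actBy, actBy, Category.assoc, this, ← unitors_inv_equal, h, extAct_one, Iso.inv_hom_id]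

/-- The braiding of `C_{O(A, Ā)}` is the crossed-module braiding over `A`, and its inverse is
the crossed-module braiding over `Ā` in the category with inverse braiding. -/
def braidingIso (X Y : ModO A) : X.obj ⊗ Y.obj ≅ Y.obj ⊗ X.obj where
  hom := crossedBraiding X.act (coact Y)
  inv := @crossedBraiding C _ _ (reverseBraiding C) A Y.obj X.obj Y.act (coactBar X)
  hom_inv_id := by
    rw [crossedBraiding_bar, crossedBraiding_hom, Category.assoc]
    have := actR_comp Y X _ _ (QuasitriangularBialgebra.R_mul_Rinv (A := A))
    rw [reassoc_of% this, Iso.hom_inv_id]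
  inv_hom_id := by
    rw [crossedBraiding_bar, crossedBraiding_hom, Category.assoc, Iso.inv_hom_id_assoc]
    exact actR_comp Y X _ _ (QuasitriangularBialgebra.Rinv_mul_R (A := A))

lemma act_braiding (X Y : ModO A) : diagAct Δ[A] X.act Y.act ≫ crossedBraiding X.act (coact Y) =
    crossedBraiding X.act (coact Y) ▷ A ≫ diagAct Δ[A] Y.act X.act := by
  have h2 : diagAct Δ[A] Y.act X.act = (Y.obj ⊗ X.obj) ◁ Δ[A] ≫ extAct Y X := rfl
  have h3 := act_conv (extAct Y X) (extAct_mul Y X) (comulBar A ≫ (β_ A A).hom) R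
  have h4 := act_conv' (extAct Y X) (extAct_mul Y X) Δ[A] R
  have h5 := diagAct_reverse_braiding (comulBar A) X.act Y.act
  rw [diagAct_bar X Y, crossedBraiding_hom, actBy, reassoc_of% h5, h2, comp_whiskerRight, Category.assoc, h4,
    ← QuasitriangularBialgebra.comul_R, ← h3, Category.assoc, Category.assoc]

instance : BraidedCategory (ModO A) where
  braiding X Y := isoMk (braidingIso X Y) (act_braiding X Y)
  braiding_naturality_right X Y Z f := by
    ext
    have h := crossedBraiding_coaction_naturality R (a := X.act) (a' := X.act)
      (𝟙 X.obj) f.hom (by simp) f.comm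
    rw [id_tensorHom, tensorHom_id] at h
    exact h
  braiding_naturality_left f Z := by
    ext
    have h := crossedBraiding_coaction_naturality R (b := Z.act) (b' := Z.act)
      f.hom (𝟙 Z.obj) f.comm (by simp)
    rw [id_tensorHom, tensorHom_id] at h
    exact h
  hexagon_forward X Y Z := by
    ext
    have h := crossed_hexagon_forward X.act X.act_mul (coact Y) (coact Z)
    rw [← coact_tensor] at h
    exact h
  hexagon_reverse X Y Z := by
    ext
    exact crossed_hexagon_reverse Δ[A] X.act Y.act (coact Z)
      (coaction_coassoc _ _ QuasitriangularBialgebra.R_comul_right _ Z.act_mul)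

end ModO

end QT

section CrossProduct

variable {C : Type u} [Category.{v} C] [MonoidalCategory C] [BraidedCategory C] {A X : C}

/-- For a right coaction `c` of `A` on `X` and a multiplication `m` on `A`, the morphism
`(id ⊗ m) ∘ (Ψ_{A,X} ⊗ id) ∘ (id ⊗ c) : A ⊗ X ⟶ X ⊗ A`. -/
def swapCoact (m : A ⊗ A ⟶ A) (c : X ⟶ X ⊗ A) : A ⊗ X ⟶ X ⊗ A :=
  A ◁ c ≫ (α_ A X A).inv ≫ (β_ A X).hom ▷ A ≫ (α_ X A A).hom ≫ X ◁ m

/-- The multiplication of the cross product on `A ⊗ X`,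
`(m ⊗ mX) ∘ (id ⊗ (id ⊗ a) ∘ (Ψ_{X,A} ⊗ id) ∘ (id ⊗ δ) ⊗ id)`. -/
def crossMul (m : A ⊗ A ⟶ A) (δ : A ⟶ A ⊗ A) (a : X ⊗ A ⟶ X) (mX : X ⊗ X ⟶ X) :
    (A ⊗ X) ⊗ (A ⊗ X) ⟶ A ⊗ X :=
  (α_ A X (A ⊗ X)).hom ≫ A ◁ ((α_ X A X).inv ≫ swapAct δ a ▷ X ≫ (α_ A X X).hom) ≫
    (α_ A A (X ⊗ X)).inv ≫ (m ⊗ₘ mX)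

/-- The comultiplication of the cross coproduct on `A ⊗ X`,
`(id ⊗ (id ⊗ m) ∘ (Ψ_{A,X} ⊗ id) ∘ (id ⊗ c) ⊗ id) ∘ (δ ⊗ dX)`. -/
def crossComul (m : A ⊗ A ⟶ A) (δ : A ⟶ A ⊗ A) (c : X ⟶ X ⊗ A) (dX : X ⟶ X ⊗ X) :
    A ⊗ X ⟶ (A ⊗ X) ⊗ (A ⊗ X) :=
  (δ ⊗ₘ dX) ≫ (α_ A A (X ⊗ X)).hom ≫
    A ◁ ((α_ A X X).inv ≫ swapCoact m c ▷ X ≫ (α_ X A X).hom) ≫ (α_ A X (A ⊗ X)).inv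

/-- The bialgebra `K` on the object `A ⊗ X` is the cross product `A ⋉ X` of the bialgebra `H` on `A`
with the object `X` carrying the action `a`, the coaction `c`, the algebra structure `(mX, eX)` and
the coalgebra structure `(dX, uX)`. -/
structure IsCrossProduct (H : BimonObj A) (a : X ⊗ A ⟶ X) (c : X ⟶ X ⊗ A)
    (mX : X ⊗ X ⟶ X) (eX : 𝟙_ C ⟶ X) (dX : X ⟶ X ⊗ X) (uX : X ⟶ 𝟙_ C)
    (K : BimonObj (A ⊗ X)) : Prop where
  mul : K.mul = crossMul H.mul H.comul a mX
  one : K.one = (λ_ (𝟙_ C)).inv ≫ (H.one ⊗ₘ eX)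
  comul : K.comul = crossComul H.mul H.comul c dX
  counit : K.counit = (H.counit ⊗ₘ uX) ≫ (λ_ (𝟙_ C)).hom

/-- The canonical morphism `A ⟶ A ⋉ X`. -/
def crossInl (A : C) (eX : 𝟙_ C ⟶ X) : A ⟶ A ⊗ X := (ρ_ A).inv ≫ A ◁ eX

/-- The canonical morphism `X ⟶ A ⋉ X`. -/
def crossInr (eA : 𝟙_ C ⟶ A) (X : C) : X ⟶ A ⊗ X := (λ_ X).inv ≫ eA ▷ X

/-- For an object `K` with a multiplication `m`, morphisms `i : A ⟶ K` and `j : X ⟶ K` and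
`RA : 𝟙 ⟶ A ⊗ A`, `RX : 𝟙 ⟶ X ⊗ X`, the morphism
`(m ⊗ m) ∘ (j ⊗ (i ⊗ i) ∘ RA ⊗ j) ∘ RX : 𝟙 ⟶ K ⊗ K`. -/
def crossR {K : C} (m : K ⊗ K ⟶ K) (i : A ⟶ K) (j : X ⟶ K)
    (RA : 𝟙_ C ⟶ A ⊗ A) (RX : 𝟙_ C ⟶ X ⊗ X) : 𝟙_ C ⟶ K ⊗ K :=
  RX ≫ (j ⊗ₘ j) ≫ K ◁ ((λ_ K).inv ≫ (RA ≫ (i ⊗ₘ i)) ▷ K ≫ (α_ K K K).hom) ≫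
    (α_ K K (K ⊗ K)).inv ≫ (m ⊗ₘ m)

end CrossProduct

end BraidedQuantum

/-!
The cross product is studied through what characterises it as an algebra, and not on the object
`A ⊗ B`. A monoid `K` is a smash product of `A` and `B` (`IsSmashProduct`) if it comes with monoid
maps `i : A ⟶ K` and `j : B ⟶ K` such that `j(b) i(a)` can be rewritten through the action and
`i(a) j(b)` defines an isomorphism `A ⊗ B ⟶ K`. Monoid maps out of `K` are then determined by their
restrictions to `A` and `B`, and can be constructed from such restrictions (`hom_ext`,
`isMonHom_lift`), so that most identities need to be checked on `A` and `B` only. Computations with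
morphisms into monoids are written as products `f ⊛ g` of generalised elements.

The key observation is that in `K ⊗ K` the coaction of `x` in `B` is the conjugate of `x ⊗ 1` by
the image of `R_A` (`IsSmashProduct.coactIn_lmul`). Hence the coaction `B ⟶ K ⊗ K` is a monoid
map, and `x ⊗ y ↦ coact(x) (1 ⊗ y)` is a monoid map `bosonMap` from the tensor square of `B`,
formed in `C_{O(A, Ā)}`, to the tensor square of `K`, formed in `C` (`isMonHom_bosonMap`). The
comultiplication of `K` is `Δ_A` on `A` and `bosonMap ∘ Δ_B` on `B`, and its R-matrix is the
product of `R_A` and `bosonMap(R_B)` in `K ⊗ K` (`crossElement`). Since `bosonMap` is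
multiplicative, it carries the properties of `R_B` over to `K ⊗ K`; in addition `R_B` is invariant
and coinvariant under `A`, being a morphism of `C_{O(A, Ā)}`.

The structure `(Ā, A, Ψ⁻¹ R⁻¹)` is a quasitriangular bialgebra for the inverse braiding
(`QuasitriangularBialgebra.reverse`), and `Ā ⋉ B̄` is obtained by applying the construction of
`A ⋉ B` to it, with the same algebra `K` (`IsSmashProduct.reverse`). The two comultiplications are
linked by `bosonMapBar_braiding`: conjugation by `R_A` turns the opposite of the reversed `bosonMap`
into `bosonMap` composed with the braiding of `C_{O(A, Ā)}`. This gives the intertwining property of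
the R-matrix (`comul_crossElement`) and identifies the R-matrix of the reversed cross product
(`crossRBar_braiding`), so that the copairing condition in the first leg follows from the one in the
second leg (`isLeftCopairing_iff_reverse`).

In the Hopf case the identity of `K` is the convolution product of the maps `K ⟶ A ⟶ K` and
`K ⟶ B ⟶ K`, both of which have convolution inverses, given by the antipodes of `A` and `B`
(`IsSmashProduct.exists_antipode`).
-/

namespace BraidedQuantum

/-! ### Generalised elements of a monoid object -/

section ElementCalculus

variable {C : Type u} [Category.{v} C] [MonoidalCategory C] {M N X Y Z X' Y' : C}
  [MonObj M] [MonObj N]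

/-- The product of the generalised elements `f : X ⟶ M` and `g : Y ⟶ M` of a monoid object `M`. -/
def mulMap (f : X ⟶ M) (g : Y ⟶ M) : X ⊗ Y ⟶ M := (f ⊗ₘ g) ≫ μ[M]

/-- The product of generalised elements of a monoid object. -/
scoped infixl:70 " ⊛ " => mulMap

/-- Left multiplication by `r : 𝟙 ⟶ M`. -/
def lmul (r : 𝟙_ C ⟶ M) : M ⟶ M := (λ_ M).inv ≫ r ▷ M ≫ μ[M]

/-- Right multiplication by `r : 𝟙 ⟶ M`. -/
def rmul (r : 𝟙_ C ⟶ M) : M ⟶ M := (ρ_ M).inv ≫ M ◁ r ≫ μ[M]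

lemma tensorHom_mulMap (p : X' ⟶ X) (q : Y' ⟶ Y) (f : X ⟶ M) (g : Y ⟶ M) :
    (p ⊗ₘ q) ≫ (f ⊛ g) = (p ≫ f) ⊛ (q ≫ g) := by
  simp [mulMap, tensorHom_comp_tensorHom_assoc]

lemma whiskerRight_mulMap (p : X' ⟶ X) (f : X ⟶ M) (g : Y ⟶ M) :
    p ▷ Y ≫ (f ⊛ g) = (p ≫ f) ⊛ g := by
  simp [mulMap, MonoidalCategory.tensorHom_def]

lemma whiskerLeft_mulMap (q : Y' ⟶ Y) (f : X ⟶ M) (g : Y ⟶ M) :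
    X ◁ q ≫ (f ⊛ g) = f ⊛ (q ≫ g) := by
  simp [mulMap, MonoidalCategory.tensorHom_def']

lemma mulMap_comp (f : X ⟶ M) (g : Y ⟶ M) (h : M ⟶ N) [IsMonHom h] :
    (f ⊛ g) ≫ h = (f ≫ h) ⊛ (g ≫ h) := by
  simp [mulMap, tensorHom_comp_tensorHom_assoc]

lemma mulMap_assoc (f : X ⟶ M) (g : Y ⟶ M) (h : Z ⟶ M) :
    (f ⊛ g) ⊛ h = (α_ X Y Z).hom ≫ (f ⊛ (g ⊛ h)) := by
  simp only [mulMap]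
  calc
    _ = ((f ⊗ₘ g) ⊗ₘ h) ≫ μ[M] ▷ M ≫ μ[M] := by monoidal
    _ = _ := by rw [MonObj.mul_assoc]; monoidal

lemma mulMap_assoc' (f : X ⟶ M) (g : Y ⟶ M) (h : Z ⟶ M) :
    f ⊛ (g ⊛ h) = (α_ X Y Z).inv ≫ ((f ⊛ g) ⊛ h) := by
  rw [mulMap_assoc, Iso.inv_hom_id_assoc]

lemma comp_lmul (r : 𝟙_ C ⟶ M) (f : X ⟶ M) : f ≫ lmul r = (λ_ X).inv ≫ (r ⊛ f) := by
  simp only [mulMap, lmul, tensorHom_def']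
  monoidal

lemma comp_rmul (r : 𝟙_ C ⟶ M) (f : X ⟶ M) : f ≫ rmul r = (ρ_ X).inv ≫ (f ⊛ r) := by
  simp only [mulMap, rmul]
  rw [rightUnitor_inv_naturality_assoc, MonoidalCategory.tensorHom_def, Category.assoc]

lemma mulMap_lmul (r : 𝟙_ C ⟶ M) (f : X ⟶ M) (g : Y ⟶ M) :
    (f ⊛ g) ≫ lmul r = (f ≫ lmul r) ⊛ g := by
  rw [comp_lmul, comp_lmul, mulMap_assoc', ← whiskerRight_mulMap]
  monoidal

lemma mulMap_rmul (r : 𝟙_ C ⟶ M) (f : X ⟶ M) (g : Y ⟶ M) :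
    (f ⊛ g) ≫ rmul r = f ⊛ (g ≫ rmul r) := by
  rw [comp_rmul, comp_rmul, mulMap_assoc, ← whiskerLeft_mulMap]
  monoidal

lemma rmul_mulMap (r : 𝟙_ C ⟶ M) (f : X ⟶ M) (g : Y ⟶ M) :
    (f ≫ rmul r) ⊛ g = f ⊛ (g ≫ lmul r) := by
  rw [comp_lmul, comp_rmul, ← whiskerRight_mulMap, ← whiskerLeft_mulMap, mulMap_assoc]
  monoidal

lemma lmul_comp (r : 𝟙_ C ⟶ M) (h : M ⟶ N) [IsMonHom h] :
    lmul r ≫ h = h ≫ lmul (r ≫ h) := by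
  rw [comp_lmul, ← Category.id_comp (lmul r), comp_lmul, Category.assoc, mulMap_comp,
    Category.id_comp]

lemma rmul_comp (r : 𝟙_ C ⟶ M) (h : M ⟶ N) [IsMonHom h] :
    rmul r ≫ h = h ≫ rmul (r ≫ h) := by
  rw [comp_rmul, ← Category.id_comp (rmul r), comp_rmul, Category.assoc, mulMap_comp,
    Category.id_comp]

lemma lmul_one : lmul η[M] = 𝟙 M := by simp [lmul]

lemma rmul_one : rmul η[M] = 𝟙 M := by simp [rmul]

lemma lmul_lmul (r s : 𝟙_ C ⟶ M) : lmul r ≫ lmul s = lmul (r ≫ lmul s) := by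
  have h := comp_lmul r (𝟙 M)
  rw [Category.id_comp] at h
  rw [h, Category.assoc, mulMap_lmul, ← comp_lmul, Category.id_comp]

lemma rmul_rmul (r s : 𝟙_ C ⟶ M) : rmul r ≫ rmul s = rmul (r ≫ rmul s) := by
  have h := comp_rmul r (𝟙 M)
  rw [Category.id_comp] at h
  rw [h, Category.assoc, mulMap_rmul, ← comp_rmul, Category.id_comp]

lemma lmul_rmul_comm (r s : 𝟙_ C ⟶ M) : lmul r ≫ rmul s = rmul s ≫ lmul r := by
  rw [comp_lmul r (rmul s), ← Category.id_comp (lmul r), comp_lmul, Category.assoc, mulMap_rmul,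
    Category.id_comp]

lemma elem_rmul (r s : 𝟙_ C ⟶ M) : r ≫ rmul s = s ≫ lmul r := by
  rw [comp_lmul, comp_rmul, unitors_inv_equal]

lemma mulMap_one (f : X ⟶ M) : f ⊛ η[M] = (ρ_ X).hom ≫ f := by
  simp [mulMap, MonoidalCategory.tensorHom_def]

lemma one_mulMap (f : X ⟶ M) : η[M] ⊛ f = (λ_ X).hom ≫ f := by
  simp [mulMap, MonoidalCategory.tensorHom_def']

lemma one_comp_lmul (r : 𝟙_ C ⟶ M) : η[M] ≫ lmul r = r := by
  rw [← elem_rmul, rmul_one, Category.comp_id]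

lemma one_comp_rmul (r : 𝟙_ C ⟶ M) : η[M] ≫ rmul r = r := by
  rw [elem_rmul, lmul_one, Category.comp_id]

/-- `r` and `s` are mutually inverse elements of `M`. -/
structure IsInverse (r s : 𝟙_ C ⟶ M) : Prop where
  mul_inv : s ≫ lmul r = η[M]
  inv_mul : r ≫ lmul s = η[M]

namespace IsInverse

variable {r s : 𝟙_ C ⟶ M} (h : IsInverse r s)
include h

lemma symm : IsInverse s r := ⟨h.inv_mul, h.mul_inv⟩

lemma lmul_lmul : lmul r ≫ lmul s = 𝟙 M := by
  rw [BraidedQuantum.lmul_lmul, h.inv_mul, lmul_one]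

lemma rmul_rmul : rmul r ≫ rmul s = 𝟙 M := by
  rw [BraidedQuantum.rmul_rmul, elem_rmul, h.mul_inv, rmul_one]

lemma tensorHom_mul : (λ_ (𝟙_ C)).inv ≫ (r ⊗ₘ s) ≫ μ[M] = η[M] := by
  rw [← h.mul_inv, comp_lmul, mulMap]

lemma comp (f : M ⟶ N) [IsMonHom f] : IsInverse (r ≫ f) (s ≫ f) where
  mul_inv := by rw [Category.assoc, ← lmul_comp, reassoc_of% h.mul_inv, IsMonHom.one_hom]
  inv_mul := by rw [Category.assoc, ← lmul_comp, reassoc_of% h.inv_mul, IsMonHom.one_hom]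

lemma mul {r' s' : 𝟙_ C ⟶ M} (h' : IsInverse r' s') :
    IsInverse (r' ≫ lmul r) (s ≫ lmul s') where
  mul_inv := by
    rw [← BraidedQuantum.lmul_lmul, Category.assoc, reassoc_of% h'.symm.lmul_lmul, h.mul_inv]
  inv_mul := by
    rw [← BraidedQuantum.lmul_lmul, Category.assoc, reassoc_of% h.lmul_lmul, h'.inv_mul]

lemma eq_of_eq {s' : 𝟙_ C ⟶ M} (h' : IsInverse r s') : s = s' := by
  rw [← Category.comp_id s, ← h'.lmul_lmul, reassoc_of% h.mul_inv, one_comp_lmul]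

lemma eq_comp_lmul_iff {f g : X ⟶ M} : f = g ≫ lmul r ↔ f ≫ lmul s = g := by
  constructor
  · rintro rfl; rw [Category.assoc, h.lmul_lmul, Category.comp_id]
  · rintro rfl; rw [Category.assoc, h.symm.lmul_lmul, Category.comp_id]

lemma eq_comp_rmul_iff {f g : X ⟶ M} : f = g ≫ rmul r ↔ f ≫ rmul s = g := by
  constructor
  · rintro rfl; rw [Category.assoc, h.rmul_rmul, Category.comp_id]
  · rintro rfl; rw [Category.assoc, h.symm.rmul_rmul, Category.comp_id]

/-- Conjugation `m ↦ s m r` by an invertible element is a morphism of monoids. -/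
lemma isMonHom_conj : IsMonHom (rmul r ≫ lmul s) where
  one_hom := by rw [← Category.assoc, one_comp_rmul, h.inv_mul]
  mul_hom := by
    have e : μ[M] = 𝟙 M ⊛ 𝟙 M := by simp [mulMap]
    have e' : ((rmul r ≫ lmul s) ⊗ₘ (rmul r ≫ lmul s)) ≫ μ[M] =
        (rmul r ≫ lmul s) ⊛ (rmul r ≫ lmul s) := rfl
    have e'' : rmul r ≫ lmul s = lmul s ≫ rmul r := (lmul_rmul_comm s r).symm
    rw [e']
    -- in `(s m r)(s m' r)` the factors `r` and `s` in the middle cancel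
    nth_rw 2 [e'']
    rw [rmul_mulMap, Category.assoc, h.symm.lmul_lmul, Category.comp_id, e,
      ← Category.assoc, mulMap_rmul, mulMap_lmul, Category.id_comp, Category.id_comp]

end IsInverse

end ElementCalculus

/-! ### Twisted multiplications on tensor products -/

section TwistedTensor

variable {C : Type u} [Category.{v} C] [MonoidalCategory C] {M X Y : C}

/-- The multiplication `(m_X ⊗ m_Y) ∘ (id ⊗ t ⊗ id)` on `X ⊗ Y` twisted by `t : Y ⊗ X ⟶ X ⊗ Y`. -/
def twistMul (t : Y ⊗ X ⟶ X ⊗ Y) (mX : X ⊗ X ⟶ X) (mY : Y ⊗ Y ⟶ Y) :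
    (X ⊗ Y) ⊗ (X ⊗ Y) ⟶ X ⊗ Y :=
  (α_ X Y (X ⊗ Y)).hom ≫ X ◁ ((α_ Y X Y).inv ≫ t ▷ Y ≫ (α_ X Y Y).hom) ≫
    (α_ X X (Y ⊗ Y)).inv ≫ (mX ⊗ₘ mY)

/-- Monoid maps `f` and `g` that commute past each other along `t` combine to a map that is
multiplicative for the twisted multiplication. -/
lemma twistMul_mulMap [MonObj M] {t : Y ⊗ X ⟶ X ⊗ Y} {mX : X ⊗ X ⟶ X} {mY : Y ⊗ Y ⟶ Y}
    {f : X ⟶ M} {g : Y ⟶ M} (hf : mX ≫ f = f ⊛ f) (hg : mY ≫ g = g ⊛ g)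
    (h : g ⊛ f = t ≫ (f ⊛ g)) : twistMul t mX mY ≫ (f ⊛ g) = (f ⊛ g) ⊛ (f ⊛ g) := by
  have e : (f ⊛ g) ⊛ (f ⊛ g) = (α_ X Y (X ⊗ Y)).hom ≫
      X ◁ ((α_ Y X Y).inv ≫ t ▷ Y ≫ (α_ X Y Y).hom) ≫ (α_ X X (Y ⊗ Y)).inv ≫
        ((f ⊛ f) ⊛ (g ⊛ g)) := by
    rw [mulMap_assoc, mulMap_assoc' g, h, ← whiskerRight_mulMap, mulMap_assoc f f,
      Iso.inv_hom_id_assoc, mulMap_assoc f g g, ← whiskerLeft_mulMap, ← whiskerLeft_mulMap,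
      ← whiskerLeft_mulMap]
    simp only [whiskerLeft_comp, Category.assoc]
  rw [e, ← hf, ← hg, ← tensorHom_mulMap, twistMul]
  simp only [Category.assoc]

/-- A twisted multiplication is associative when the two multiplications are and `t` is compatible
with both of them. -/
lemma twistMul_assoc {t : Y ⊗ X ⟶ X ⊗ Y} {mX : X ⊗ X ⟶ X} {mY : Y ⊗ Y ⟶ Y}
    (hX : mX ▷ X ≫ mX = (α_ X X X).hom ≫ X ◁ mX ≫ mX)
    (hY : mY ▷ Y ≫ mY = (α_ Y Y Y).hom ≫ Y ◁ mY ≫ mY)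
    (tY : mY ▷ X ≫ t = (α_ Y Y X).hom ≫ Y ◁ t ≫ (α_ Y X Y).inv ≫ t ▷ Y ≫ (α_ X Y Y).hom ≫ X ◁ mY)
    (tX : Y ◁ mX ≫ t = (α_ Y X X).inv ≫ t ▷ X ≫ (α_ X Y X).hom ≫ X ◁ t ≫ (α_ X X Y).inv ≫ mX ▷ Y) :
    twistMul t mX mY ▷ (X ⊗ Y) ≫ twistMul t mX mY =
      (α_ (X ⊗ Y) (X ⊗ Y) (X ⊗ Y)).hom ≫ (X ⊗ Y) ◁ twistMul t mX mY ≫ twistMul t mX mY := by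
  have hN : twistMul t mX mY = 𝟙 _ ⊗≫ X ◁ t ▷ Y ⊗≫ mX ▷ Y ▷ Y ⊗≫ X ◁ mY := by
    simp only [twistMul, MonoidalCategory.tensorHom_def]; monoidal
  have hN' : twistMul t mX mY = 𝟙 _ ⊗≫ X ◁ t ▷ Y ⊗≫ X ◁ X ◁ mY ⊗≫ mX ▷ Y := by
    simp only [twistMul, tensorHom_def']; monoidal
  calc
    _ = 𝟙 _ ⊗≫ X ◁ t ▷ Y ▷ X ▷ Y ⊗≫ mX ▷ Y ▷ Y ▷ X ▷ Y ⊗≫ X ◁ (mY ▷ X ≫ t) ▷ Y ⊗≫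
          mX ▷ Y ▷ Y ⊗≫ X ◁ mY := by
      rw [hN]; monoidal
    _ = 𝟙 _ ⊗≫ X ◁ t ▷ Y ▷ X ▷ Y ⊗≫ (mX ▷ (Y ⊗ Y ⊗ X ⊗ Y) ≫ X ◁ (𝟙 _ ⊗≫ Y ◁ t ▷ Y ⊗≫
          t ▷ Y ▷ Y ⊗≫ X ◁ mY ▷ Y ⊗≫ 𝟙 (X ⊗ Y ⊗ Y))) ⊗≫ mX ▷ Y ▷ Y ⊗≫ X ◁ mY := by
      rw [tY]; monoidal
    _ = 𝟙 _ ⊗≫ X ◁ t ▷ Y ▷ X ▷ Y ⊗≫ X ◁ X ◁ Y ◁ t ▷ Y ⊗≫ X ◁ X ◁ t ▷ Y ▷ Y ⊗≫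
          X ◁ X ◁ X ◁ mY ▷ Y ⊗≫ (mX ▷ X ≫ mX) ▷ Y ▷ Y ⊗≫ X ◁ mY := by
      rw [← whisker_exchange]; monoidal
    _ = 𝟙 _ ⊗≫ X ◁ (t ▷ (Y ⊗ X) ≫ (X ⊗ Y) ◁ t) ▷ Y ⊗≫ X ◁ X ◁ t ▷ Y ▷ Y ⊗≫
          X ◁ ((X ⊗ X) ◁ (mY ▷ Y) ≫ mX ▷ (Y ⊗ Y)) ⊗≫ mX ▷ Y ▷ Y ⊗≫ X ◁ mY := by
      rw [hX]; monoidal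
    _ = 𝟙 _ ⊗≫ X ◁ Y ◁ X ◁ t ▷ Y ⊗≫ X ◁ t ▷ X ▷ Y ▷ Y ⊗≫ X ◁ X ◁ t ▷ Y ▷ Y ⊗≫
          X ◁ mX ▷ Y ▷ Y ▷ Y ⊗≫ X ◁ X ◁ mY ▷ Y ⊗≫ mX ▷ Y ▷ Y ⊗≫ X ◁ mY := by
      rw [← whisker_exchange t t, whisker_exchange mX]; monoidal
    _ = 𝟙 _ ⊗≫ X ◁ Y ◁ X ◁ t ▷ Y ⊗≫ X ◁ t ▷ X ▷ Y ▷ Y ⊗≫ X ◁ X ◁ t ▷ Y ▷ Y ⊗≫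
          X ◁ mX ▷ Y ▷ Y ▷ Y ⊗≫ ((X ⊗ X) ◁ (mY ▷ Y) ≫ mX ▷ (Y ⊗ Y)) ⊗≫ X ◁ mY := by
      monoidal
    _ = 𝟙 _ ⊗≫ X ◁ Y ◁ X ◁ t ▷ Y ⊗≫ X ◁ t ▷ X ▷ Y ▷ Y ⊗≫ X ◁ X ◁ t ▷ Y ▷ Y ⊗≫
          X ◁ mX ▷ Y ▷ Y ▷ Y ⊗≫ mX ▷ Y ▷ Y ▷ Y ⊗≫ X ◁ (mY ▷ Y ≫ mY) := by
      rw [whisker_exchange mX]; monoidal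
    _ = 𝟙 _ ⊗≫ X ◁ Y ◁ X ◁ t ▷ Y ⊗≫ X ◁ ((𝟙 (Y ⊗ X ⊗ X) ⊗≫ t ▷ X ⊗≫ X ◁ t ⊗≫ mX ▷ Y) ▷ (Y ⊗ Y)) ⊗≫
          (mX ▷ (Y ⊗ Y ⊗ Y) ≫ X ◁ Y ◁ mY) ⊗≫ X ◁ mY := by
      rw [hY]; monoidal
    _ = 𝟙 _ ⊗≫ X ◁ Y ◁ X ◁ t ▷ Y ⊗≫ X ◁ ((𝟙 (Y ⊗ X ⊗ X) ⊗≫ t ▷ X ⊗≫ X ◁ t ⊗≫ mX ▷ Y) ▷ (Y ⊗ Y) ≫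
          (X ⊗ Y) ◁ mY) ⊗≫ mX ▷ Y ▷ Y ⊗≫ X ◁ mY := by
      rw [← whisker_exchange]; monoidal
    _ = 𝟙 _ ⊗≫ X ◁ Y ◁ X ◁ t ▷ Y ⊗≫ X ◁ Y ◁ X ◁ X ◁ mY ⊗≫ X ◁ ((α_ Y X X).inv ≫ t ▷ X ≫
          (α_ X Y X).hom ≫ X ◁ t ≫ (α_ X X Y).inv ≫ mX ▷ Y) ▷ Y ⊗≫ mX ▷ Y ▷ Y ⊗≫ X ◁ mY := by
      rw [← whisker_exchange]; monoidal
    _ = _ := by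
      rw [← tX]
      nth_rw 1 [hN']
      rw [hN]; monoidal

end TwistedTensor

/-! ### Generalised elements of a tensor product of monoid objects -/

section TensorElements

variable {C : Type u} [Category.{v} C] [MonoidalCategory C] {M N X Y Z W : C}

/-- The inclusion `m ↦ m ⊗ 1`. -/
def inl (M N : C) [MonObj N] : M ⟶ M ⊗ N := (ρ_ M).inv ≫ M ◁ η[N]

/-- The inclusion `n ↦ 1 ⊗ n`. -/
def inr (M N : C) [MonObj M] : N ⟶ M ⊗ N := (λ_ N).inv ≫ η[M] ▷ N

lemma inl_naturality [MonObj N] {M' : C} (f : M ⟶ M') : f ≫ inl M' N = inl M N ≫ f ▷ N := by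
  simp only [inl]
  rw [rightUnitor_inv_naturality_assoc, Category.assoc, whisker_exchange]

lemma inr_naturality [MonObj M] {N' : C} (f : N ⟶ N') : f ≫ inr M N' = inr M N ≫ M ◁ f := by
  simp only [inr]
  rw [leftUnitor_inv_naturality_assoc, Category.assoc, whisker_exchange]

lemma inl_whiskerLeft [MonObj N] {N' : C} [MonObj N'] (f : N ⟶ N') [IsMonHom f] :
    inl M N ≫ M ◁ f = inl M N' := by
  simp [inl, ← whiskerLeft_comp]

lemma inr_whiskerRight [MonObj M] {M' : C} [MonObj M'] (f : M ⟶ M') [IsMonHom f] :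
    inr M N ≫ f ▷ N = inr M' N := by
  simp [inr, ← comp_whiskerRight]

variable [MonObj M] [MonObj N] [BraidedCategory C]

instance isMonHom_unit : IsMonHom η[M] where
  mul_hom := by simp [unitors_equal]

instance isMonHom_inl : IsMonHom (inl M N) := by unfold inl; infer_instance

instance isMonHom_inr : IsMonHom (inr M N) := by unfold inr; infer_instance

/-- `(x ⊗ 1)(1 ⊗ y) = x ⊗ y`. -/
lemma inl_mulMap_inr (f : X ⟶ M) (g : Y ⟶ N) : (f ≫ inl M N) ⊛ (g ≫ inr M N) = f ⊗ₘ g := by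
  rw [← tensorHom_mulMap]
  have : inl M N ⊛ inr M N = 𝟙 (M ⊗ N) := by
    calc
      _ = 𝟙 _ ⊗≫ M ◁ η[N] ▷ N ⊗≫ ((M ⊗ N) ◁ (η[M] ▷ N)) ⊗≫ M ◁ (β_ N M).hom ▷ N ⊗≫
          (μ[M] ⊗ₘ μ[N]) := by
        simp only [mulMap, inl, inr, MonObj.tensorObj.mul_def, tensorμ,
          MonoidalCategory.tensorHom_def]
        monoidal
      _ = 𝟙 _ ⊗≫ M ◁ η[N] ▷ N ⊗≫ M ◁ (N ◁ η[M] ≫ (β_ N M).hom) ▷ N ⊗≫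
          (μ[M] ⊗ₘ μ[N]) := by monoidal
      _ = 𝟙 _ ⊗≫ M ◁ η[N] ▷ N ⊗≫ (M ◁ η[M] ≫ μ[M]) ▷ N ▷ N ⊗≫ M ◁ μ[N] := by
        rw [braiding_naturality_right, braiding_tensorUnit_right, MonoidalCategory.tensorHom_def]
        monoidal
      _ = 𝟙 _ ⊗≫ M ◁ (η[N] ▷ N ≫ μ[N]) := by
        rw [MonObj.mul_one]; monoidal
      _ = _ := by rw [MonObj.one_mul]; monoidal
  rw [this, Category.comp_id]

/-- In the product `(1 ⊗ y)(x ⊗ 1)` the two elements are exchanged by the braiding. -/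
lemma inr_mulMap_inl (f : X ⟶ M) (g : Y ⟶ N) :
    (g ≫ inr M N) ⊛ (f ≫ inl M N) = (β_ Y X).hom ≫ (f ⊗ₘ g) := by
  rw [← tensorHom_mulMap, ← braiding_naturality]
  have : inr M N ⊛ inl M N = (β_ N M).hom := by
    calc
      _ = 𝟙 _ ⊗≫ (N ⊗ M) ◁ η[N] ⊗≫ (η[M] ▷ N) ▷ (M ⊗ N) ⊗≫ M ◁ (β_ N M).hom ▷ N ⊗≫
          (μ[M] ⊗ₘ μ[N]) := by
        simp only [mulMap, inl, inr, MonObj.tensorObj.mul_def, tensorμ,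
          tensorHom_def']
        monoidal
      _ = 𝟙 _ ⊗≫ (N ⊗ M) ◁ η[N] ⊗≫ (η[M] ▷ (N ⊗ M) ≫ M ◁ (β_ N M).hom) ▷ N ⊗≫
          (μ[M] ⊗ₘ μ[N]) := by monoidal
      _ = 𝟙 _ ⊗≫ ((N ⊗ M) ◁ η[N] ≫ (β_ N M).hom ▷ N) ⊗≫ (η[M] ▷ M ≫ μ[M]) ▷ N ▷ N ⊗≫
          M ◁ μ[N] := by
        rw [← whisker_exchange, MonoidalCategory.tensorHom_def]
        monoidal
      _ = 𝟙 _ ⊗≫ (β_ N M).hom ⊗≫ M ◁ (N ◁ η[N] ≫ μ[N]) := by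
        rw [MonObj.one_mul, whisker_exchange]; monoidal
      _ = _ := by rw [MonObj.mul_one]; monoidal
  rw [this]

lemma tensorHom_mulMap_inr (f : X ⟶ M) (g : Y ⟶ N) (h : Z ⟶ N) :
    (f ⊗ₘ g) ⊛ (h ≫ inr M N) = (α_ X Y Z).hom ≫ (f ⊗ₘ (g ⊛ h)) := by
  rw [← inl_mulMap_inr, mulMap_assoc, ← mulMap_comp, inl_mulMap_inr]

lemma inl_mulMap_tensorHom (f : X ⟶ M) (g : Y ⟶ M) (h : Z ⟶ N) :
    (f ≫ inl M N) ⊛ (g ⊗ₘ h) = (α_ X Y Z).inv ≫ ((f ⊛ g) ⊗ₘ h) := by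
  rw [← inl_mulMap_inr, mulMap_assoc', ← mulMap_comp, inl_mulMap_inr]

lemma inr_mulMap_tensorHom (f : X ⟶ N) (g : Y ⟶ M) (h : Z ⟶ N) :
    (f ≫ inr M N) ⊛ (g ⊗ₘ h) =
      (α_ X Y Z).inv ≫ (β_ X Y).hom ▷ Z ≫ (α_ Y X Z).hom ≫ (g ⊗ₘ (f ⊛ h)) := by
  rw [← inl_mulMap_inr, mulMap_assoc', inr_mulMap_inl, ← whiskerRight_mulMap,
    tensorHom_mulMap_inr]

lemma tensorHom_mulMap_tensorHom (f : X ⟶ M) (g : Y ⟶ N) (h : Z ⟶ M) (k : W ⟶ N) :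
    (f ⊗ₘ g) ⊛ (h ⊗ₘ k) = tensorμ X Y Z W ≫ ((f ⊛ h) ⊗ₘ (g ⊛ k)) := by
  simp only [mulMap, MonObj.tensorObj.mul_def]
  rw [tensorμ_natural_assoc, tensorHom_comp_tensorHom]

lemma lmul_inl (r : 𝟙_ C ⟶ M) : lmul (r ≫ inl M N) = lmul r ▷ N := by
  rw [← Category.id_comp (lmul _), comp_lmul, ← id_tensorHom_id, inl_mulMap_tensorHom,
    ← tensorHom_id, ← Category.id_comp (lmul r), comp_lmul, tensorHom_id, tensorHom_id]
  monoidal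

lemma inr_lmul_inl (r : 𝟙_ C ⟶ M) : inr M N ≫ lmul (r ≫ inl M N) = (λ_ N).inv ≫ r ▷ N := by
  rw [comp_lmul]
  have := inl_mulMap_inr r (𝟙 N)
  rw [Category.id_comp] at this
  rw [this, tensorHom_id]

lemma inr_rmul_inl (r : 𝟙_ C ⟶ M) : inr M N ≫ rmul (r ≫ inl M N) = (λ_ N).inv ≫ r ▷ N := by
  rw [comp_rmul]
  have := inr_mulMap_inl r (𝟙 N)
  rw [Category.id_comp] at this
  rw [this, tensorHom_id, braiding_tensorUnit_right]
  simp

lemma rmul_inl (r : 𝟙_ C ⟶ M) : rmul (r ≫ inl M N) = rmul r ▷ N := by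
  have h := inl_mulMap_inr (𝟙 M) (𝟙 N)
  have h' := inl_mulMap_inr (rmul r) (𝟙 N)
  rw [Category.id_comp] at h h'
  rw [← Category.id_comp (rmul (r ≫ _)), ← id_tensorHom_id, ← h, mulMap_rmul, Category.id_comp,
    inr_rmul_inl, ← inr_lmul_inl, ← rmul_mulMap, ← rmul_comp, h', tensorHom_id]

lemma lmul_inr (r : 𝟙_ C ⟶ N) : lmul (r ≫ inr M N) = M ◁ lmul r := by
  have h := inl_mulMap_inr (𝟙 M) (𝟙 N)
  have h' := inl_mulMap_inr (𝟙 M) (lmul r)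
  have e : inl M N ≫ lmul (r ≫ inr M N) = inl M N ≫ rmul (r ≫ inr M N) := by
    have h1 := inl_mulMap_inr (𝟙 M) r
    have h2 := inr_mulMap_inl (𝟙 M) r
    rw [Category.id_comp] at h1 h2
    rw [comp_lmul, comp_rmul, h1, h2, braiding_tensorUnit_left]
    simp
  rw [Category.id_comp] at h h'
  rw [← Category.id_comp (lmul (r ≫ _)), ← id_tensorHom_id, ← h, mulMap_lmul, Category.id_comp, e,
    rmul_mulMap, ← lmul_comp, h', id_tensorHom]

/-- An element `r ⊗ 1` of `M ⊗ N`, with `r : 𝟙 ⟶ M`, commutes with all elements `1 ⊗ y`: no braiding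
is needed to move `r` past `y`, because `r` is defined on the unit object. -/
lemma inr_lmul_eq_rmul (r : 𝟙_ C ⟶ M) (f : X ⟶ N) :
    (f ≫ inr M N) ≫ lmul (r ≫ inl M N) = (f ≫ inr M N) ≫ rmul (r ≫ inl M N) := by
  rw [Category.assoc, Category.assoc, inr_lmul_inl, inr_rmul_inl]

end TensorElements

section Reverse

variable {C : Type u} [Category.{v} C] [MonoidalCategory C] [BraidedCategory C]
  {M N : C}

/-- The tensor product of two monoid objects formed with the inverse braiding. -/
abbrev revTensor (M N : C) [MonObj M] [MonObj N] : MonObj (M ⊗ N) :=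
  @Mon.instMonObjTensorObj C _ _ (reverseBraiding C) M N _ _

lemma inl_comp_braiding [MonObj N] : inl M N ≫ (β_ M N).hom = inr N M := by
  simp [inl, inr]

lemma inr_comp_braiding [MonObj M] : inr M N ≫ (β_ M N).hom = inl N M := by
  simp [inl, inr]

/-- The braiding is an isomorphism from the tensor product of two monoids formed with the
inverse braiding to the tensor product, in the other order, formed with the braiding. -/
lemma isMonHom_braiding [MonObj M] [MonObj N] :
    @IsMonHom C _ _ _ _ (revTensor M N) _ (β_ M N).hom := by
  refine @IsMonHom.mk C _ _ _ _ (revTensor M N) _ _ ?_ ?_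
  · simp [MonObj.tensorObj.one_def, unitors_inv_equal]
  · simp only [MonObj.tensorObj.mul_def, Category.assoc, braiding_naturality]
    rw [reassoc_of% tensorμ_reverse_braiding M N M N]

end Reverse

/-! ### Copairings -/

section Copairing

variable {C : Type u} [Category.{v} C] [MonoidalCategory C] {K : C} [MonObj K]

/-- The multiplicativity of `R : 𝟙 ⟶ K ⊗ K` in its left leg, where `d` is the comultiplication. -/
def IsLeftCopairing (d : K ⟶ K ⊗ K) (R : 𝟙_ C ⟶ K ⊗ K) : Prop :=
  R ≫ d ▷ K = R ≫ K ◁ ((λ_ K).inv ≫ R ▷ K ≫ (α_ K K K).hom ≫ K ◁ μ[K]) ≫ (α_ K K K).inv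

/-- The multiplicativity of `R : 𝟙 ⟶ K ⊗ K` in its right leg, where `d` is the comultiplication. -/
def IsRightCopairing (d : K ⟶ K ⊗ K) (R : 𝟙_ C ⟶ K ⊗ K) : Prop :=
  R ≫ K ◁ d = R ≫ ((ρ_ K).inv ≫ K ◁ R ≫ (α_ K K K).inv ≫ μ[K] ▷ K) ▷ K ≫ (α_ K K K).hom

/-- The map `x ⊗ y ↦ x ⊗ 1 ⊗ y`. -/
abbrev emb13 (K : C) [MonObj K] : K ⊗ K ⟶ (K ⊗ K) ⊗ K := inl K K ▷ K

/-- The map `x ⊗ y ↦ 1 ⊗ x ⊗ y`. -/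
abbrev emb23 (K : C) [MonObj K] : K ⊗ K ⟶ (K ⊗ K) ⊗ K := inr K K ▷ K

/-- The map `x ⊗ y ↦ x ⊗ y ⊗ 1`. -/
abbrev emb12 (K : C) [MonObj K] : K ⊗ K ⟶ (K ⊗ K) ⊗ K := inl (K ⊗ K) K

lemma emb13_associator : emb13 K ≫ (α_ K K K).hom = K ◁ inr K K := by
  simp only [emb13, inl, inr]; monoidal

lemma emb12_associator : emb12 K ≫ (α_ K K K).hom = K ◁ inl K K := by
  simp only [emb12, inl]; monoidal

lemma emb23_associator : emb23 K ≫ (α_ K K K).hom = inr K (K ⊗ K) := by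
  simp only [emb23, inr]; monoidal

variable [BraidedCategory C]

/-- The copairing condition in the second leg reads `(id ⊗ d)(R) = R₁₃ R₁₂` in `K ⊗ K ⊗ K`. -/
lemma isRightCopairing_iff {d : K ⟶ K ⊗ K} {R : 𝟙_ C ⟶ K ⊗ K} :
    IsRightCopairing d R ↔
      R ≫ K ◁ d ≫ (α_ K K K).inv = (R ≫ emb13 K) ≫ rmul (R ≫ emb12 K) := by
  have h : inl K K ≫ rmul R = (ρ_ K).inv ≫ K ◁ R ≫ (α_ K K K).inv ≫ μ[K] ▷ K := by
    have := inl_mulMap_tensorHom (𝟙 K) (𝟙 K) (𝟙 K)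
    rw [comp_rmul, ← Category.comp_id R, ← id_tensorHom_id, ← whiskerLeft_mulMap,
      ← Category.id_comp (inl K K), this]
    simp [mulMap]
  rw [rmul_inl, Category.assoc, ← comp_whiskerRight, h, IsRightCopairing,
    ← Category.assoc R (K ◁ d), Iso.comp_inv_eq, Category.assoc]

/-- The copairing condition in the first leg reads `(d ⊗ id)(R) = R₂₃ R₁₃` in `K ⊗ K ⊗ K`. -/
lemma isLeftCopairing_iff {d : K ⟶ K ⊗ K} {R : 𝟙_ C ⟶ K ⊗ K} :
    IsLeftCopairing d R ↔ R ≫ d ▷ K = (R ≫ emb13 K) ≫ lmul (R ≫ emb23 K) := by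
  have h : inr K K ≫ lmul R = (λ_ K).inv ≫ R ▷ K ≫ (α_ K K K).hom ≫ K ◁ μ[K] := by
    have := tensorHom_mulMap_inr (𝟙 K) (𝟙 K) (𝟙 K)
    rw [comp_lmul, ← Category.comp_id R, ← id_tensorHom_id, ← whiskerRight_mulMap,
      ← Category.id_comp (inr K K), this]
    simp [mulMap]
  have h2 : emb13 K = K ◁ inr K K ≫ (α_ K K K).inv := by
    rw [← emb13_associator, Category.assoc, Iso.hom_inv_id, Category.comp_id]
  have h3 : emb23 K = inr K (K ⊗ K) ≫ (α_ K K K).inv := by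
    rw [← emb23_associator, Category.assoc, Iso.hom_inv_id, Category.comp_id]
  rw [IsLeftCopairing, h2, h3, ← Category.assoc R (inr K _), Category.assoc, Category.assoc,
    ← lmul_comp, lmul_inr, ← h, whiskerLeft_comp]
  simp only [Category.assoc]

/-- The half twist `(K ⊗ K) ⊗ K ⟶ (K ⊗ K) ⊗ K`, an isomorphism from the tensor cube formed with
the inverse braiding to the one formed with the braiding. -/
abbrev halfTwist (K : C) : (K ⊗ K) ⊗ K ⟶ (K ⊗ K) ⊗ K :=
  (α_ K K K).hom ≫ K ◁ (β_ K K).hom ≫ (β_ K (K ⊗ K)).hom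

/-- The tensor cube of a monoid object formed with the inverse braiding. -/
abbrev revTensorCube (K : C) [MonObj K] : MonObj ((K ⊗ K) ⊗ K) :=
  @Mon.instMonObjTensorObj C _ _ (reverseBraiding C) (K ⊗ K) K (revTensor K K) _

lemma isMonHom_halfTwist : @IsMonHom C _ _ _ _ (revTensorCube K) _ (halfTwist K) := by
  let P' : MonObj (K ⊗ (K ⊗ K)) :=
    @Mon.instMonObjTensorObj C _ _ (reverseBraiding C) K (K ⊗ K) _ (revTensor K K)
  let P'' : MonObj (K ⊗ (K ⊗ K)) := revTensor K (K ⊗ K)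
  have h1 : @IsMonHom C _ _ _ _ (revTensorCube K) P' (α_ K K K).hom :=
    @MonObj.instIsMonHomHomAssociator C _ _ (reverseBraiding C) K K K _ _ _
  have h0 : @IsMonHom C _ _ _ _ (revTensor K K) _ (β_ K K).hom := isMonHom_braiding
  have h2 : @IsMonHom C _ _ _ _ P' P'' (K ◁ (β_ K K).hom) :=
    @MonObj.instIsMonHomWhiskerLeft C _ _ (reverseBraiding C) K (K ⊗ K) (K ⊗ K) _ (revTensor K K) _
      (β_ K K).hom h0
  have h3 : @IsMonHom C _ _ _ _ P'' _ (β_ K (K ⊗ K)).hom := isMonHom_braiding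
  exact @instIsMonHomComp C _ _ _ _ _ (revTensorCube K) P' _ _ _ h1
    (@instIsMonHomComp C _ _ _ _ _ P' P'' _ _ _ h2 h3)

lemma IsInverse.braiding_inv {R R' : 𝟙_ C ⟶ K ⊗ K} (h : IsInverse R R') :
    @IsInverse C _ _ _ (revTensor K K) (R ≫ (β_ K K).inv) (R' ≫ (β_ K K).inv) := by
  have : @IsMonHom C _ _ _ _ (revTensor K K) _ (β_ K K).hom := isMonHom_braiding
  have h' : @IsMonHom C _ _ _ _ _ (revTensor K K) (β_ K K).inv :=
    @instIsMonHomInvOfHom C _ _ _ _ (revTensor K K) _ (β_ K K) this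
  exact @IsInverse.comp C _ _ _ _ _ (revTensor K K) R R' h (β_ K K).inv h'

/-- Passing to the inverse braiding and the inverse of `R` exchanges the two copairing
conditions. -/
lemma isLeftCopairing_iff_reverse {d : K ⟶ K ⊗ K} [hd : IsMonHom (d ≫ (β_ K K).hom)]
    {R R' : 𝟙_ C ⟶ K ⊗ K} (h : IsInverse R R') :
    IsLeftCopairing (d ≫ (β_ K K).hom) R ↔ IsRightCopairing d (R' ≫ (β_ K K).inv) := by
  rw [isLeftCopairing_iff, @isRightCopairing_iff C _ _ K _ (reverseBraiding C)]
  have e1 : ((R' ≫ (β_ K K).inv) ≫ K ◁ d ≫ (α_ K K K).inv) ≫ halfTwist K =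
      R' ≫ (d ≫ (β_ K K).hom) ▷ K := by
    simp only [Category.assoc]
    rw [Iso.inv_hom_id_assoc, ← whiskerLeft_comp_assoc, braiding_naturality_right,
      Iso.inv_hom_id_assoc]
  have e2 : (β_ K K).inv ≫ emb13 K ≫ halfTwist K = emb13 K := by
    rw [reassoc_of% emb13_associator, ← whiskerLeft_comp_assoc, inr_comp_braiding,
      braiding_naturality_right, Iso.inv_hom_id_assoc]
  have e3 : (β_ K K).inv ≫ emb12 K ≫ halfTwist K = emb23 K := by
    rw [reassoc_of% emb12_associator, ← whiskerLeft_comp_assoc, inl_comp_braiding,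
      braiding_naturality_right, Iso.inv_hom_id_assoc]
  have e4 : (((R' ≫ (β_ K K).inv) ≫ emb13 K) ≫
      @rmul C _ _ _ (revTensorCube K) ((R' ≫ (β_ K K).inv) ≫ emb12 K)) ≫ halfTwist K =
      (R' ≫ emb13 K) ≫ rmul (R' ≫ emb23 K) := by
    have := @rmul_comp C _ _ _ _ (revTensorCube K) _ ((R' ≫ (β_ K K).inv) ≫ emb12 K)
      (halfTwist K) isMonHom_halfTwist
    rw [Category.assoc, this]
    simp only [Category.assoc]
    rw [e3, reassoc_of% e2]
  -- the two sides of the condition for `R` are the inverses of those of the twisted condition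
  have i1 := h.comp ((d ≫ (β_ K K).hom) ▷ K)
  have i2 := (h.comp (emb23 K)).mul (h.comp (emb13 K))
  refine Iff.trans ?_ (cancel_mono (halfTwist K))
  rw [e1, e4, elem_rmul]
  constructor
  · intro e
    rw [e] at i1
    exact i1.eq_of_eq i2
  · intro e
    rw [e] at i1
    exact i1.symm.eq_of_eq i2.symm

end Copairing

/-! ### The reversed quasitriangular bialgebra -/

namespace QuasitriangularBialgebra

variable {C : Type u} [Category.{v} C] [MonoidalCategory C] [BraidedCategory C]
  (A : C) [QA : QuasitriangularBialgebra A]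

/-- The comonoid structure of `Ā`, with the counit of `A`. -/
abbrev barComon : ComonObj A where
  comul := comulBar A
  counit := ε[A]
  counit_comul := ModO.counit_comulBar
  comul_counit := ModO.comulBar_counit
  comul_assoc := ModO.comulBar_coassoc.symm

/-- The bialgebra `Ā` with the algebra structure and the counit of `A`. -/
abbrev barBimon : @BimonObj C _ _ (reverseBraiding C) A :=
  @BimonObj.mk C _ _ (reverseBraiding C) A QA.toMonObj (barComon A)
    (by
      have := QA.bar.mul_comul
      rw [bar_mul] at this
      exact this)
    (by
      have : QA.bar.one ≫ comulBar A = (λ_ _).inv ≫ (QA.bar.one ⊗ₘ QA.bar.one) := QA.bar.one_comul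
      rw [bar_one] at this
      exact this)
    (BimonObj.mul_counit A) (BimonObj.one_counit A)

lemma isMonHom_comulBar : @IsMonHom C _ _ _ _ _ (revTensor A A) (comulBar A) :=
  @IsMonHom.mk C _ _ _ _ _ (revTensor A A) _ (barBimon A).one_comul
    (barBimon A).mul_comul

instance isMonHom_comulBar_braiding : IsMonHom (comulBar A ≫ (β_ A A).hom) :=
  @instIsMonHomComp C _ _ _ _ _ _ (revTensor A A) _ _ _ (isMonHom_comulBar A) isMonHom_braiding

instance isMonHom_comul : IsMonHom Δ[A] where
  one_hom := BimonObj.one_comul A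
  mul_hom := BimonObj.mul_comul A

instance isMonHom_counit : IsMonHom ε[A] where
  one_hom := BimonObj.one_counit A
  mul_hom := by rw [BimonObj.mul_counit]; rfl

lemma isInverse_R : IsInverse QA.R QA.Rinv where
  mul_inv := by rw [comp_lmul]; exact QA.R_mul_Rinv
  inv_mul := by rw [comp_lmul]; exact QA.Rinv_mul_R

lemma comulBar_braiding_rmul_R : (comulBar A ≫ (β_ A A).hom) ≫ rmul QA.R = Δ[A] ≫ lmul QA.R := by
  rw [comp_rmul, comp_lmul]; exact QA.comul_R

/-- The intertwining property of `R`, rewritten for `R⁻¹`. -/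
lemma comul_Rinv : Δ[A] ≫ rmul QA.Rinv = (comulBar A ≫ (β_ A A).hom) ≫ lmul QA.Rinv := by
  have hR := isInverse_R A
  rw [← hR.eq_comp_lmul_iff.1 (comulBar_braiding_rmul_R A)]
  simp only [Category.assoc]
  rw [lmul_rmul_comm, reassoc_of% hR.rmul_rmul]

lemma isInverse_Rbar :
    @IsInverse C _ _ _ (revTensor A A) (QA.Rinv ≫ (β_ A A).inv) (QA.R ≫ (β_ A A).inv) :=
  (isInverse_R A).symm.braiding_inv

/-- The intertwining property of the R-matrix `Ψ⁻¹ R⁻¹` of the reversed bialgebra. -/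
lemma braiding_inv_comul_R :
    (ρ_ A).inv ≫ ((Δ[A] ≫ (β_ A A).inv) ⊗ₘ (QA.Rinv ≫ (β_ A A).inv)) ≫ (revTensor A A).mul =
      (λ_ A).inv ≫ ((QA.Rinv ≫ (β_ A A).inv) ⊗ₘ comulBar A) ≫ (revTensor A A).mul := by
  have hb : @IsMonHom C _ _ _ _ (revTensor A A) _ (β_ A A).hom := isMonHom_braiding
  have h1 := @IsMonHom.mul_hom C _ _ _ _ (revTensor A A) _ (β_ A A).hom hb
  rw [← cancel_mono (β_ A A).hom]
  simp only [Category.assoc]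
  rw [h1, tensorHom_comp_tensorHom_assoc, tensorHom_comp_tensorHom_assoc]
  simp only [Category.assoc, Iso.inv_hom_id, Category.comp_id]
  have h := comul_Rinv A
  rw [comp_rmul, comp_lmul] at h
  exact h

lemma Rinv_counit_left : QA.Rinv ≫ ε[A] ▷ A ≫ (λ_ A).hom = η[A] := by
  have h := (isInverse_R A).comp (ε[A] ▷ A ≫ (λ_ A).hom)
  rw [QA.R_counit_left] at h
  have := h.mul_inv
  rwa [lmul_one, Category.comp_id] at this

lemma Rinv_counit_right : QA.Rinv ≫ A ◁ ε[A] ≫ (ρ_ A).hom = η[A] := by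
  have h := (isInverse_R A).comp (A ◁ ε[A] ≫ (ρ_ A).hom)
  rw [QA.R_counit_right] at h
  have := h.mul_inv
  rwa [lmul_one, Category.comp_id] at this

/-- The quasitriangular bialgebra `(Ā, A, Ψ⁻¹ R⁻¹)` in the category with the inverse braiding. -/
@[reducible]
def reverse : @QuasitriangularBialgebra C _ _ (reverseBraiding C) A :=
  @QuasitriangularBialgebra.mk C _ _ (reverseBraiding C) A (barBimon A) QA.toBimonObj rfl rfl rfl
    (QA.Rinv ≫ (β_ A A).inv) (QA.R ≫ (β_ A A).inv)
    (@IsInverse.tensorHom_mul C _ _ _ (revTensor A A) _ _ (isInverse_Rbar A))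
    (@IsInverse.tensorHom_mul C _ _ _ (revTensor A A) _ _
      (@IsInverse.symm C _ _ _ (revTensor A A) _ _ (isInverse_Rbar A)))
    (by
      have : (QA.Rinv ≫ (β_ A A).inv) ≫ ε[A] ▷ A ≫ (λ_ A).hom = η[A] := by
        rw [Category.assoc, ← braiding_inv_naturality_right_assoc, ← Rinv_counit_right A]
        simp
      exact this)
    (by
      have : (QA.Rinv ≫ (β_ A A).inv) ≫ A ◁ ε[A] ≫ (ρ_ A).hom = η[A] := by
        rw [Category.assoc, ← braiding_inv_naturality_left_assoc, ← Rinv_counit_left A]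
        simp
      exact this)
    (by
      have hd : @IsMonHom C _ _ _ _ _ (revTensor A A) (Δ[A] ≫ (β_ A A).inv) :=
        @instIsMonHomComp C _ _ _ _ _ _ _ (revTensor A A) Δ[A] (β_ A A).inv _
          (@instIsMonHomInvOfHom C _ _ _ _ (revTensor A A) _ (β_ A A) isMonHom_braiding)
      refine (@isLeftCopairing_iff_reverse C _ _ A _ (reverseBraiding C) Δ[A] hd _ _
        (isInverse_Rbar A)).2 ?_
      have : (QA.R ≫ (β_ A A).inv) ≫ (β_ A A).hom = QA.R := by simp
      change IsRightCopairing Δ[A] ((QA.R ≫ (β_ A A).inv) ≫ (β_ A A).hom)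
      rw [this]
      exact QA.R_comul_right)
    ((isLeftCopairing_iff_reverse (isInverse_R A)).1 QA.R_comul_left)
    (braiding_inv_comul_R A)

end QuasitriangularBialgebra

/-! ### Modules, monoids and comonoids in `C_{O(A, Ā)}` -/

section

variable {C : Type u} [Category.{v} C] [MonoidalCategory C] [BraidedCategory C] {A X K : C}
  [MonObj K]

/-- Moving `a` past `x` and then taking its coproduct amounts to moving both legs of the coproduct
past `x`, where only the second one acts. -/
lemma swapAct_comul (δ : A ⟶ A ⊗ A) (hδ : δ ≫ δ ▷ A ≫ (α_ A A A).hom = δ ≫ A ◁ δ)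
    (a : X ⊗ A ⟶ X) : X ◁ δ ≫ (α_ X A A).inv ≫ (β_ X A).hom ▷ A ≫ (α_ A X A).hom ≫
      A ◁ swapAct δ a = swapAct δ a ≫ δ ▷ X ≫ (α_ A A X).hom := by
  simp only [swapAct]
  calc
    _ = 𝟙 _ ⊗≫ X ◁ δ ⊗≫ ((β_ X A).hom ▷ A ≫ (A ⊗ X) ◁ δ) ⊗≫ A ◁ (β_ X A).hom ▷ A ⊗≫
          A ◁ A ◁ a := by monoidal
    _ = 𝟙 _ ⊗≫ X ◁ (δ ≫ A ◁ δ) ⊗≫ (β_ X A).hom ▷ (A ⊗ A) ⊗≫ A ◁ (β_ X A).hom ▷ A ⊗≫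
          A ◁ A ◁ a := by
      rw [← whisker_exchange]; monoidal
    _ = 𝟙 _ ⊗≫ X ◁ δ ⊗≫ (X ◁ δ ≫ (β_ X (A ⊗ A)).hom) ▷ A ⊗≫ (A ⊗ A) ◁ a ⊗≫ 𝟙 _ := by
      rw [← hδ]
      simp only [braiding_tensor_right_hom]
      monoidal
    _ = 𝟙 _ ⊗≫ X ◁ δ ⊗≫ (β_ X A).hom ▷ A ⊗≫ (δ ▷ (X ⊗ A) ≫ (A ⊗ A) ◁ a) ⊗≫ 𝟙 _ := by
      rw [braiding_naturality_right]; monoidal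
    _ = _ := by rw [← whisker_exchange]; monoidal

/-- The elements `1 ⊗ y` and the coproduct of `a` commute past each other through the action. -/
lemma inr_mulMap_comul {δ : A ⟶ A ⊗ A} (hδ : δ ≫ δ ▷ A ≫ (α_ A A A).hom = δ ≫ A ◁ δ)
    {a : X ⊗ A ⟶ X} {i : A ⟶ K} {j : X ⟶ K} (h : j ⊛ i = swapAct δ a ≫ (i ⊛ j)) :
    (j ≫ inr K K) ⊛ (δ ≫ (i ⊗ₘ i)) = swapAct δ a ≫ ((δ ≫ (i ⊗ₘ i)) ⊛ (j ≫ inr K K)) := by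
  have e2 : (i ⊗ₘ (swapAct δ a ≫ (i ⊛ j))) = A ◁ swapAct δ a ≫ (i ⊗ₘ (i ⊛ j)) := by
    rw [← id_tensorHom, tensorHom_comp_tensorHom, Category.id_comp]
  have key := swapAct_comul δ hδ a
  rw [← whiskerLeft_mulMap, inr_mulMap_tensorHom, h, ← whiskerRight_mulMap,
    tensorHom_mulMap_inr, e2]
  simp only [← Category.assoc] at key ⊢
  rw [key]

end

section Module

variable {C : Type u} [Category.{v} C] [MonoidalCategory C] [BraidedCategory C]
  {A : C} [QA : QuasitriangularBialgebra A]

namespace ModO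

/-- The underlying object of a monoid object of `C_{O(A, Ā)}` is a monoid object of `C`. -/
instance monObj (X : ModO A) [MonObj X] : MonObj X.obj where
  one := η[X].hom
  mul := μ[X].hom
  one_mul := congrArg Hom.hom (MonObj.one_mul X)
  mul_one := congrArg Hom.hom (MonObj.mul_one X)
  mul_assoc := congrArg Hom.hom (MonObj.mul_assoc X)

/-- A morphism of monoid objects of `C_{O(A, Ā)}` is a morphism of monoid objects of `C`. -/
instance isMonHom_hom {X Y : ModO A} [MonObj X] [MonObj Y] (f : X ⟶ Y) [IsMonHom f] :
    IsMonHom f.hom where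
  one_hom := congrArg Hom.hom (IsMonHom.one_hom f)
  mul_hom := (congrArg Hom.hom (IsMonHom.mul_hom f)).trans (by simp; rfl)

/-- The tensor product of monoids in `C_{O(A, Ā)}` has the multiplication twisted by the braiding of
`C_{O(A, Ā)}`; its underlying monoid is not the tensor product formed in `C`. -/
lemma tensor_mul_hom (X Y : ModO A) [MonObj X] [MonObj Y] :
    μ[(X ⊗ Y : ModO A).obj] = twistMul (crossedBraiding Y.act (coact X)) μ[X.obj] μ[Y.obj] := by
  change (tensorμ X Y X Y ≫ (μ[X] ⊗ₘ μ[Y])).hom = _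
  simp only [tensorμ, twistMul, comp_hom, tensorHom_hom, whiskerLeft_hom, whiskerRight_hom,
    whiskerLeft_comp, Category.assoc]
  rfl

lemma tensor_one_hom (X Y : ModO A) [MonObj X] [MonObj Y] :
    η[(X ⊗ Y : ModO A).obj] = (λ_ (𝟙_ C)).inv ≫ (η[X.obj] ⊗ₘ η[Y.obj]) := by
  change ((λ_ (𝟙_ (ModO A))).inv ≫ (η[X] ⊗ₘ η[Y])).hom = _
  simp only [comp_hom, tensorHom_hom]
  rfl

/-- The underlying object of a comonoid object of `C_{O(A, Ā)}` is a comonoid object of `C`. -/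
instance comonObj (X : ModO A) [ComonObj X] : ComonObj X.obj where
  counit := ε[X].hom
  comul := Δ[X].hom
  counit_comul := congrArg Hom.hom (ComonObj.counit_comul X)
  comul_counit := congrArg Hom.hom (ComonObj.comul_counit X)
  comul_assoc := congrArg Hom.hom (ComonObj.comul_assoc X)

lemma swapAct_naturality {X Y : ModO A} (f : X ⟶ Y) :
    f.hom ▷ A ≫ swapAct Δ[A] Y.act = swapAct Δ[A] X.act ≫ A ◁ f.hom := by
  simp only [swapAct]
  calc
    _ = 𝟙 _ ⊗≫ (f.hom ▷ A ≫ Y.obj ◁ Δ[A]) ⊗≫ (β_ Y.obj A).hom ▷ A ⊗≫ A ◁ Y.act := by monoidal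
    _ = 𝟙 _ ⊗≫ X.obj ◁ Δ[A] ⊗≫ (f.hom ▷ A ≫ (β_ Y.obj A).hom) ▷ A ⊗≫ A ◁ Y.act := by
      rw [← whisker_exchange]; monoidal
    _ = 𝟙 _ ⊗≫ X.obj ◁ Δ[A] ⊗≫ (β_ X.obj A).hom ▷ A ⊗≫ A ◁ (f.hom ▷ A ≫ Y.act) := by
      rw [braiding_naturality_left]; monoidal
    _ = _ := by rw [← act_hom]; monoidal

lemma swapAct_tensor (X Y : ModO A) : swapAct Δ[A] (X ⊗ Y).act =
    (α_ X.obj Y.obj A).hom ≫ X.obj ◁ swapAct Δ[A] Y.act ≫ (α_ X.obj A Y.obj).inv ≫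
      swapAct Δ[A] X.act ▷ Y.obj ≫ (α_ A X.obj Y.obj).hom :=
  swapAct_diagAct _ comul_coassoc' _ _

lemma coact_naturality {X Y : ModO A} (f : X ⟶ Y) : f.hom ≫ coact Y = coact X ≫ f.hom ▷ A := by
  simp only [coact, coaction, Category.assoc]
  rw [rightUnitor_inv_naturality_assoc, ← whisker_exchange_assoc,
    associator_inv_naturality_left_assoc, ← comp_whiskerRight, ← comp_whiskerRight, act_hom]

lemma coact_counit (X : ModO A) : coact X ≫ X.obj ◁ ε[A] = (ρ_ X.obj).inv := by
  have h := QA.R_counit_right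
  calc
    _ = 𝟙 _ ⊗≫ X.obj ◁ QA.R ⊗≫ (X.act ▷ A ≫ X.obj ◁ ε[A]) := by
      simp only [coact, coaction]; monoidal
    _ = 𝟙 _ ⊗≫ X.obj ◁ (QA.R ≫ A ◁ ε[A] ≫ (ρ_ A).hom) ⊗≫ X.act ⊗≫ 𝟙 _ := by
      rw [← whisker_exchange]; monoidal
    _ = 𝟙 _ ⊗≫ (X.obj ◁ η[A] ≫ X.act) ⊗≫ 𝟙 _ := by rw [h]; monoidal
    _ = _ := by rw [X.act_one]; monoidal

/-- The codiagonal coaction on a tensor product. -/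
abbrev tensorCoact (X Y : ModO A) : X.obj ⊗ Y.obj ⟶ (X.obj ⊗ Y.obj) ⊗ A :=
  (coact X ⊗ₘ coact Y) ≫ tensorμ X.obj A Y.obj A ≫ (X.obj ⊗ Y.obj) ◁ μ[A]

lemma coact_tensor_eq_tensorCoact (X Y : ModO A) : coact (X ⊗ Y) = tensorCoact X Y := by
  rw [coact_tensor, tensorCoact, tensorμ, MonoidalCategory.tensorHom_def]
  monoidal

lemma comul_tensorCoact (X : ModO A) [ComonObj X] :
    Δ[X.obj] ≫ tensorCoact X X = coact X ≫ Δ[X.obj] ▷ A := by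
  rw [← coact_tensor_eq_tensorCoact]
  exact coact_naturality Δ[X]

lemma coact_unit : coact (𝟙_ (ModO A)) = η[A] ≫ (λ_ A).inv := by
  have h := QA.R_counit_left
  have e : coaction QA.R ((λ_ A).hom ≫ ε[A]) = η[A] ≫ (λ_ A).inv := by
    calc
      _ = 𝟙 _ ⊗≫ (QA.R ≫ ε[A] ▷ A ≫ (λ_ A).hom) ⊗≫ 𝟙 _ := by
        simp only [coaction]; monoidal
      _ = _ := by rw [h]; monoidal
  exact e

lemma coact_counit_map (X : ModO A) [ComonObj X] :
    coact X ≫ ε[X.obj] ▷ A = ε[X.obj] ≫ η[A] ≫ (λ_ A).inv := by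
  rw [← coact_unit]
  exact (coact_naturality ε[X]).symm

lemma comul_swapAct (X : ModO A) [ComonObj X] :
    Δ[X.obj] ▷ A ≫ swapAct Δ[A] (diagAct Δ[A] X.act X.act) = swapAct Δ[A] X.act ≫ A ◁ Δ[X.obj] :=
  swapAct_naturality Δ[X]

lemma counit_swapAct (X : ModO A) [ComonObj X] :
    swapAct Δ[A] X.act ≫ A ◁ ε[X.obj] = ε[X.obj] ▷ A ≫ (λ_ A).hom ≫ (ρ_ A).inv := by
  rw [← swapAct_unit Δ[A] ε[A] (by simp)]
  exact (swapAct_naturality ε[X]).symm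

/-- Coassociativity of the coaction, a consequence of the copairing condition in the second leg. -/
lemma coact_coassoc (X : ModO A) :
    coact X ≫ coact X ▷ A ≫ (α_ X.obj A A).hom = coact X ≫ X.obj ◁ Δ[A] :=
  coaction_coassoc _ _ QA.R_comul_right _ X.act_mul

/-- Moving `x` to the right past the left leg of `R` produces `R` times the coaction of `x`. This is
where membership in `C_{O(A, Ā)}` enters: it replaces `Δ` by the comultiplication of `Ā`, for which
the copairing condition in the first leg holds. -/
lemma swapAct_R (X : ModO A) :
    (ρ_ X.obj).inv ≫ X.obj ◁ QA.R ≫ (α_ X.obj A A).inv ≫ swapAct Δ[A] X.act ▷ A =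
      (λ_ X.obj).inv ≫ (QA.R ⊗ₘ coact X) ≫ tensorμ A A X.obj A ≫ (A ⊗ X.obj) ◁ μ[A] := by
  rw [X.swap_eq, swapAct_reverse]
  calc
    _ = 𝟙 _ ⊗≫ X.obj ◁ (QA.R ≫ (comulBar A ≫ (β_ A A).hom) ▷ A) ⊗≫ X.act ▷ A ▷ A ⊗≫
          (β_ A X.obj).inv ▷ A := by monoidal
    _ = 𝟙 _ ⊗≫ X.obj ◁ QA.R ⊗≫ ((X.obj ⊗ A) ◁ ((λ_ A).inv ≫ QA.R ▷ A ≫ (α_ A A A).hom ≫ A ◁ μ[A]) ≫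
          X.act ▷ (A ⊗ A)) ⊗≫ (β_ A X.obj).inv ▷ A := by
      rw [QA.R_comul_left]; monoidal
    _ = 𝟙 _ ⊗≫ X.obj ◁ QA.R ⊗≫ X.act ▷ A ⊗≫ (X.obj ◁ QA.R) ▷ A ⊗≫ (X.obj ⊗ A) ◁ μ[A] ⊗≫
          (β_ A X.obj).inv ▷ A := by
      rw [whisker_exchange]; monoidal
    _ = 𝟙 _ ⊗≫ coact X ⊗≫ (X.obj ◁ QA.R) ▷ A ⊗≫ ((X.obj ⊗ A) ◁ μ[A] ≫
          (β_ A X.obj).inv ▷ A) := by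
      simp only [coact, coaction]; monoidal
    _ = 𝟙 _ ⊗≫ coact X ⊗≫ ((λ_ X.obj).hom ≫ (ρ_ X.obj).inv ≫ X.obj ◁ QA.R ≫ (α_ X.obj A A).inv ≫
          (β_ A X.obj).inv ▷ A) ▷ A ⊗≫ (A ⊗ X.obj) ◁ μ[A] := by
      rw [whisker_exchange]; monoidal
    _ = 𝟙 _ ⊗≫ (𝟙_ C ◁ coact X ≫ QA.R ▷ (X.obj ⊗ A)) ⊗≫ A ◁ (β_ A X.obj).hom ▷ A ⊗≫
          (A ⊗ X.obj) ◁ μ[A] := by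
      rw [← slide_R]; monoidal
    _ = _ := by
      rw [tensorHom_def', tensorμ]; monoidal

end ModO

end Module

/-! ### Smash products -/

section Smash

variable {C : Type u} [Category.{v} C] [MonoidalCategory C] [BraidedCategory C]
  {A : C} [QA : QuasitriangularBialgebra A]

open ModO QuasitriangularBialgebra

/-- The monoid object `K` is the smash product of `A` with the monoid `B` of `C_{O(A, Ā)}`: it is
generated by monoid maps `i : A ⟶ K` and `j : B ⟶ K` that commute past each other through the
action, and the multiplication `A ⊗ B ⟶ K` is an isomorphism. -/
structure IsSmashProduct (B : ModO A) [MonObj B] {K : C} [MonObj K] (i : A ⟶ K) (j : B.obj ⟶ K) :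
    Prop where
  hom_left : IsMonHom i
  hom_right : IsMonHom j
  exchange : j ⊛ i = swapAct Δ[A] B.act ≫ (i ⊛ j)
  isIso : IsIso (i ⊛ j)

namespace IsSmashProduct

variable {B : ModO A} [MonObj B] {K : C} [MonObj K] {i : A ⟶ K} {j : B.obj ⟶ K}

/-- Monoid maps out of a smash product are determined by their restrictions to `A` and `B`. -/
lemma hom_ext (h : IsSmashProduct B i j) {M : C} [MonObj M] {f g : K ⟶ M} [IsMonHom f] [IsMonHom g]
    (hi : i ≫ f = i ≫ g) (hj : j ≫ f = j ≫ g) : f = g := by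
  have := h.isIso
  rw [← cancel_epi (i ⊛ j), mulMap_comp, mulMap_comp, hi, hj]

/-- The map `i(a) j(b) ↦ f(a) g(b)` out of a smash product. -/
noncomputable def lift (h : IsSmashProduct B i j) {M : C} [MonObj M] (f : A ⟶ M)
    (g : B.obj ⟶ M) : K ⟶ M :=
  have := h.isIso
  inv (i ⊛ j) ≫ (f ⊛ g)

lemma mulMap_lift (h : IsSmashProduct B i j) {M : C} [MonObj M] (f : A ⟶ M) (g : B.obj ⟶ M) :
    (i ⊛ j) ≫ h.lift f g = f ⊛ g := by
  have := h.isIso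
  simp [lift]

lemma left_lift (h : IsSmashProduct B i j) {M : C} [MonObj M] (f : A ⟶ M) (g : B.obj ⟶ M)
    [hg : IsMonHom g] : i ≫ h.lift f g = f := by
  have := h.hom_right
  have e : i = (ρ_ A).inv ≫ A ◁ η[B.obj] ≫ (i ⊛ j) := by
    rw [whiskerLeft_mulMap, IsMonHom.one_hom, mulMap_one, Iso.inv_hom_id_assoc]
  refine (congrArg (· ≫ h.lift f g) e).trans ?_
  simp only [Category.assoc]
  rw [mulMap_lift, whiskerLeft_mulMap, IsMonHom.one_hom, mulMap_one, Iso.inv_hom_id_assoc]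

lemma right_lift (h : IsSmashProduct B i j) {M : C} [MonObj M] (f : A ⟶ M) (g : B.obj ⟶ M)
    [hf : IsMonHom f] : j ≫ h.lift f g = g := by
  have := h.hom_left
  have e : j = (λ_ B.obj).inv ≫ η[A] ▷ B.obj ≫ (i ⊛ j) := by
    rw [whiskerRight_mulMap, IsMonHom.one_hom, one_mulMap, Iso.inv_hom_id_assoc]
  refine (congrArg (· ≫ h.lift f g) e).trans ?_
  simp only [Category.assoc]
  rw [mulMap_lift, whiskerRight_mulMap, IsMonHom.one_hom, one_mulMap, Iso.inv_hom_id_assoc]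

/-- Monoid maps on `A` and `B` that satisfy the exchange relation extend to a monoid map on `K`. -/
lemma isMonHom_lift (h : IsSmashProduct B i j) {M : C} [MonObj M] (f : A ⟶ M) (g : B.obj ⟶ M)
    [hf : IsMonHom f] [hg : IsMonHom g] (hfg : g ⊛ f = swapAct Δ[A] B.act ≫ (f ⊛ g)) :
    IsMonHom (h.lift f g) where
  one_hom := by
    have := h.hom_left
    rw [← IsMonHom.one_hom i, Category.assoc, left_lift, IsMonHom.one_hom]
  mul_hom := by
    have := h.isIso
    have := h.hom_left
    have := h.hom_right
    have e1 := twistMul_mulMap (IsMonHom.mul_hom i) (IsMonHom.mul_hom j) h.exchange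
    have e2 := twistMul_mulMap (IsMonHom.mul_hom f) (IsMonHom.mul_hom g) hfg
    rw [← cancel_epi ((i ⊛ j) ⊗ₘ (i ⊛ j)), tensorHom_comp_tensorHom_assoc, mulMap_lift]
    change _ = (f ⊛ g) ⊛ (f ⊛ g)
    rw [← e2, ← Category.assoc]
    change ((i ⊛ j) ⊛ (i ⊛ j)) ≫ _ = _
    rw [← e1, Category.assoc, mulMap_lift]

end IsSmashProduct

section

variable {B : ModO A} {K : C} [MonObj K] (i : A ⟶ K) (j : B.obj ⟶ K)

/-- The image of the R-matrix of `A` in `K ⊗ K`. -/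
abbrev imageR : 𝟙_ C ⟶ K ⊗ K := QA.R ≫ (i ⊗ₘ i)

/-- The coaction of `B` with values in `K ⊗ K`. -/
abbrev coactIn : B.obj ⟶ K ⊗ K := coact B ≫ (j ⊗ₘ i)

/-- The map `B ⊗ B ⟶ K ⊗ K` through which the comultiplication of the cross product is defined
on `B`: the coaction on the first factor, multiplied with `1 ⊗ y`. -/
def bosonMap : B.obj ⊗ B.obj ⟶ K ⊗ K :=
  coactIn i j ⊛ (j ≫ inr K K)

variable {i j}

lemma isInverse_imageR (hi : IsMonHom i) : IsInverse (imageR i) (QA.Rinv ≫ (i ⊗ₘ i)) :=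
  (isInverse_R A).comp (i ⊗ₘ i)

end

namespace IsSmashProduct

variable {B : ModO A} [MonObj B] {K : C} [MonObj K] {i : A ⟶ K} {j : B.obj ⟶ K}

/-- In `K ⊗ K` the coaction of `x` and the element `x ⊗ 1` are conjugate under the image of the
R-matrix of `A`. -/
lemma coactIn_lmul (h : IsSmashProduct B i j) :
    coactIn i j ≫ lmul (imageR i) = (j ≫ inl K K) ≫ rmul (imageR i) := by
  have := h.hom_left
  rw [comp_lmul, comp_rmul, ← tensorHom_mulMap, tensorHom_mulMap_tensorHom, ← whiskerLeft_mulMap,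
    inl_mulMap_tensorHom, h.exchange]
  have e : i ⊛ i = μ[A] ≫ i := (IsMonHom.mul_hom i).symm
  have e2 : ((swapAct Δ[A] B.act ≫ (i ⊛ j)) ⊗ₘ i) = swapAct Δ[A] B.act ▷ A ≫ ((i ⊛ j) ⊗ₘ i) := by
    rw [← tensorHom_id, tensorHom_comp_tensorHom, Category.id_comp]
  have e3 : ((i ⊛ j) ⊗ₘ (μ[A] ≫ i)) = (A ⊗ B.obj) ◁ μ[A] ≫ ((i ⊛ j) ⊗ₘ i) := by
    rw [← id_tensorHom, tensorHom_comp_tensorHom, Category.id_comp]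
  rw [e, e2, e3]
  have := swapAct_R B
  simp only [← Category.assoc] at this ⊢
  rw [this]

lemma coactIn_eq (h : IsSmashProduct B i j) :
    coactIn i j = (j ≫ inl K K) ≫ rmul (imageR i) ≫ lmul (QA.Rinv ≫ (i ⊗ₘ i)) := by
  rw [← Category.assoc, ← (isInverse_imageR h.hom_left).symm.eq_comp_lmul_iff.2 h.coactIn_lmul]

/-- As a conjugate of `x ↦ x ⊗ 1`, the coaction with values in `K ⊗ K` is a morphism of monoids. -/
lemma isMonHom_coactIn (h : IsSmashProduct B i j) : IsMonHom (coactIn i j) := by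
  have := h.hom_right
  have := (isInverse_imageR (QA := QA) h.hom_left).isMonHom_conj
  rw [h.coactIn_eq]
  infer_instance

/-- The crossed-module condition: the elements `1 ⊗ y` and the coaction of `x` commute past each
other through the braiding of `C_{O(A, Ā)}`. -/
lemma inr_mulMap_coactIn (h : IsSmashProduct B i j) :
    (j ≫ inr K K) ⊛ coactIn i j =
      crossedBraiding B.act (coact B) ≫ (coactIn i j ⊛ (j ≫ inr K K)) := by
  have key : B.obj ◁ coact B ≫ (α_ B.obj B.obj A).inv ≫ (β_ B.obj B.obj).hom ▷ A ≫
      (α_ B.obj B.obj A).hom ≫ B.obj ◁ swapAct Δ[A] B.act =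
      crossedBraiding B.act (coact B) ≫ coact B ▷ B.obj ≫ (α_ B.obj A B.obj).hom := by
    simp only [crossedBraiding, swapAct]
    calc
      _ = 𝟙 _ ⊗≫ B.obj ◁ coact B ⊗≫ ((β_ B.obj B.obj).hom ▷ A ≫ (B.obj ⊗ B.obj) ◁ Δ[A]) ⊗≫
            B.obj ◁ (β_ B.obj A).hom ▷ A ⊗≫ B.obj ◁ A ◁ B.act := by monoidal
      _ = 𝟙 _ ⊗≫ B.obj ◁ (coact B ≫ B.obj ◁ Δ[A]) ⊗≫ (β_ B.obj B.obj).hom ▷ (A ⊗ A) ⊗≫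
            B.obj ◁ (β_ B.obj A).hom ▷ A ⊗≫ B.obj ◁ A ◁ B.act := by
        rw [← whisker_exchange]; monoidal
      _ = 𝟙 _ ⊗≫ B.obj ◁ coact B ⊗≫ (B.obj ◁ coact B ≫ (β_ B.obj (B.obj ⊗ A)).hom) ▷ A ⊗≫
            B.obj ◁ A ◁ B.act := by
        rw [← coact_coassoc]
        simp only [braiding_tensor_right_hom]
        monoidal
      _ = 𝟙 _ ⊗≫ B.obj ◁ coact B ⊗≫ (β_ B.obj B.obj).hom ▷ A ⊗≫
            (coact B ▷ (B.obj ⊗ A) ≫ (B.obj ⊗ A) ◁ B.act) ⊗≫ 𝟙 _ := by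
        rw [braiding_naturality_right]; monoidal
      _ = _ := by rw [← whisker_exchange]; monoidal
  have e2 : (j ⊗ₘ (swapAct Δ[A] B.act ≫ (i ⊛ j))) =
      B.obj ◁ swapAct Δ[A] B.act ≫ (j ⊗ₘ (i ⊛ j)) := by
    rw [← id_tensorHom, tensorHom_comp_tensorHom, Category.id_comp]
  rw [coactIn, ← whiskerLeft_mulMap, inr_mulMap_tensorHom, h.exchange, ← whiskerRight_mulMap,
    tensorHom_mulMap_inr, e2]
  simp only [← Category.assoc] at key ⊢
  rw [key]

/-- The map `bosonMap` is a morphism of monoids from `B ⊗ B`, formed in `C_{O(A, Ā)}`, to `K ⊗ K`,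
formed in `C`. It transports identities between elements of `B ⊗ B` to `K ⊗ K`. -/
lemma isMonHom_bosonMap (h : IsSmashProduct B i j) :
    @IsMonHom C _ _ (B ⊗ B : ModO A).obj (K ⊗ K) _ _ (bosonMap i j) := by
  have := h.hom_left
  have := h.hom_right
  have := h.isMonHom_coactIn
  refine ⟨?_, ?_⟩
  · have : ((λ_ (𝟙_ C)).inv ≫ (η[B.obj] ⊗ₘ η[B.obj])) ≫ (coactIn i j ⊛ (j ≫ inr K K)) =
        η[K ⊗ K] := by
      rw [Category.assoc, tensorHom_mulMap, IsMonHom.one_hom, IsMonHom.one_hom, mulMap_one]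
      rw [← unitors_equal, Iso.inv_hom_id_assoc]
    rw [tensor_one_hom]
    exact this
  · rw [tensor_mul_hom]
    exact twistMul_mulMap (IsMonHom.mul_hom _) (IsMonHom.mul_hom _) h.inr_mulMap_coactIn

end IsSmashProduct

/-! ### The comultiplication of the cross product -/

/-- Exchange relations with `A` are inherited by products, with the diagonal action. -/
lemma exchange_mulMap {X Y : ModO A} {M : C} [MonObj M] {f : X.obj ⟶ M} {g : Y.obj ⟶ M} {d : A ⟶ M}
    (hf : f ⊛ d = swapAct Δ[A] X.act ≫ (d ⊛ f)) (hg : g ⊛ d = swapAct Δ[A] Y.act ≫ (d ⊛ g)) :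
    (f ⊛ g) ⊛ d = swapAct Δ[A] (diagAct Δ[A] X.act Y.act) ≫ (d ⊛ (f ⊛ g)) := by
  rw [mulMap_assoc, hg, ← whiskerLeft_mulMap, mulMap_assoc', hf, ← whiskerRight_mulMap,
    mulMap_assoc, swapAct_diagAct _ comul_coassoc']
  simp only [Category.assoc]

/-- `B`, regarded as an object of the category `C_{O(Ā, A)}` of the inverse braiding. -/
@[reducible]
def ModO.reverse (B : ModO A) :
    @ModO C _ _ (reverseBraiding C) A (QuasitriangularBialgebra.reverse A) :=
  @ModO.mk C _ _ (reverseBraiding C) A (QuasitriangularBialgebra.reverse A) B.obj B.act B.act_one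
    B.act_mul B.swap_eq.symm

namespace IsSmashProduct

variable {B : ModO A} [MonObj B] {K : C} [MonObj K] {i : A ⟶ K} {j : B.obj ⟶ K}

/-- The elements `x ⊗ 1` and the opposite coproduct of `a` in `Ā` commute past each other through
the action: this is `inr_mulMap_comul` for the inverse braiding. -/
lemma inl_mulMap_comulBar (h : IsSmashProduct B i j) :
    (j ≫ inl K K) ⊛ ((comulBar A ≫ (β_ A A).hom) ≫ (i ⊗ₘ i)) =
      swapAct Δ[A] B.act ≫
        (((comulBar A ≫ (β_ A A).hom) ≫ (i ⊗ₘ i)) ⊛ (j ≫ inl K K)) := by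
  have hb : @IsMonHom C _ _ _ _ (revTensor K K) _ (β_ K K).hom := isMonHom_braiding
  have hx := h.exchange
  rw [B.swap_eq] at hx ⊢
  have h1 := @inr_mulMap_comul C _ _ (reverseBraiding C) A B.obj K _ (comulBar A) comulBar_coassoc
    B.act i j hx
  have h2 := congrArg (· ≫ (β_ K K).hom) h1
  simp only [Category.assoc] at h2
  rw [@mulMap_comp C _ _ _ _ _ _ (revTensor K K) _ _ _ _ hb,
    @mulMap_comp C _ _ _ _ _ _ (revTensor K K) _ _ _ _ hb] at h2
  simp only [Category.assoc, braiding_naturality, inr_comp_braiding] at h2 ⊢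
  exact h2

/-- The image of `Δ_A` in `K ⊗ K` is the conjugate of the image of the opposite comultiplication of
`Ā` by the image of the R-matrix. -/
lemma comul_eq_conj (h : IsSmashProduct B i j) : Δ[A] ≫ (i ⊗ₘ i) =
    ((comulBar A ≫ (β_ A A).hom) ≫ (i ⊗ₘ i)) ≫ rmul (imageR i) ≫
      lmul (QA.Rinv ≫ (i ⊗ₘ i)) := by
  have := h.hom_left
  rw [← Category.assoc, (isInverse_imageR h.hom_left).symm.eq_comp_lmul_iff, Category.assoc,
    Category.assoc, ← rmul_comp, ← lmul_comp, ← Category.assoc, ← Category.assoc]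
  have := comulBar_braiding_rmul_R A
  rw [← this]

/-- The conjugate by the R-matrix of `inl_mulMap_comulBar`. -/
lemma coactIn_mulMap_comul (h : IsSmashProduct B i j) :
    coactIn i j ⊛ (Δ[A] ≫ (i ⊗ₘ i)) =
      swapAct Δ[A] B.act ≫ ((Δ[A] ≫ (i ⊗ₘ i)) ⊛ coactIn i j) := by
  have := (isInverse_imageR (QA := QA) h.hom_left).isMonHom_conj
  rw [h.comul_eq_conj, h.coactIn_eq, ← mulMap_comp, ← mulMap_comp, h.inl_mulMap_comulBar,
    Category.assoc]

lemma bosonMap_mulMap_comul (h : IsSmashProduct B i j) :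
    bosonMap i j ⊛ (Δ[A] ≫ (i ⊗ₘ i)) =
      swapAct Δ[A] (diagAct Δ[A] B.act B.act) ≫ ((Δ[A] ≫ (i ⊗ₘ i)) ⊛ bosonMap i j) :=
  exchange_mulMap h.coactIn_mulMap_comul (inr_mulMap_comul comul_coassoc' h.exchange)

end IsSmashProduct

namespace IsSmashProduct

variable {B : ModO A} [BimonObj B] {K : C} [MonObj K] {i : A ⟶ K} {j : B.obj ⟶ K}

lemma isMonHom_comul_hom (B : ModO A) [BimonObj B] :
    @IsMonHom C _ _ B.obj (B ⊗ B : ModO A).obj _ _ Δ[B.obj] := by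
  have : IsMonHom Δ[B] := { one_hom := BimonObj.one_comul B, mul_hom := BimonObj.mul_comul B }
  exact isMonHom_hom Δ[B]

instance isMonHom_counit_hom (B : ModO A) [BimonObj B] : IsMonHom ε[B.obj] := by
  have : IsMonHom ε[B] :=
    { one_hom := BimonObj.one_counit B
      mul_hom := by rw [BimonObj.mul_counit]; rfl }
  have h := isMonHom_hom ε[B]
  exact ⟨h.one_hom, h.mul_hom⟩

lemma isMonHom_comul_bosonMap (h : IsSmashProduct B i j) : IsMonHom (Δ[B.obj] ≫ bosonMap i j) :=
  @instIsMonHomComp C _ _ _ (B ⊗ B : ModO A).obj _ _ _ _ Δ[B.obj] (bosonMap i j)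
    (isMonHom_comul_hom B) h.isMonHom_bosonMap

lemma isMonHom_comul_left (h : IsSmashProduct B i j) : IsMonHom (Δ[A] ≫ (i ⊗ₘ i)) := by
  have := h.hom_left
  infer_instance

/-- The comultiplication of the cross product: `Δ_A` on `A`, and `Δ_B` followed by `bosonMap` on
`B`. -/
noncomputable def comul (h : IsSmashProduct B i j) : K ⟶ K ⊗ K :=
  h.lift (Δ[A] ≫ (i ⊗ₘ i)) (Δ[B.obj] ≫ bosonMap i j)

/-- The counit of the cross product, which restricts to the counits of `A` and `B`. -/
noncomputable def counit (h : IsSmashProduct B i j) : K ⟶ 𝟙_ C := h.lift ε[A] ε[B.obj]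

lemma left_comul (h : IsSmashProduct B i j) : i ≫ h.comul = Δ[A] ≫ (i ⊗ₘ i) :=
  have := h.isMonHom_comul_bosonMap
  h.left_lift _ _

lemma right_comul (h : IsSmashProduct B i j) : j ≫ h.comul = Δ[B.obj] ≫ bosonMap i j :=
  have := h.isMonHom_comul_left
  h.right_lift _ _

lemma left_counit (h : IsSmashProduct B i j) : i ≫ h.counit = ε[A] := h.left_lift _ _

lemma right_counit (h : IsSmashProduct B i j) : j ≫ h.counit = ε[B.obj] := h.right_lift _ _

lemma isMonHom_comul (h : IsSmashProduct B i j) : IsMonHom h.comul := by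
  have := h.isMonHom_comul_bosonMap
  have := h.isMonHom_comul_left
  refine h.isMonHom_lift _ _ ?_
  rw [← whiskerRight_mulMap, h.bosonMap_mulMap_comul, reassoc_of% comul_swapAct B,
    whiskerLeft_mulMap]

lemma isMonHom_counit (h : IsSmashProduct B i j) : IsMonHom h.counit := by
  refine h.isMonHom_lift _ _ ?_
  rw [← Category.comp_id ε[B.obj], ← whiskerLeft_mulMap, reassoc_of% counit_swapAct B,
    ← whiskerRight_mulMap]
  congr 1
  simp [mulMap, tensorHom_def', ← unitors_equal]

end IsSmashProduct

/-! ### Coassociativity -/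

namespace IsSmashProduct

variable {B : ModO A} [BimonObj B] {K : C} [MonObj K] {i : A ⟶ K} {j : B.obj ⟶ K}

lemma bosonMap_counit_left (h : IsSmashProduct B i j) :
    bosonMap i j ≫ h.counit ▷ K = ε[B.obj] ▷ B.obj ≫ (λ_ B.obj).hom ≫ j ≫ (λ_ K).inv := by
  have := h.isMonHom_counit
  have := h.hom_left
  have e : coactIn i j ≫ h.counit ▷ K = ε[B.obj] ≫ η[𝟙_ C ⊗ K] := by
    rw [coactIn, Category.assoc, ← tensorHom_id, tensorHom_comp_tensorHom, h.right_counit,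
      MonoidalCategory.tensorHom_def, reassoc_of% coact_counit_map B, Category.comp_id]
    rw [← leftUnitor_inv_naturality, ← Category.assoc η[A], IsMonHom.one_hom]
    rw [MonObj.tensorObj.one_def, show η[𝟙_ C] = 𝟙 _ from rfl, id_tensorHom,
      leftUnitor_inv_naturality]
  rw [bosonMap, mulMap_comp, e, Category.assoc, inr_whiskerRight, ← whiskerRight_mulMap,
    one_mulMap]
  simp [inr]

lemma bosonMap_counit_right (h : IsSmashProduct B i j) :
    bosonMap i j ≫ K ◁ h.counit = B.obj ◁ ε[B.obj] ≫ (ρ_ B.obj).hom ≫ j ≫ (ρ_ K).inv := by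
  have := h.isMonHom_counit
  have e : coactIn i j ≫ K ◁ h.counit = j ≫ (ρ_ K).inv := by
    rw [coactIn, Category.assoc, ← id_tensorHom, tensorHom_comp_tensorHom, h.left_counit,
      tensorHom_def', reassoc_of% coact_counit B, Category.comp_id, rightUnitor_inv_naturality]
  have e2 : inr K K ≫ K ◁ h.counit = h.counit ≫ η[K ⊗ 𝟙_ C] := by
    rw [← inr_naturality]
    simp only [inr, MonObj.tensorObj.one_def]
    rw [show η[𝟙_ C] = 𝟙 _ from rfl, tensorHom_id]
  rw [bosonMap, mulMap_comp, e, Category.assoc, e2, ← Category.assoc, h.right_counit,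
    ← whiskerLeft_mulMap, mulMap_one]

lemma counit_comul (h : IsSmashProduct B i j) : h.comul ≫ h.counit ▷ K = (λ_ K).inv := by
  have := h.isMonHom_counit
  have := h.isMonHom_comul
  apply h.hom_ext (M := 𝟙_ C ⊗ K)
  · rw [← Category.assoc, h.left_comul, Category.assoc, ← tensorHom_id, tensorHom_comp_tensorHom,
      h.left_counit, Category.comp_id, MonoidalCategory.tensorHom_def,
      reassoc_of% ComonObj.counit_comul A, leftUnitor_inv_naturality]
  · rw [← Category.assoc, h.right_comul, Category.assoc, h.bosonMap_counit_left,
      reassoc_of% ComonObj.counit_comul B.obj, Iso.inv_hom_id_assoc]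

lemma comul_counit (h : IsSmashProduct B i j) : h.comul ≫ K ◁ h.counit = (ρ_ K).inv := by
  have := h.isMonHom_counit
  have := h.isMonHom_comul
  apply h.hom_ext (M := K ⊗ 𝟙_ C)
  · rw [← Category.assoc, h.left_comul, Category.assoc, ← id_tensorHom, tensorHom_comp_tensorHom,
      h.left_counit, Category.comp_id, tensorHom_def',
      reassoc_of% ComonObj.comul_counit A, rightUnitor_inv_naturality]
  · rw [← Category.assoc, h.right_comul, Category.assoc, h.bosonMap_counit_right,
      reassoc_of% ComonObj.comul_counit B.obj, Iso.inv_hom_id_assoc]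

/-- The map `B ⊗ B ⟶ K ⊗ K ⊗ K` obtained from `bosonMap` and the coaction on `B ⊗ B`. -/
def bosonMap₃ (i : A ⟶ K) (j : B.obj ⟶ K) : B.obj ⊗ B.obj ⟶ (K ⊗ K) ⊗ K :=
  tensorCoact B B ≫ (bosonMap i j ⊗ₘ i)

/-- The map `B ⟶ K ⊗ K ⊗ K` given by the iterated coaction. -/
noncomputable abbrev coactIn₃ (h : IsSmashProduct B i j) : B.obj ⟶ (K ⊗ K) ⊗ K :=
  coactIn i j ≫ K ◁ h.comul ≫ (α_ K K K).inv

/-- Coassociativity of the coaction, with values in `K ⊗ K ⊗ K`. -/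
lemma coactIn₃_eq (h : IsSmashProduct B i j) :
    h.coactIn₃ = coact B ≫ (coactIn i j ⊗ₘ i) := by
  have e : coactIn i j ≫ K ◁ h.comul = coact B ≫ B.obj ◁ Δ[A] ≫ (j ⊗ₘ (i ⊗ₘ i)) := by
    rw [coactIn, Category.assoc, ← id_tensorHom, tensorHom_comp_tensorHom, h.left_comul,
      ← id_tensorHom, tensorHom_comp_tensorHom, Category.comp_id, Category.id_comp]
  rw [coactIn₃, ← Category.assoc, e, ← reassoc_of% coact_coassoc B, Category.assoc,
    Category.assoc, Category.assoc, associator_inv_naturality, Iso.hom_inv_id_assoc,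
    ← tensorHom_id, tensorHom_comp_tensorHom, Category.id_comp]

lemma bosonMap₃_eq (h : IsSmashProduct B i j) :
    bosonMap₃ i j = h.coactIn₃ ⊛ (coactIn i j ≫ emb23 K) := by
  have := h.hom_left
  have e : coactIn i j ≫ emb23 K = coact B ≫ ((j ≫ inr K K) ⊗ₘ i) := by
    change (coact B ≫ (j ⊗ₘ i)) ≫ inr K K ▷ K = _
    rw [Category.assoc, ← tensorHom_id, tensorHom_comp_tensorHom, Category.comp_id]
  have e1 : i ⊛ i = μ[A] ≫ i := (IsMonHom.mul_hom i).symm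
  rw [h.coactIn₃_eq, e, ← tensorHom_mulMap, tensorHom_mulMap_tensorHom, bosonMap₃, tensorCoact, e1]
  simp only [Category.assoc, ← id_tensorHom, tensorHom_comp_tensorHom, Category.id_comp]
  rfl

/-- The comultiplication of `K` in the second leg of `bosonMap (x ⊗ y)`. Together with
`bosonMap_comul_left` it reduces coassociativity on `B` to coassociativity of `Δ_B`. -/
lemma bosonMap_comul_right (h : IsSmashProduct B i j) :
    bosonMap i j ≫ K ◁ h.comul ≫ (α_ K K K).inv =
      B.obj ◁ Δ[B.obj] ≫ (α_ B.obj B.obj B.obj).inv ≫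
        (bosonMap₃ i j ⊛ (j ≫ inr (K ⊗ K) K)) := by
  have := h.isMonHom_comul
  have e : (j ≫ inr K K) ≫ K ◁ h.comul ≫ (α_ K K K).inv =
      Δ[B.obj] ≫ ((coactIn i j ≫ emb23 K) ⊛ (j ≫ inr (K ⊗ K) K)) := by
    have e1 : inr K (K ⊗ K) ≫ (α_ K K K).inv = emb23 K := by
      rw [← emb23_associator, Category.assoc, Iso.hom_inv_id, Category.comp_id]
    have e2 : inr K K ≫ emb23 K = inr (K ⊗ K) K := inr_whiskerRight _
    rw [Category.assoc, ← reassoc_of% inr_naturality, ← Category.assoc, h.right_comul, e1, bosonMap,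
      Category.assoc, mulMap_comp, Category.assoc j, e2]
  rw [bosonMap, mulMap_comp, e, h.bosonMap₃_eq, mulMap_assoc, ← whiskerLeft_mulMap,
    Iso.inv_hom_id_assoc]

lemma bosonMap_comul_left (h : IsSmashProduct B i j) :
    bosonMap i j ≫ h.comul ▷ K =
      Δ[B.obj] ▷ B.obj ≫ (bosonMap₃ i j ⊛ (j ≫ inr (K ⊗ K) K)) := by
  have := h.isMonHom_comul
  rw [bosonMap, mulMap_comp, Category.assoc j, inr_whiskerRight, whiskerRight_mulMap]
  congr 1
  rw [bosonMap₃, ← Category.assoc, comul_tensorCoact B, coactIn, Category.assoc, ← tensorHom_id,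
    tensorHom_comp_tensorHom, h.right_comul, ← tensorHom_id, Category.assoc,
    tensorHom_comp_tensorHom]
  simp

lemma comul_assoc (h : IsSmashProduct B i j) :
    h.comul ≫ K ◁ h.comul = h.comul ≫ h.comul ▷ K ≫ (α_ K K K).hom := by
  have := h.isMonHom_comul
  -- both sides are monoid maps; on `B` they agree because `Δ_B` is coassociative
  apply h.hom_ext (M := K ⊗ (K ⊗ K))
  · rw [← Category.assoc, h.left_comul, ← Category.assoc i, h.left_comul]
    simp only [Category.assoc, ← id_tensorHom, ← tensorHom_id, tensorHom_comp_tensorHom_assoc,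
      tensorHom_comp_tensorHom, h.left_comul, Category.comp_id]
    have e1 : (i ⊗ₘ (Δ[A] ≫ (i ⊗ₘ i))) = A ◁ Δ[A] ≫ (i ⊗ₘ (i ⊗ₘ i)) := by
      rw [← id_tensorHom, tensorHom_comp_tensorHom, Category.id_comp]
    have e2 : ((Δ[A] ≫ (i ⊗ₘ i)) ⊗ₘ i) = Δ[A] ▷ A ≫ ((i ⊗ₘ i) ⊗ₘ i) := by
      rw [← tensorHom_id, tensorHom_comp_tensorHom, Category.id_comp]
    rw [e1, e2, Category.assoc, associator_naturality, reassoc_of% ComonObj.comul_assoc A]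
  · have e1 := h.bosonMap_comul_right
    have e2 := h.bosonMap_comul_left
    rw [← cancel_mono (α_ K K K).inv]
    simp only [Category.assoc, Iso.hom_inv_id, Category.comp_id]
    rw [← Category.assoc, h.right_comul, ← Category.assoc j, h.right_comul, Category.assoc, e1,
      Category.assoc, e2, reassoc_of% ComonObj.comul_assoc B.obj, Iso.hom_inv_id_assoc]

/-- The cross product bialgebra. -/
noncomputable abbrev bimonObj (h : IsSmashProduct B i j) : BimonObj K where
  comul := h.comul
  counit := h.counit
  counit_comul := h.counit_comul
  comul_counit := h.comul_counit
  comul_assoc := h.comul_assoc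
  mul_comul := h.isMonHom_comul.mul_hom
  one_comul := h.isMonHom_comul.one_hom
  mul_counit := h.isMonHom_counit.mul_hom
  one_counit := h.isMonHom_counit.one_hom

end IsSmashProduct

/-! ### The R-matrix of the cross product -/

/-- The element `r` of `B ⊗ B` is coinvariant for the diagonal coaction. -/
def IsCoinvariant {B : ModO A} (r : 𝟙_ C ⟶ B.obj ⊗ B.obj) : Prop :=
  r ≫ tensorCoact B B = η[A] ≫ (λ_ A).inv ≫ r ▷ A

lemma isCoinvariant_hom {B : ModO A} (r : 𝟙_ (ModO A) ⟶ B ⊗ B) : IsCoinvariant (B := B) r.hom := by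
  have h := coact_naturality r
  rw [coact_tensor_eq_tensorCoact, coact_unit] at h
  exact h.trans (Category.assoc _ _ _)

/-- The element of `K ⊗ K` determined by an element `r` of `B ⊗ B`: the image of the R-matrix of `A`
times the image of `r` under `bosonMap`. For the R-matrix `r` of `B` it is the R-matrix of the cross
product. -/
def crossElement {B : ModO A} {K : C} [MonObj K] (i : A ⟶ K) (j : B.obj ⟶ K)
    (r : 𝟙_ C ⟶ B.obj ⊗ B.obj) : 𝟙_ C ⟶ K ⊗ K :=
  r ≫ bosonMap i j ≫ lmul (imageR i)

namespace IsSmashProduct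

variable {B : ModO A} [BimonObj B] {K : C} [MonObj K] {i : A ⟶ K} {j : B.obj ⟶ K}

/-- On a coinvariant element, the third leg of `bosonMap₃` is trivial. -/
lemma coinvariant_bosonMap₃ (h : IsSmashProduct B i j) {r : 𝟙_ C ⟶ B.obj ⊗ B.obj}
    (hinv : IsCoinvariant r) :
    r ≫ bosonMap₃ i j = (r ≫ bosonMap i j) ≫ emb12 K := by
  have := h.hom_left
  rw [bosonMap₃, ← Category.assoc, hinv, emb12, inl_naturality]
  simp only [Category.assoc, inl]
  rw [← tensorHom_id, ← tensorHom_id, ← id_tensorHom, tensorHom_comp_tensorHom,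
    tensorHom_comp_tensorHom, Category.id_comp, Category.comp_id, Category.id_comp,
    leftUnitor_inv_naturality_assoc, ← id_tensorHom, tensorHom_comp_tensorHom, IsMonHom.one_hom,
    Category.id_comp, unitors_inv_equal]

lemma coactIn₃_lmul (h : IsSmashProduct B i j) :
    h.coactIn₃ ≫ lmul (imageR i ≫ emb12 K) =
      (coactIn i j ≫ emb13 K) ≫ rmul (imageR i ≫ emb12 K) := by
  rw [h.coactIn₃_eq, lmul_inl, rmul_inl, Category.assoc, Category.assoc, ← comp_whiskerRight,
    ← tensorHom_id, tensorHom_comp_tensorHom, h.coactIn_lmul]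
  change _ = (coact B ≫ (j ⊗ₘ i)) ≫ _
  rw [← tensorHom_id, Category.assoc (coact B), tensorHom_comp_tensorHom, Category.assoc]

/-- The comultiplication of `K` in the second leg of the image of a right copairing `r`. -/
lemma coinvariant_bosonMap_comul_right (h : IsSmashProduct B i j) {r : 𝟙_ C ⟶ B.obj ⊗ B.obj}
    (hinv : IsCoinvariant r)
    (hr : IsRightCopairing Δ[B.obj] r) :
    r ≫ bosonMap i j ≫ K ◁ h.comul ≫ (α_ K K K).inv =
      (r ≫ (h.coactIn₃ ⊛ (j ≫ inr (K ⊗ K) K))) ≫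
        rmul ((r ≫ bosonMap i j) ≫ emb12 K) := by
  have := h.isMonHom_comul
  have := h.isMonHom_coactIn
  have hr' : r ≫ B.obj ◁ Δ[B.obj] = r ≫ ((ρ_ B.obj).inv ≫ B.obj ◁ r ≫
      (α_ B.obj B.obj B.obj).inv ≫ μ[B.obj] ▷ B.obj) ▷ B.obj ≫ (α_ B.obj B.obj B.obj).hom := hr
  have e1 : μ[B.obj] ▷ B.obj ≫ bosonMap₃ i j = (α_ _ _ _).hom ≫ (h.coactIn₃ ⊛ bosonMap₃ i j) := by
    rw [h.bosonMap₃_eq, whiskerRight_mulMap, ← mulMap_assoc]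
    congr 1
    exact IsMonHom.mul_hom _
  have e2 : ((ρ_ B.obj).inv ≫ B.obj ◁ r ≫ (α_ B.obj B.obj B.obj).inv ≫ μ[B.obj] ▷ B.obj) ≫
      bosonMap₃ i j = h.coactIn₃ ≫ rmul ((r ≫ bosonMap i j) ≫ emb12 K) := by
    rw [Category.assoc, Category.assoc, Category.assoc, e1, Iso.inv_hom_id_assoc, comp_rmul,
      ← h.coinvariant_bosonMap₃ hinv, ← whiskerLeft_mulMap]
  rw [h.bosonMap_comul_right, reassoc_of% hr', Iso.hom_inv_id_assoc, whiskerRight_mulMap, e2,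
    rmul_mulMap, inr_lmul_eq_rmul, ← mulMap_rmul]
  simp only [Category.assoc]

/-- If `r` is coinvariant and a right copairing for `Δ_B`, then `crossElement i j r` is a right
copairing for the comultiplication of the cross product. -/
lemma isRightCopairing_crossElement (h : IsSmashProduct B i j) {r : 𝟙_ C ⟶ B.obj ⊗ B.obj}
    (hinv : IsCoinvariant r)
    (hr : IsRightCopairing Δ[B.obj] r) : IsRightCopairing h.comul (crossElement i j r) := by
  have := h.isMonHom_comul
  have := h.hom_left
  rw [isRightCopairing_iff]
  -- the copairing condition for the R-matrix of `A`, transported to `K`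
  have e1 : imageR i ≫ K ◁ h.comul ≫ (α_ K K K).inv =
      (imageR i ≫ emb12 K) ≫ lmul (imageR i ≫ emb13 K) := by
    have hA := QA.R_comul_right
    have hA' : QA.R ≫ A ◁ Δ[A] ≫ (α_ A A A).inv = _ := isRightCopairing_iff.1 hA
    have e2 : (i ⊗ₘ i) ≫ K ◁ h.comul ≫ (α_ K K K).inv =
        A ◁ Δ[A] ≫ (α_ A A A).inv ≫ ((i ⊗ₘ i) ⊗ₘ i) := by
      rw [← id_tensorHom, tensorHom_comp_tensorHom_assoc, h.left_comul, ← id_tensorHom,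
        ← associator_inv_naturality, tensorHom_comp_tensorHom_assoc]
      simp
    have e3 : emb12 A ≫ ((i ⊗ₘ i) ⊗ₘ i) = (i ⊗ₘ i) ≫ emb12 K := by
      rw [emb12, emb12, inl_naturality, MonoidalCategory.tensorHom_def' (i ⊗ₘ i),
        reassoc_of% inl_whiskerLeft]
    have e4 : emb13 A ≫ ((i ⊗ₘ i) ⊗ₘ i) = (i ⊗ₘ i) ≫ emb13 K := by
      have : inl A A ≫ (i ⊗ₘ i) = i ≫ inl K K := by
        rw [inl_naturality, MonoidalCategory.tensorHom_def' i, reassoc_of% inl_whiskerLeft]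
      simp only [emb13, ← tensorHom_id, tensorHom_comp_tensorHom, this, Category.id_comp,
        Category.comp_id]
    rw [← elem_rmul, imageR, Category.assoc, e2, ← Category.assoc (A ◁ Δ[A]), ← Category.assoc QA.R,
      hA', Category.assoc, rmul_comp]
    simp only [Category.assoc]
    rw [e3, reassoc_of% e4]
  -- moving the image of `R_A` in legs 1 and 2 past the iterated coaction removes its middle leg
  have e5 : (h.coactIn₃ ⊛ (j ≫ inr (K ⊗ K) K)) ≫ lmul (imageR i ≫ emb12 K) =
      bosonMap i j ≫ emb13 K ≫ rmul (imageR i ≫ emb12 K) := by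
    have e6 : inr K K ≫ emb13 K = inr (K ⊗ K) K := inr_whiskerRight _
    have e7 : bosonMap i j ≫ emb13 K = (coactIn i j ≫ emb13 K) ⊛ (j ≫ inr (K ⊗ K) K) := by
      rw [bosonMap, mulMap_comp, Category.assoc j, e6]
    rw [mulMap_lmul, h.coactIn₃_lmul, rmul_mulMap, inr_lmul_eq_rmul, ← mulMap_rmul,
      ← Category.assoc (bosonMap i j), e7]
  have e7 : crossElement i j r ≫ K ◁ h.comul ≫ (α_ K K K).inv =
      (r ≫ bosonMap i j ≫ K ◁ h.comul ≫ (α_ K K K).inv) ≫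
        lmul (imageR i ≫ emb12 K) ≫ lmul (imageR i ≫ emb13 K) := by
    rw [lmul_lmul, ← e1, crossElement]
    simp only [Category.assoc]
    have := lmul_comp (imageR i) (K ◁ h.comul ≫ (α_ K K K).inv)
    simp only [Category.assoc] at this
    rw [this]
  have e8 : crossElement i j r ≫ emb12 K =
      (imageR i ≫ emb12 K) ≫ rmul ((r ≫ bosonMap i j) ≫ emb12 K) := by
    rw [elem_rmul, crossElement]
    simp only [Category.assoc]
    rw [lmul_comp, Category.assoc]
  have e9 : crossElement i j r ≫ emb13 K =
      (r ≫ bosonMap i j ≫ emb13 K) ≫ lmul (imageR i ≫ emb13 K) := by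
    rw [crossElement]
    simp only [Category.assoc]
    rw [lmul_comp, Category.assoc]
  rw [e7, e8, e9, h.coinvariant_bosonMap_comul_right hinv hr, ← rmul_rmul]
  simp only [Category.assoc]
  rw [← reassoc_of% lmul_rmul_comm, reassoc_of% e5, reassoc_of% lmul_rmul_comm, lmul_rmul_comm]

end IsSmashProduct

lemma ModO.isInverse_hom {B : ModO A} [MonObj B] {r s : 𝟙_ (ModO A) ⟶ B} (h : IsInverse r s) :
    IsInverse (M := B.obj) r.hom s.hom := by
  refine ⟨?_, ?_⟩
  · have := congrArg Hom.hom h.mul_inv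
    exact this
  · have := congrArg Hom.hom h.inv_mul
    exact this

namespace IsSmashProduct

variable {B : ModO A} [BimonObj B] {K : C} [MonObj K] {i : A ⟶ K} {j : B.obj ⟶ K}

lemma isInverse_crossElement (h : IsSmashProduct B i j) {r s : 𝟙_ C ⟶ B.obj ⊗ B.obj}
    (hr : @IsInverse C _ _ (B ⊗ B : ModO A).obj _ r s) :
    IsInverse (crossElement i j r)
      ((QA.Rinv ≫ (i ⊗ₘ i)) ≫ lmul (s ≫ bosonMap i j)) := by
  have h1 : IsInverse (r ≫ bosonMap i j) (s ≫ bosonMap i j) :=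
    @IsInverse.comp C _ _ (B ⊗ B : ModO A).obj (K ⊗ K) _ _ r s hr (bosonMap i j)
      h.isMonHom_bosonMap
  have h2 := (isInverse_imageR (QA := QA) h.hom_left).mul h1
  rwa [Category.assoc] at h2

lemma crossElement_counit_left (h : IsSmashProduct B i j) {r : 𝟙_ C ⟶ B.obj ⊗ B.obj}
    (hr : r ≫ ε[B.obj] ▷ B.obj ≫ (λ_ B.obj).hom = η[B.obj]) :
    crossElement i j r ≫ h.counit ▷ K ≫ (λ_ K).hom = η[K] := by
  have := h.hom_left
  have := h.hom_right
  have := h.isMonHom_counit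
  have e : imageR i ≫ h.counit ▷ K ≫ (λ_ K).hom = η[K] := by
    rw [imageR, Category.assoc, ← tensorHom_id, tensorHom_comp_tensorHom_assoc, h.left_counit,
      Category.comp_id, MonoidalCategory.tensorHom_def, Category.assoc, leftUnitor_naturality,
      reassoc_of% QA.R_counit_left, IsMonHom.one_hom]
  rw [crossElement, Category.assoc, Category.assoc, lmul_comp, e, lmul_one, Category.comp_id,
    reassoc_of% h.bosonMap_counit_left, Iso.inv_hom_id, Category.comp_id, reassoc_of% hr,
    IsMonHom.one_hom]

lemma crossElement_counit_right (h : IsSmashProduct B i j) {r : 𝟙_ C ⟶ B.obj ⊗ B.obj}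
    (hr : r ≫ B.obj ◁ ε[B.obj] ≫ (ρ_ B.obj).hom = η[B.obj]) :
    crossElement i j r ≫ K ◁ h.counit ≫ (ρ_ K).hom = η[K] := by
  have := h.hom_left
  have := h.hom_right
  have := h.isMonHom_counit
  have e : imageR i ≫ K ◁ h.counit ≫ (ρ_ K).hom = η[K] := by
    rw [imageR, Category.assoc, ← id_tensorHom, tensorHom_comp_tensorHom_assoc, h.left_counit,
      Category.comp_id, tensorHom_def', Category.assoc, rightUnitor_naturality,
      reassoc_of% QA.R_counit_right, IsMonHom.one_hom]
  rw [crossElement, Category.assoc, Category.assoc, lmul_comp, e, lmul_one, Category.comp_id,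
    reassoc_of% h.bosonMap_counit_right, Iso.inv_hom_id, Category.comp_id, reassoc_of% hr,
    IsMonHom.one_hom]

end IsSmashProduct

/-- The element `r` of `B ⊗ B` is invariant for the diagonal action. -/
def IsInvariant {B : ModO A} (r : 𝟙_ C ⟶ B.obj ⊗ B.obj) : Prop :=
  r ▷ A ≫ swapAct Δ[A] (diagAct Δ[A] B.act B.act) = (λ_ A).hom ≫ (ρ_ A).inv ≫ A ◁ r

lemma isInvariant_hom {B : ModO A} (r : 𝟙_ (ModO A) ⟶ B ⊗ B) : IsInvariant (B := B) r.hom := by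
  have h := swapAct_naturality r
  have h2 : swapAct Δ[A] (𝟙_ (ModO A)).act = (λ_ A).hom ≫ (ρ_ A).inv :=
    swapAct_unit _ _ (by simp)
  rw [h2] at h
  exact h.trans (Category.assoc _ _ _)

/-! ### The inverse braiding -/

namespace ModO

/-- The category `C_{O(Ā, A)}` formed in `C` with the inverse braiding, over the reversed
quasitriangular bialgebra. -/
abbrev RevModO (A : C) [QuasitriangularBialgebra A] : Type _ :=
  @ModO C _ _ (reverseBraiding C) A (QuasitriangularBialgebra.reverse A)

/-- The category structure of `RevModO A`, with the instances made explicit. -/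
abbrev revCategory (A : C) [QuasitriangularBialgebra A] : Category (RevModO A) :=
  @instCategory C _ _ (reverseBraiding C) A (QuasitriangularBialgebra.reverse A)

/-- The monoidal structure of `RevModO A`, with the instances made explicit. -/
abbrev revMonoidal (A : C) [QuasitriangularBialgebra A] :
    @MonoidalCategory (RevModO A) (revCategory A) :=
  @instMonoidalCategory C _ _ (reverseBraiding C) A (QuasitriangularBialgebra.reverse A)

/-- The braiding of `RevModO A`, with the instances made explicit. -/
abbrev revBraided (A : C) [QuasitriangularBialgebra A] :
    @BraidedCategory (RevModO A) (revCategory A) (revMonoidal A) :=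
  @instBraidedCategory C _ _ (reverseBraiding C) A (QuasitriangularBialgebra.reverse A)

variable (B : ModO A) [QB : QuasitriangularBialgebra B]

/-- The algebra structure of `B`, as an object of `RevModO A`. Both categories have the same
diagonal action on tensor products, by `diagAct_bar`. -/
abbrev reverseMon : @MonObj (RevModO A) _ (revMonoidal A) B.reverse :=
  @MonObj.mk (RevModO A) _ (revMonoidal A) B.reverse
    (@Hom.mk C _ _ (reverseBraiding C) A (QuasitriangularBialgebra.reverse A) _ _ η[B].hom
      (Hom.comm η[B]))
    (@Hom.mk C _ _ (reverseBraiding C) A (QuasitriangularBialgebra.reverse A) _ _ μ[B].hom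
      ((congrArg (· ≫ μ[B].hom) (diagAct_bar B B).symm).trans (Hom.comm μ[B])))
    (by
      apply @ModO.hom_ext C _ _ (reverseBraiding C) A (QuasitriangularBialgebra.reverse A)
      have h := congrArg Hom.hom (MonObj.one_mul B)
      exact h)
    (by
      apply @ModO.hom_ext C _ _ (reverseBraiding C) A (QuasitriangularBialgebra.reverse A)
      have h := congrArg Hom.hom (MonObj.mul_one B)
      exact h)
    (by
      apply @ModO.hom_ext C _ _ (reverseBraiding C) A (QuasitriangularBialgebra.reverse A)
      have h := congrArg Hom.hom (MonObj.mul_assoc B)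
      exact h)

/-- The coalgebra structure of `B̄`, as an object of `RevModO A`. -/
abbrev reverseComon : @ComonObj (RevModO A) _ (revMonoidal A) B.reverse :=
  @ComonObj.mk (RevModO A) _ (revMonoidal A) B.reverse
    (@Hom.mk C _ _ (reverseBraiding C) A (QuasitriangularBialgebra.reverse A) _ _ ε[B].hom
      (Hom.comm ε[B]))
    (@Hom.mk C _ _ (reverseBraiding C) A (QuasitriangularBialgebra.reverse A) _ _ (comulBar B).hom
      ((Hom.comm (comulBar B)).trans
        (congrArg ((comulBar B).hom ▷ A ≫ ·) (diagAct_bar B B))))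
    (by
      apply @ModO.hom_ext C _ _ (reverseBraiding C) A (QuasitriangularBialgebra.reverse A)
      have h := congrArg Hom.hom (barComon B).counit_comul
      exact h)
    (by
      apply @ModO.hom_ext C _ _ (reverseBraiding C) A (QuasitriangularBialgebra.reverse A)
      have h := congrArg Hom.hom (barComon B).comul_counit
      exact h)
    (by
      apply @ModO.hom_ext C _ _ (reverseBraiding C) A (QuasitriangularBialgebra.reverse A)
      have h := congrArg Hom.hom (barComon B).comul_assoc
      exact h)

/-- The bialgebra `B̄`, as an object of `RevModO A`, whose braiding is the inverse of the braiding
of `C_{O(A, Ā)}`. -/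
abbrev reverseBimon : @BimonObj (RevModO A) _ (revMonoidal A) (revBraided A) B.reverse :=
  @BimonObj.mk (RevModO A) _ (revMonoidal A) (revBraided A) B.reverse (reverseMon B)
    (reverseComon B)
    (by
      apply @ModO.hom_ext C _ _ (reverseBraiding C) A (QuasitriangularBialgebra.reverse A)
      have h := congrArg Hom.hom (barBimon B).mul_comul
      exact h)
    (by
      apply @ModO.hom_ext C _ _ (reverseBraiding C) A (QuasitriangularBialgebra.reverse A)
      have h := congrArg Hom.hom (barBimon B).one_comul
      exact h)
    (by
      apply @ModO.hom_ext C _ _ (reverseBraiding C) A (QuasitriangularBialgebra.reverse A)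
      have h := congrArg Hom.hom (barBimon B).mul_counit
      exact h)
    (by
      apply @ModO.hom_ext C _ _ (reverseBraiding C) A (QuasitriangularBialgebra.reverse A)
      have h := congrArg Hom.hom (barBimon B).one_counit
      exact h)

/-- The R-matrix of the reversed quasitriangular bialgebra `(B̄, B)`. -/
abbrev reverseR : 𝟙_ C ⟶ B.obj ⊗ B.obj := (Rbar B).hom

lemma isCoinvariant_reverseR :
    @IsCoinvariant C _ _ (reverseBraiding C) A (QuasitriangularBialgebra.reverse A) B.reverse
      (reverseR B) :=
  @isCoinvariant_hom C _ _ (reverseBraiding C) A (QuasitriangularBialgebra.reverse A) B.reverse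
    (@Hom.mk C _ _ (reverseBraiding C) A (QuasitriangularBialgebra.reverse A) _ _ (reverseR B)
      ((Hom.comm (Rbar B)).trans (congrArg ((Rbar B).hom ▷ A ≫ ·) (diagAct_bar B B))))

lemma isRightCopairing_reverseR :
    IsRightCopairing (comulBar B).hom (reverseR B) :=
  congrArg Hom.hom (QuasitriangularBialgebra.reverse B).R_comul_right

end ModO

/-- A smash product in `C` is also a smash product in `C` with the inverse braiding: by the defining
condition of `C_{O(A, Ā)}` the two exchange relations agree. -/
lemma IsSmashProduct.reverse {B : ModO A} [QB : QuasitriangularBialgebra B] {K : C} [MonObj K]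
    {i : A ⟶ K} {j : B.obj ⟶ K} (h : IsSmashProduct B i j) :
    @IsSmashProduct C _ _ (reverseBraiding C) A (QuasitriangularBialgebra.reverse A) B.reverse
      (reverseMon B) K _ i j :=
  @IsSmashProduct.mk C _ _ (reverseBraiding C) A (QuasitriangularBialgebra.reverse A) B.reverse
      (reverseMon B) K _ i j h.hom_left h.hom_right
    (by
      have := h.exchange
      rw [B.swap_eq] at this
      exact this) h.isIso

/-- The R-matrix of `B`, as an element of `B ⊗ B` in `C`. -/
def R₀ (B : ModO A) [QB : QuasitriangularBialgebra B] : 𝟙_ C ⟶ B.obj ⊗ B.obj := QB.R.hom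

/-- The inverse R-matrix of `B`, as an element of `B ⊗ B` in `C`. -/
def Rinv₀ (B : ModO A) [QB : QuasitriangularBialgebra B] : 𝟙_ C ⟶ B.obj ⊗ B.obj := QB.Rinv.hom

/-- The comultiplication of `B̄`, as a morphism of `C`. -/
def comulBar₀ (B : ModO A) [QB : QuasitriangularBialgebra B] : B.obj ⟶ B.obj ⊗ B.obj :=
  (BraidedQuantum.comulBar B).hom

lemma isInverse_R₀ (B : ModO A) [QB : QuasitriangularBialgebra B] :
    @IsInverse C _ _ (B ⊗ B : ModO A).obj _ (R₀ B) (Rinv₀ B) :=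
  isInverse_hom (isInverse_R B)

lemma isInvariant_R₀ (B : ModO A) [QB : QuasitriangularBialgebra B] : IsInvariant (R₀ B) :=
  isInvariant_hom QB.R

lemma isCoinvariant_R₀ (B : ModO A) [QB : QuasitriangularBialgebra B] : IsCoinvariant (R₀ B) :=
  isCoinvariant_hom QB.R

namespace IsSmashProduct

variable {B : ModO A} [QB : QuasitriangularBialgebra B] {K : C} [MonObj K]
  {i : A ⟶ K} {j : B.obj ⟶ K}

/-- The coaction of `Ā` on `B`, with values in `K ⊗ K`. -/
abbrev coactInBar (i : A ⟶ K) (j : B.obj ⟶ K) : B.obj ⟶ K ⊗ K :=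
  @coactIn C _ _ (reverseBraiding C) A (QuasitriangularBialgebra.reverse A) B.reverse K i j

/-- The map `bosonMap` for the inverse braiding and the reversed bialgebras. -/
abbrev bosonMapBar (i : A ⟶ K) (j : B.obj ⟶ K) : B.obj ⊗ B.obj ⟶ K ⊗ K :=
  @bosonMap C _ _ (reverseBraiding C) A (QuasitriangularBialgebra.reverse A) B.reverse K _ i j

/-- In `K ⊗ K` the coaction of `Ā` on `x`, followed by the braiding, is the conjugate of `1 ⊗ x` by
the image of the R-matrix of `A`. -/
lemma coactInBar_braiding (h : IsSmashProduct B i j) :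
    coactInBar i j ≫ (β_ K K).hom =
      (j ≫ inr K K) ≫ rmul (QA.Rinv ≫ (i ⊗ₘ i)) ≫ lmul (imageR i) := by
  have hb : @IsMonHom C _ _ _ _ (revTensor K K) _ (β_ K K).hom := isMonHom_braiding
  have e : @imageR C _ _ (reverseBraiding C) A (QuasitriangularBialgebra.reverse A) K i ≫
      (β_ K K).hom = QA.Rinv ≫ (i ⊗ₘ i) := by
    change ((QA.Rinv ≫ (β_ A A).inv) ≫ (i ⊗ₘ i)) ≫ _ = _
    rw [Category.assoc, Category.assoc, braiding_naturality, Iso.inv_hom_id_assoc]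
  have h1 := congrArg (· ≫ (β_ K K).hom)
    (@coactIn_lmul C _ _ (reverseBraiding C) A (QuasitriangularBialgebra.reverse A) B.reverse
      (reverseMon B) K _ i j h.reverse)
  simp only [Category.assoc] at h1
  rw [@lmul_comp C _ _ _ _ (revTensor K K) _ _ _ hb,
    @rmul_comp C _ _ _ _ (revTensor K K) _ _ _ hb, e, reassoc_of% inl_comp_braiding] at h1
  rw [← Category.assoc, (isInverse_imageR h.hom_left).eq_comp_lmul_iff, Category.assoc,
    Category.assoc]
  simp only [Category.assoc]
  exact h1

/-- The link between the two comultiplications of the cross product: conjugation by the image of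
the R-matrix of `A` turns `bosonMapBar`, followed by the braiding of `C`, into the braiding of
`C_{O(A, Ā)}` followed by `bosonMap`. -/
lemma bosonMapBar_braiding (h : IsSmashProduct B i j) :
    (bosonMapBar i j ≫ (β_ K K).hom) ≫ rmul (imageR i) =
      crossedBraiding B.act (coact B) ≫ bosonMap i j ≫ lmul (imageR i) := by
  have hb : @IsMonHom C _ _ _ _ (revTensor K K) _ (β_ K K).hom := isMonHom_braiding
  have e : bosonMapBar i j ≫ (β_ K K).hom =
      (coactInBar i j ≫ (β_ K K).hom) ⊛ (j ≫ inl K K) := by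
    change @bosonMap C _ _ (reverseBraiding C) A (QuasitriangularBialgebra.reverse A) B.reverse K _
      i j ≫ _ = _
    unfold bosonMap
    rw [@mulMap_comp C _ _ _ _ _ _ (revTensor K K) _ _ _ _ hb,
      Category.assoc j, inr_comp_braiding]
  have e2 : rmul (QA.Rinv ≫ (i ⊗ₘ i)) ≫ lmul (imageR i) ≫ rmul (imageR i) = lmul (imageR i) := by
    rw [lmul_rmul_comm, reassoc_of% (isInverse_imageR h.hom_left).symm.rmul_rmul]
  have e3 : (coactInBar i j ≫ (β_ K K).hom) ≫ rmul (imageR i) =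
      (j ≫ inr K K) ≫ lmul (imageR i) := by
    rw [h.coactInBar_braiding]
    simp only [Category.assoc]
    rw [e2]
  rw [e, mulMap_rmul, ← h.coactIn_lmul, ← rmul_mulMap, e3, ← mulMap_lmul, h.inr_mulMap_coactIn,
    bosonMap, Category.assoc]

/-- The comultiplication of the cross product `Ā ⋉ B̄`. -/
noncomputable abbrev comulBar (h : IsSmashProduct B i j) : K ⟶ K ⊗ K :=
  @IsSmashProduct.comul C _ _ (reverseBraiding C) A (QuasitriangularBialgebra.reverse A) B.reverse
    (reverseBimon B) K _ i j h.reverse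

lemma left_comulBar (h : IsSmashProduct B i j) :
    i ≫ h.comulBar = BraidedQuantum.comulBar A ≫ (i ⊗ₘ i) :=
  @IsSmashProduct.left_comul C _ _ (reverseBraiding C) A (QuasitriangularBialgebra.reverse A)
    B.reverse (reverseBimon B) K _ i j h.reverse

lemma right_comulBar (h : IsSmashProduct B i j) :
    j ≫ h.comulBar = comulBar₀ B ≫ bosonMapBar i j :=
  @IsSmashProduct.right_comul C _ _ (reverseBraiding C) A (QuasitriangularBialgebra.reverse A)
    B.reverse (reverseBimon B) K _ i j h.reverse

lemma isMonHom_comulBar_braiding (h : IsSmashProduct B i j) :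
    IsMonHom (h.comulBar ≫ (β_ K K).hom) :=
  @instIsMonHomComp C _ _ _ _ _ _ (revTensor K K) _ _ _
    (@IsSmashProduct.isMonHom_comul C _ _ (reverseBraiding C) A
      (QuasitriangularBialgebra.reverse A) B.reverse (reverseBimon B) K _ i j h.reverse)
    isMonHom_braiding

/-- The image of an invariant element of `B ⊗ B` commutes with the image of `Δ_A`. -/
lemma comul_invariant (h : IsSmashProduct B i j) {r : 𝟙_ C ⟶ B.obj ⊗ B.obj} (hr : IsInvariant r) :
    (Δ[A] ≫ (i ⊗ₘ i)) ≫ rmul (r ≫ bosonMap i j) = (Δ[A] ≫ (i ⊗ₘ i)) ≫ lmul (r ≫ bosonMap i j) := by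
  have hr' : r ▷ A ≫ swapAct Δ[A] (diagAct Δ[A] B.act B.act) = _ := hr
  have e := congrArg (fun f => (λ_ A).inv ≫ r ▷ A ≫ f) h.bosonMap_mulMap_comul
  simp only [reassoc_of% hr', Iso.inv_hom_id_assoc] at e
  rw [whiskerLeft_mulMap, whiskerRight_mulMap] at e
  rw [comp_rmul, comp_lmul, ← e]

/-- In `K ⊗ K`, the image of `r` intertwines the images of the two comultiplications of `B`. -/
lemma comulBar_bosonMap_rmul (h : IsSmashProduct B i j) :
    comulBar₀ B ≫ crossedBraiding B.act (coact B) ≫ bosonMap i j ≫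
      rmul (R₀ B ≫ bosonMap i j) = Δ[B.obj] ≫ bosonMap i j ≫ lmul (R₀ B ≫ bosonMap i j) := by
  have hJ := h.isMonHom_bosonMap
  have e := congrArg Hom.hom (comulBar_braiding_rmul_R B)
  have e' : (comulBar₀ B ≫ crossedBraiding B.act (coact B)) ≫
      @rmul C _ _ (B ⊗ B : ModO A).obj _ (R₀ B) =
        Δ[B.obj] ≫ @lmul C _ _ (B ⊗ B : ModO A).obj _ (R₀ B) := e
  have e1 := @rmul_comp C _ _ (B ⊗ B : ModO A).obj (K ⊗ K) _ _ (R₀ B) (bosonMap i j) hJ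
  have e2 := @lmul_comp C _ _ (B ⊗ B : ModO A).obj (K ⊗ K) _ _ (R₀ B) (bosonMap i j) hJ
  have e3 := congrArg (· ≫ bosonMap i j) e'
  refine Eq.trans ?_ (e3.trans ((Category.assoc _ _ _).trans ?_))
  · exact (congrArg (fun f => comulBar₀ B ≫
      crossedBraiding B.act (coact B) ≫ f) e1.symm).trans
        ((Category.assoc _ _ _).symm.trans (Category.assoc _ _ _).symm)
  · exact congrArg (fun f => Δ[B.obj] ≫ f) e2

/-- The R-matrix of the cross product intertwines its two comultiplications. Conjugation by it is a
morphism of monoids, so that the identity may be checked on `A` and on `B`: on `A` it follows from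
the intertwining property of `R_A` and the invariance of `R_B`, on `B` from `bosonMapBar_braiding`
and the intertwining property of `R_B`. -/
lemma comul_crossElement (h : IsSmashProduct B i j) :
    (h.comulBar ≫ (β_ K K).hom) ≫ rmul (crossElement i j (R₀ B)) =
      h.comul ≫ lmul (crossElement i j (R₀ B)) := by
  have hi := h.hom_left
  have := h.isMonHom_comul
  have := h.isMonHom_comulBar_braiding
  have hR := h.isInverse_crossElement (isInverse_R₀ B)
  have e : crossElement i j (R₀ B) = (R₀ B ≫ bosonMap i j) ≫ lmul (imageR i) :=
    (Category.assoc _ _ _).symm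
  have er : rmul (crossElement i j (R₀ B)) =
      rmul (imageR i) ≫ rmul (R₀ B ≫ bosonMap i j) := by rw [rmul_rmul, elem_rmul, ← e]
  have el : lmul (crossElement i j (R₀ B)) =
      lmul (R₀ B ≫ bosonMap i j) ≫ lmul (imageR i) := by rw [lmul_lmul, ← e]
  have hconj := hR.isMonHom_conj
  have key : (h.comulBar ≫ (β_ K K).hom) ≫ (rmul (crossElement i j (R₀ B)) ≫
      lmul ((QA.Rinv ≫ (i ⊗ₘ i)) ≫ lmul (Rinv₀ B ≫ bosonMap i j))) = h.comul := by
    have hl : IsMonHom ((h.comulBar ≫ (β_ K K).hom) ≫ (rmul (crossElement i j (R₀ B)) ≫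
      lmul ((QA.Rinv ≫ (i ⊗ₘ i)) ≫ lmul (Rinv₀ B ≫ bosonMap i j)))) := instIsMonHomComp _ _
    apply h.hom_ext
    · rw [← Category.assoc, ← Category.assoc, ← Category.assoc, ← hR.eq_comp_lmul_iff,
        h.left_comulBar, h.left_comul, er, el]
      have e1 : (BraidedQuantum.comulBar A ≫ (i ⊗ₘ i)) ≫ (β_ K K).hom =
        (BraidedQuantum.comulBar A ≫ (β_ A A).hom) ≫ (i ⊗ₘ i) := by simp
      have e2 := congrArg (· ≫ (i ⊗ₘ i)) (comulBar_braiding_rmul_R A)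
      simp only [Category.assoc] at e2
      rw [rmul_comp, lmul_comp] at e2
      have e3 := h.comul_invariant (isInvariant_R₀ B)
      simp only [Category.assoc] at e3
      rw [e1]
      simp only [Category.assoc]
      rw [← reassoc_of% e3, reassoc_of% e2, lmul_rmul_comm]
    · rw [← Category.assoc, ← Category.assoc, ← Category.assoc, ← hR.eq_comp_lmul_iff,
        h.right_comulBar, h.right_comul, er, el]
      simp only [Category.assoc]
      have e1 := h.bosonMapBar_braiding
      simp only [Category.assoc] at e1
      have e2 := h.comulBar_bosonMap_rmul
      rw [reassoc_of% e1, lmul_rmul_comm, reassoc_of% e2]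
  rw [← Category.assoc, ← hR.eq_comp_lmul_iff] at key
  exact key

end IsSmashProduct

/-! ### The quasitriangular structure -/

/-- The braiding of `C_{O(A, Ā)}` takes the R-matrix of the reversed bialgebra to `R_B⁻¹`. -/
lemma reverseR_braiding (B : ModO A) [QB : QuasitriangularBialgebra B] :
    reverseR B ≫ crossedBraiding B.act (coact B) = Rinv₀ B :=
  congrArg Hom.hom (show (QB.Rinv ≫ (β_ B B).inv) ≫ (β_ B B).hom = QB.Rinv by simp)

namespace IsSmashProduct

variable {B : ModO A} [QB : QuasitriangularBialgebra B] {K : C} [MonObj K]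
  {i : A ⟶ K} {j : B.obj ⟶ K}

/-- The R-matrix of `A ⋉ B`. -/
abbrev crossR (i : A ⟶ K) (j : B.obj ⟶ K) : 𝟙_ C ⟶ K ⊗ K := crossElement i j (R₀ B)

/-- The inverse of the R-matrix of `A ⋉ B`. -/
abbrev crossRinv (i : A ⟶ K) (j : B.obj ⟶ K) : 𝟙_ C ⟶ K ⊗ K :=
  (QA.Rinv ≫ (i ⊗ₘ i)) ≫ lmul (Rinv₀ B ≫ bosonMap i j)

/-- The R-matrix of `Ā ⋉ B̄`. -/
abbrev crossRBar (i : A ⟶ K) (j : B.obj ⟶ K) : 𝟙_ C ⟶ K ⊗ K :=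
  @crossElement C _ _ (reverseBraiding C) A (QuasitriangularBialgebra.reverse A) B.reverse K _ i j
    (reverseR B)

/-- The R-matrix of `Ā ⋉ B̄` is `Ψ⁻¹` applied to the inverse of the R-matrix of `A ⋉ B`. -/
lemma crossRBar_braiding (h : IsSmashProduct B i j) :
    crossRBar i j ≫ (β_ K K).hom = crossRinv i j := by
  have hb : @IsMonHom C _ _ _ _ (revTensor K K) _ (β_ K K).hom := isMonHom_braiding
  have hR := isInverse_imageR (QA := QA) h.hom_left
  have e : @imageR C _ _ (reverseBraiding C) A (QuasitriangularBialgebra.reverse A) K i ≫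
      (β_ K K).hom = QA.Rinv ≫ (i ⊗ₘ i) := by
    change ((QA.Rinv ≫ (β_ A A).inv) ≫ (i ⊗ₘ i)) ≫ _ = _
    rw [Category.assoc, Category.assoc, braiding_naturality, Iso.inv_hom_id_assoc]
  have e1 : crossRBar i j ≫ (β_ K K).hom =
      reverseR B ≫ (bosonMapBar i j ≫ (β_ K K).hom) ≫ lmul (QA.Rinv ≫ (i ⊗ₘ i)) := by
    change (reverseR B ≫ bosonMapBar i j ≫ @lmul C _ _ _ (revTensor K K) _) ≫ _ = _
    rw [Category.assoc, Category.assoc, @lmul_comp C _ _ _ _ (revTensor K K) _ _ _ hb, e,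
      Category.assoc]
  have e2 := reverseR_braiding B
  have e3 : lmul (imageR i) ≫ rmul (QA.Rinv ≫ (i ⊗ₘ i)) ≫ lmul (QA.Rinv ≫ (i ⊗ₘ i)) =
      rmul (QA.Rinv ≫ (i ⊗ₘ i)) := by
    rw [← lmul_rmul_comm, reassoc_of% hR.lmul_lmul]
  rw [e1, hR.symm.eq_comp_rmul_iff.2 h.bosonMapBar_braiding, crossRinv, ← elem_rmul]
  simp only [Category.assoc] at e3 ⊢
  rw [reassoc_of% e2, e3]

/-- The copairing condition in the first leg is the condition in the second leg for the reversed
bialgebras. -/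
lemma isLeftCopairing_crossR (h : IsSmashProduct B i j) :
    IsLeftCopairing (h.comulBar ≫ (β_ K K).hom) (crossR i j) := by
  have := h.isMonHom_comulBar_braiding
  have e : crossRinv i j ≫ (β_ K K).inv = crossRBar i j := by
    rw [← h.crossRBar_braiding, Category.assoc, Iso.hom_inv_id, Category.comp_id]
  refine (isLeftCopairing_iff_reverse (h.isInverse_crossElement (isInverse_R₀ B))).2 ?_
  rw [e]
  exact @isRightCopairing_crossElement C _ _ (reverseBraiding C) A
    (QuasitriangularBialgebra.reverse A) B.reverse (reverseBimon B) K _ i j h.reverse (reverseR B)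
    (isCoinvariant_reverseR B) (isRightCopairing_reverseR B)

lemma isRightCopairing_crossR (h : IsSmashProduct B i j) :
    IsRightCopairing h.comul (crossR i j) :=
  h.isRightCopairing_crossElement (isCoinvariant_R₀ B) (congrArg Hom.hom QB.R_comul_right)

/-- The bialgebra `Ā ⋉ B̄` in `C` with the inverse braiding. -/
noncomputable abbrev bimonObjBar (h : IsSmashProduct B i j) :
    @BimonObj C _ _ (reverseBraiding C) K :=
  @IsSmashProduct.bimonObj C _ _ (reverseBraiding C) A (QuasitriangularBialgebra.reverse A)
    B.reverse (reverseBimon B) K _ i j h.reverse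

/-- The quasitriangular bialgebra `(A ⋉ B, Ā ⋉ B̄, R)`. -/
noncomputable abbrev quasitriangularBialgebra (h : IsSmashProduct B i j) :
    QuasitriangularBialgebra K where
  toBimonObj := h.bimonObj
  bar := h.bimonObjBar
  bar_mul := rfl
  bar_one := rfl
  bar_counit := rfl
  R := crossR i j
  Rinv := crossRinv i j
  R_mul_Rinv := (h.isInverse_crossElement (isInverse_R₀ B)).tensorHom_mul
  Rinv_mul_R := (h.isInverse_crossElement (isInverse_R₀ B)).symm.tensorHom_mul
  R_counit_left := h.crossElement_counit_left (congrArg Hom.hom QB.R_counit_left)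
  R_counit_right := h.crossElement_counit_right (congrArg Hom.hom QB.R_counit_right)
  R_comul_left := h.isLeftCopairing_crossR
  R_comul_right := h.isRightCopairing_crossR
  comul_R := by
    have e := h.comul_crossElement
    rw [comp_rmul, comp_lmul] at e
    exact e

end IsSmashProduct

/-! ### Explicit formulas for the structure maps -/

namespace IsSmashProduct

variable {B : ModO A} {K : C} [MonObj K] {i : A ⟶ K} {j : B.obj ⟶ K}

/-- Under `A ⊗ B ≅ K` the comultiplication of `K` is that of the cross product. -/
lemma mulMap_comul [BimonObj B] (h : IsSmashProduct B i j) :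
    (i ⊛ j) ≫ h.comul =
      crossComul μ[A] Δ[A] (coact B) Δ[B.obj] ≫ ((i ⊛ j) ⊗ₘ (i ⊛ j)) := by
  have := h.isMonHom_comul
  have hi := h.hom_left
  have e : i ⊛ i = μ[A] ≫ i := (IsMonHom.mul_hom i).symm
  have e1 : (i ⊛ (i ⊛ j)) = (α_ _ _ _).inv ≫ μ[A] ▷ B.obj ≫ (i ⊛ j) := by
    rw [mulMap_assoc', e, whiskerRight_mulMap]
  have e2 : (i ⊗ₘ i) ⊛ bosonMap i j = (α_ A A (B.obj ⊗ B.obj)).hom ≫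
      A ◁ ((α_ A B.obj B.obj).inv ≫ swapCoact μ[A] (coact B) ▷ B.obj ≫ (α_ B.obj A B.obj).hom) ≫
        (α_ A B.obj (A ⊗ B.obj)).inv ≫ ((i ⊛ j) ⊗ₘ (i ⊛ j)) := by
    have e3 : ((i ⊛ j) ⊗ₘ (i ⊛ (i ⊛ j))) = (A ⊗ B.obj) ◁ ((α_ _ _ _).inv ≫ μ[A] ▷ B.obj) ≫
        ((i ⊛ j) ⊗ₘ (i ⊛ j)) := by
      rw [e1, ← id_tensorHom, tensorHom_comp_tensorHom, Category.id_comp, Category.assoc]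
    rw [bosonMap, coactIn, ← whiskerRight_mulMap, tensorHom_mulMap_inr, ← whiskerLeft_mulMap,
      ← whiskerLeft_mulMap, tensorHom_mulMap_tensorHom, e3, tensorμ, swapCoact]
    monoidal
  rw [mulMap_comp, h.left_comul, h.right_comul, ← tensorHom_mulMap, e2, crossComul]
  simp only [Category.assoc]

lemma mulMap_counit [BimonObj B] (h : IsSmashProduct B i j) :
    (i ⊛ j) ≫ h.counit = (ε[A] ⊗ₘ ε[B.obj]) ≫ (λ_ (𝟙_ C)).hom := by
  have := h.isMonHom_counit
  rw [mulMap_comp, h.left_counit, h.right_counit]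
  rfl

/-- The R-matrix is the product of the images of `R_A` and `R_B` in the order `j, i` in the first
leg and `i, j` in the second. -/
lemma crossElement_eq [MonObj B] (h : IsSmashProduct B i j) (r : 𝟙_ C ⟶ B.obj ⊗ B.obj) :
    crossElement i j r = BraidedQuantum.crossR μ[K] i j QA.R r := by
  have e1 : bosonMap i j ≫ lmul (imageR i) =
      ((ρ_ B.obj).inv ≫ B.obj ◁ QA.R ≫ (α_ B.obj A A).inv) ▷ B.obj ≫
        (α_ (B.obj ⊗ A) A B.obj).hom ≫ ((j ⊛ i) ⊗ₘ (i ⊛ j)) := by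
    have e0 : (j ≫ inl K K) ≫ rmul (imageR i) =
        ((ρ_ B.obj).inv ≫ B.obj ◁ QA.R ≫ (α_ B.obj A A).inv) ≫ ((j ⊛ i) ⊗ₘ i) := by
      rw [comp_rmul, ← whiskerLeft_mulMap, inl_mulMap_tensorHom]
      simp only [Category.assoc]
    rw [bosonMap, mulMap_lmul, h.coactIn_lmul, e0, ← tensorHom_mulMap_inr, whiskerRight_mulMap]
  have e2 : (j ⊗ₘ j) ≫ K ◁ ((λ_ K).inv ≫ (QA.R ≫ (i ⊗ₘ i)) ▷ K ≫ (α_ K K K).hom) ≫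
      (α_ K K (K ⊗ K)).inv = B.obj ◁ ((λ_ B.obj).inv ≫ QA.R ▷ B.obj ≫ (α_ A A B.obj).hom) ≫
        (α_ B.obj A (A ⊗ B.obj)).inv ≫ ((j ⊗ₘ i) ⊗ₘ (i ⊗ₘ j)) := by
    have e3 : K ◁ ((λ_ K).inv ≫ (QA.R ≫ (i ⊗ₘ i)) ▷ K ≫ (α_ K K K).hom) =
        K ◁ ((λ_ K).inv ≫ QA.R ▷ K) ≫ (𝟙 K ⊗ₘ ((i ⊗ₘ i) ⊗ₘ 𝟙 K)) ≫ K ◁ (α_ K K K).hom := by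
      simp
    have e4 : (j ⊗ₘ j) ≫ K ◁ ((λ_ K).inv ≫ QA.R ▷ K) =
        B.obj ◁ ((λ_ B.obj).inv ≫ QA.R ▷ B.obj) ≫ (j ⊗ₘ (𝟙 _ ⊗ₘ j)) := by
      rw [← id_tensorHom, tensorHom_comp_tensorHom, ← id_tensorHom, tensorHom_comp_tensorHom,
        Category.comp_id, Category.id_comp, leftUnitor_inv_naturality_assoc, id_tensorHom,
        Category.assoc, whisker_exchange]
    have e5 : (j ⊗ₘ ((i ⊗ₘ i) ⊗ₘ j)) ≫ K ◁ (α_ K K K).hom =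
        B.obj ◁ (α_ A A B.obj).hom ≫ (j ⊗ₘ (i ⊗ₘ (i ⊗ₘ j))) := by
      rw [← id_tensorHom, tensorHom_comp_tensorHom, ← id_tensorHom, tensorHom_comp_tensorHom,
        Category.comp_id, Category.id_comp, associator_naturality]
    simp only [e3, Category.assoc]
    rw [reassoc_of% e4, tensorHom_comp_tensorHom_assoc, tensorHom_comp_tensorHom,
      Category.comp_id, Category.id_comp, reassoc_of% e5,
      associator_inv_naturality]
    simp only [whiskerLeft_comp, Category.assoc]
  rw [crossElement, e1, BraidedQuantum.crossR, reassoc_of% e2, mulMap, mulMap,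
    ← tensorHom_comp_tensorHom]
  congr 1
  monoidal

end IsSmashProduct

end Smash

/-! ### The smash product on the object `A ⊗ B` -/

section Concrete

variable {C : Type u} [Category.{v} C] [MonoidalCategory C] {X Y : C}

lemma one_twistMul {t : Y ⊗ X ⟶ X ⊗ Y} {mX : X ⊗ X ⟶ X} {mY : Y ⊗ Y ⟶ Y} {eX : 𝟙_ C ⟶ X}
    {eY : 𝟙_ C ⟶ Y} (hX : eX ▷ X ≫ mX = (λ_ X).hom) (hY : eY ▷ Y ≫ mY = (λ_ Y).hom)
    (ht : eY ▷ X ≫ t = (λ_ X).hom ≫ (ρ_ X).inv ≫ X ◁ eY) :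
    ((λ_ (𝟙_ C)).inv ≫ (eX ⊗ₘ eY)) ▷ (X ⊗ Y) ≫ twistMul t mX mY = (λ_ (X ⊗ Y)).hom := by
  calc
    _ = 𝟙 _ ⊗≫ eX ▷ (X ⊗ Y) ⊗≫ X ◁ (eY ▷ X ≫ t) ▷ Y ⊗≫ X ◁ X ◁ mY ⊗≫ mX ▷ Y := by
      simp only [twistMul, MonoidalCategory.tensorHom_def eX eY, tensorHom_def' mX mY]
      monoidal
    _ = 𝟙 _ ⊗≫ eX ▷ (X ⊗ Y) ⊗≫ X ◁ X ◁ (eY ▷ Y ≫ mY) ⊗≫ mX ▷ Y := by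
      rw [ht]; monoidal
    _ = 𝟙 _ ⊗≫ (eX ▷ X ≫ mX) ▷ Y := by
      rw [hY]; monoidal
    _ = _ := by rw [hX]; monoidal

lemma twistMul_one {t : Y ⊗ X ⟶ X ⊗ Y} {mX : X ⊗ X ⟶ X} {mY : Y ⊗ Y ⟶ Y} {eX : 𝟙_ C ⟶ X}
    {eY : 𝟙_ C ⟶ Y} (hX : X ◁ eX ≫ mX = (ρ_ X).hom) (hY : Y ◁ eY ≫ mY = (ρ_ Y).hom)
    (ht : Y ◁ eX ≫ t = (ρ_ Y).hom ≫ (λ_ Y).inv ≫ eX ▷ Y) :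
    (X ⊗ Y) ◁ ((λ_ (𝟙_ C)).inv ≫ (eX ⊗ₘ eY)) ≫ twistMul t mX mY = (ρ_ (X ⊗ Y)).hom := by
  calc
    _ = 𝟙 _ ⊗≫ X ◁ Y ◁ eY ⊗≫ X ◁ (Y ◁ eX ≫ t) ▷ Y ⊗≫ mX ▷ Y ▷ Y ⊗≫ X ◁ mY := by
      simp only [twistMul, tensorHom_def' eX eY, MonoidalCategory.tensorHom_def mX mY]
      monoidal
    _ = 𝟙 _ ⊗≫ X ◁ Y ◁ eY ⊗≫ (X ◁ eX ≫ mX) ▷ Y ▷ Y ⊗≫ X ◁ mY := by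
      rw [ht]; monoidal
    _ = 𝟙 _ ⊗≫ X ◁ (Y ◁ eY ≫ mY) := by
      rw [hX]; monoidal
    _ = _ := by rw [hY]; monoidal

section Inclusions

variable {t : Y ⊗ X ⟶ X ⊗ Y} {mX : X ⊗ X ⟶ X} {mY : Y ⊗ Y ⟶ Y} {eX : 𝟙_ C ⟶ X} {eY : 𝟙_ C ⟶ Y}

lemma twistMul_inl_inl (hY : Y ◁ eY ≫ mY = (ρ_ Y).hom)
    (ht : eY ▷ X ≫ t = (λ_ X).hom ≫ (ρ_ X).inv ≫ X ◁ eY) :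
    (crossInl X eY ⊗ₘ crossInl X eY) ≫ twistMul t mX mY = mX ≫ crossInl X eY := by
  calc
    _ = 𝟙 _ ⊗≫ X ◁ eY ▷ X ⊗≫ X ◁ ((Y ⊗ X) ◁ eY ≫ t ▷ Y) ⊗≫ X ◁ X ◁ mY ⊗≫ mX ▷ Y := by
      simp only [crossInl, twistMul, MonoidalCategory.tensorHom_def (_ ≫ _) (_ ≫ _),
        tensorHom_def' mX mY]
      monoidal
    _ = 𝟙 _ ⊗≫ X ◁ (eY ▷ X ≫ t) ⊗≫ X ◁ X ◁ (Y ◁ eY ≫ mY) ⊗≫ mX ▷ Y := by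
      rw [whisker_exchange]; monoidal
    _ = 𝟙 _ ⊗≫ ((X ⊗ X) ◁ eY ≫ mX ▷ Y) := by
      rw [ht, hY]; monoidal
    _ = _ := by
      rw [whisker_exchange, crossInl]; monoidal

lemma twistMul_inr_inr (hX : X ◁ eX ≫ mX = (ρ_ X).hom)
    (ht : Y ◁ eX ≫ t = (ρ_ Y).hom ≫ (λ_ Y).inv ≫ eX ▷ Y) :
    (crossInr eX Y ⊗ₘ crossInr eX Y) ≫ twistMul t mX mY = mY ≫ crossInr eX Y := by
  calc
    _ = 𝟙 _ ⊗≫ eX ▷ Y ▷ Y ⊗≫ X ◁ (Y ◁ eX ≫ t) ▷ Y ⊗≫ mX ▷ Y ▷ Y ⊗≫ X ◁ mY := by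
      simp only [crossInr, twistMul, MonoidalCategory.tensorHom_def]
      monoidal
    _ = 𝟙 _ ⊗≫ eX ▷ Y ▷ Y ⊗≫ (X ◁ eX ≫ mX) ▷ Y ▷ Y ⊗≫ X ◁ mY := by
      rw [ht]; monoidal
    _ = 𝟙 _ ⊗≫ (eX ▷ (Y ⊗ Y) ≫ X ◁ mY) := by
      rw [hX]; monoidal
    _ = _ := by
      rw [← whisker_exchange, crossInr]; monoidal

lemma twistMul_inl_inr (hX : X ◁ eX ≫ mX = (ρ_ X).hom) (hY : eY ▷ Y ≫ mY = (λ_ Y).hom)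
    (ht : Y ◁ eX ≫ t = (ρ_ Y).hom ≫ (λ_ Y).inv ≫ eX ▷ Y) :
    (crossInl X eY ⊗ₘ crossInr eX Y) ≫ twistMul t mX mY = 𝟙 (X ⊗ Y) := by
  calc
    _ = 𝟙 _ ⊗≫ X ◁ eY ▷ Y ⊗≫ X ◁ (Y ◁ eX ≫ t) ▷ Y ⊗≫ mX ▷ Y ▷ Y ⊗≫ X ◁ mY := by
      simp only [crossInl, crossInr, twistMul, MonoidalCategory.tensorHom_def]
      monoidal
    _ = 𝟙 _ ⊗≫ X ◁ (eY ▷ Y) ⊗≫ (X ◁ eX ≫ mX) ▷ Y ▷ Y ⊗≫ X ◁ mY := by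
      rw [ht]; monoidal
    _ = 𝟙 _ ⊗≫ X ◁ (eY ▷ Y ≫ mY) := by
      rw [hX]; monoidal
    _ = _ := by
      rw [hY]; monoidal

lemma twistMul_inr_inl (hX : eX ▷ X ≫ mX = (λ_ X).hom) (hY : Y ◁ eY ≫ mY = (ρ_ Y).hom) :
    (crossInr eX Y ⊗ₘ crossInl X eY) ≫ twistMul t mX mY = t := by
  calc
    _ = 𝟙 _ ⊗≫ eX ▷ (Y ⊗ X) ⊗≫ X ◁ ((Y ⊗ X) ◁ eY ≫ t ▷ Y) ⊗≫ X ◁ X ◁ mY ⊗≫ mX ▷ Y := by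
      simp only [crossInl, crossInr, twistMul, MonoidalCategory.tensorHom_def (_ ≫ _) (_ ≫ _),
        tensorHom_def' mX mY]
      monoidal
    _ = 𝟙 _ ⊗≫ (eX ▷ (Y ⊗ X) ≫ X ◁ t) ⊗≫ X ◁ X ◁ (Y ◁ eY ≫ mY) ⊗≫ mX ▷ Y := by
      rw [whisker_exchange]; monoidal
    _ = 𝟙 _ ⊗≫ t ⊗≫ (eX ▷ X ≫ mX) ▷ Y := by
      rw [hY, ← whisker_exchange]; monoidal
    _ = _ := by
      rw [hX]; monoidal

end Inclusions

variable [BraidedCategory C] {A : C} [BimonObj A]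

lemma one_swapAct (a : X ⊗ A ⟶ X) (ha : X ◁ η[A] ≫ a = (ρ_ X).hom) :
    X ◁ η[A] ≫ swapAct Δ[A] a = (ρ_ X).hom ≫ (λ_ X).inv ≫ η[A] ▷ X := by
  have h1 : η[A] ≫ Δ[A] = (λ_ (𝟙_ C)).inv ≫ (η[A] ⊗ₘ η[A]) := BimonObj.one_comul A
  calc
    _ = X ◁ (η[A] ≫ Δ[A]) ≫ (α_ X A A).inv ≫ (β_ X A).hom ▷ A ≫ (α_ A X A).hom ≫ A ◁ a := by
      simp only [swapAct]; monoidal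
    _ = 𝟙 _ ⊗≫ X ◁ η[A] ⊗≫ ((X ⊗ A) ◁ η[A] ≫ (β_ X A).hom ▷ A) ⊗≫ A ◁ a := by
      rw [h1, MonoidalCategory.tensorHom_def]; monoidal
    _ = 𝟙 _ ⊗≫ (X ◁ η[A] ≫ (β_ X A).hom) ⊗≫ A ◁ (X ◁ η[A] ≫ a) := by
      rw [whisker_exchange]; monoidal
    _ = _ := by
      rw [braiding_naturality_right, braiding_tensorUnit_right, ha]; monoidal

/-- Compatibility of the exchange map `X ⊗ A ⟶ A ⊗ X` with the multiplication of `A`. -/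
lemma mul_swapAct (a : X ⊗ A ⟶ X) (ha : a ▷ A ≫ a = (α_ X A A).hom ≫ X ◁ μ[A] ≫ a) :
    X ◁ μ[A] ≫ swapAct Δ[A] a = (α_ X A A).inv ≫ swapAct Δ[A] a ▷ A ≫ (α_ A X A).hom ≫
      A ◁ swapAct Δ[A] a ≫ (α_ A A X).inv ≫ μ[A] ▷ X := by
  have h1 : μ[A] ≫ Δ[A] = (Δ[A] ⊗ₘ Δ[A]) ≫ tensorμ A A A A ≫ (μ[A] ⊗ₘ μ[A]) :=
    BimonObj.mul_comul A
  have h2 : X ◁ μ[A] ≫ (β_ X A).hom =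
      (α_ X A A).inv ≫ (β_ X A).hom ▷ A ≫ (α_ A X A).hom ≫ A ◁ (β_ X A).hom ≫
        (α_ A A X).inv ≫ μ[A] ▷ X := by
    rw [braiding_naturality_right, braiding_tensor_right_hom]; simp
  have h3 : a ▷ A ≫ (β_ X A).hom = (α_ X A A).hom ≫ X ◁ (β_ A A).hom ≫ (α_ X A A).inv ≫
      (β_ X A).hom ▷ A ≫ (α_ A X A).hom ≫ A ◁ a := by
    rw [braiding_naturality_left, braiding_tensor_left_hom]; simp
  calc
    _ = X ◁ (μ[A] ≫ Δ[A]) ≫ (α_ X A A).inv ≫ (β_ X A).hom ▷ A ≫ (α_ A X A).hom ≫ A ◁ a := by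
      simp only [swapAct]; monoidal
    _ = 𝟙 _ ⊗≫ X ◁ Δ[A] ▷ A ⊗≫ X ◁ A ◁ A ◁ Δ[A] ⊗≫ X ◁ A ◁ (β_ A A).hom ▷ A ⊗≫
          (X ◁ ((A ⊗ A) ◁ μ[A] ≫ μ[A] ▷ A) ⊗≫ (β_ X A).hom ▷ A) ⊗≫ A ◁ a := by
      rw [h1, tensorμ, MonoidalCategory.tensorHom_def Δ[A] Δ[A], tensorHom_def' μ[A] μ[A]]
      monoidal
    _ = 𝟙 _ ⊗≫ X ◁ Δ[A] ▷ A ⊗≫ X ◁ A ◁ A ◁ Δ[A] ⊗≫ X ◁ A ◁ (β_ A A).hom ▷ A ⊗≫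
          X ◁ μ[A] ▷ (A ⊗ A) ⊗≫ ((X ⊗ A) ◁ μ[A] ≫ (β_ X A).hom ▷ A) ⊗≫ A ◁ a := by
      rw [whisker_exchange μ[A] μ[A]]; monoidal
    _ = 𝟙 _ ⊗≫ X ◁ Δ[A] ▷ A ⊗≫ X ◁ A ◁ A ◁ Δ[A] ⊗≫ X ◁ A ◁ (β_ A A).hom ▷ A ⊗≫
          ((X ◁ μ[A] ≫ (β_ X A).hom) ▷ (A ⊗ A) ≫ (A ⊗ X) ◁ μ[A]) ⊗≫ A ◁ a := by
      rw [whisker_exchange (β_ X A).hom μ[A]]; monoidal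
    _ = 𝟙 _ ⊗≫ X ◁ Δ[A] ▷ A ⊗≫ X ◁ A ◁ A ◁ Δ[A] ⊗≫ X ◁ A ◁ (β_ A A).hom ▷ A ⊗≫
          (β_ X A).hom ▷ (A ⊗ A ⊗ A) ⊗≫ A ◁ (β_ X A).hom ▷ (A ⊗ A) ⊗≫ (μ[A] ▷ (X ⊗ A ⊗ A) ≫
          A ◁ ((α_ X A A).inv ≫ ((α_ X A A).hom ≫ X ◁ μ[A] ≫ a))) := by
      rw [h2]; monoidal
    _ = 𝟙 _ ⊗≫ X ◁ Δ[A] ▷ A ⊗≫ (X ◁ A ◁ A ◁ Δ[A] ⊗≫ X ◁ A ◁ (β_ A A).hom ▷ A ⊗≫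
          (β_ X A).hom ▷ (A ⊗ A ⊗ A)) ⊗≫ A ◁ (β_ X A).hom ▷ (A ⊗ A) ⊗≫
          A ◁ A ◁ (a ▷ A ≫ a) ⊗≫ μ[A] ▷ X := by
      rw [← whisker_exchange μ[A], ← ha]; monoidal
    _ = 𝟙 _ ⊗≫ X ◁ Δ[A] ▷ A ⊗≫ ((X ⊗ A) ◁ (A ◁ Δ[A] ⊗≫ (β_ A A).hom ▷ A) ≫
          (β_ X A).hom ▷ ((A ⊗ A) ⊗ A)) ⊗≫ A ◁ (β_ X A).hom ▷ (A ⊗ A) ⊗≫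
          A ◁ A ◁ (a ▷ A) ⊗≫ A ◁ A ◁ a ⊗≫ μ[A] ▷ X := by
      monoidal
    _ = 𝟙 _ ⊗≫ X ◁ Δ[A] ▷ A ⊗≫ (β_ X A).hom ▷ A ▷ A ⊗≫ A ◁ (X ⊗ A) ◁ Δ[A] ⊗≫
          A ◁ ((α_ X A A).hom ≫ X ◁ (β_ A A).hom ≫ (α_ X A A).inv ≫
      (β_ X A).hom ▷ A ≫ (α_ A X A).hom ≫ A ◁ a) ▷ A ⊗≫ A ◁ A ◁ a ⊗≫ μ[A] ▷ X := by
      rw [whisker_exchange]; monoidal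
    _ = 𝟙 _ ⊗≫ X ◁ Δ[A] ▷ A ⊗≫ (β_ X A).hom ▷ A ▷ A ⊗≫ A ◁ ((X ⊗ A) ◁ Δ[A] ≫
          a ▷ (A ⊗ A)) ⊗≫ A ◁ (β_ X A).hom ▷ A ⊗≫ A ◁ A ◁ a ⊗≫ μ[A] ▷ X := by
      rw [← h3]; monoidal
    _ = _ := by
      rw [whisker_exchange]
      simp only [swapAct]
      monoidal

end Concrete

section SmashMon

variable {C : Type u} [Category.{v} C] [MonoidalCategory C] [BraidedCategory C]
  {A : C} [QA : QuasitriangularBialgebra A]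

open ModO QuasitriangularBialgebra

lemma unit_swapAct (B : ModO A) [MonObj B] :
    η[B.obj] ▷ A ≫ swapAct Δ[A] B.act = (λ_ A).hom ≫ (ρ_ A).inv ≫ A ◁ η[B.obj] := by
  have h := swapAct_naturality η[B]
  have h2 : swapAct Δ[A] (𝟙_ (ModO A)).act = (λ_ A).hom ≫ (ρ_ A).inv :=
    swapAct_unit _ _ (by simp)
  rw [h2] at h
  exact h.trans (Category.assoc _ _ _)

/-- The smash product multiplication on `A ⊗ B`. -/
@[reducible]
def smashMon (B : ModO A) [MonObj B] : MonObj (A ⊗ B.obj) where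
  one := (λ_ (𝟙_ C)).inv ≫ (η[A] ⊗ₘ η[B.obj])
  mul := twistMul (swapAct Δ[A] B.act) μ[A] μ[B.obj]
  one_mul := one_twistMul (MonObj.one_mul A) (MonObj.one_mul B.obj) (unit_swapAct B)
  mul_one := twistMul_one (MonObj.mul_one A) (MonObj.mul_one B.obj)
    (one_swapAct B.act B.act_one)
  mul_assoc := by
    refine twistMul_assoc (MonObj.mul_assoc A) (MonObj.mul_assoc B.obj) ?_
      (mul_swapAct B.act B.act_mul)
    have h := swapAct_naturality μ[B]
    rw [swapAct_tensor] at h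
    have h' : μ[B.obj] ▷ A ≫ swapAct Δ[A] B.act = ((α_ B.obj B.obj A).hom ≫
        B.obj ◁ swapAct Δ[A] B.act ≫ (α_ B.obj A B.obj).inv ≫ swapAct Δ[A] B.act ▷ B.obj ≫
          (α_ A B.obj B.obj).hom) ≫ A ◁ μ[B.obj] := h
    rw [h']
    simp only [Category.assoc]

lemma crossInl_mulMap_crossInr (B : ModO A) [MonObj B] :
    @mulMap C _ _ (A ⊗ B.obj) _ _ (smashMon B) (crossInl A η[B.obj]) (crossInr η[A] B.obj) =
      𝟙 (A ⊗ B.obj) :=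
  twistMul_inl_inr (MonObj.mul_one A) (MonObj.one_mul B.obj) (one_swapAct B.act B.act_one)

/-- The object `A ⊗ B` with its smash product multiplication is a smash product. -/
lemma isSmashProduct_crossInl_crossInr (B : ModO A) [MonObj B] :
    @IsSmashProduct C _ _ _ A _ B _ (A ⊗ B.obj) (smashMon B) (crossInl A η[B.obj])
      (crossInr η[A] B.obj) :=
  @IsSmashProduct.mk C _ _ _ A _ B _ (A ⊗ B.obj) (smashMon B) (crossInl A η[B.obj])
    (crossInr η[A] B.obj)
    (@IsMonHom.mk C _ _ _ _ _ (smashMon B) _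
      (show η[A] ≫ crossInl A η[B.obj] = (λ_ (𝟙_ C)).inv ≫ (η[A] ⊗ₘ η[B.obj]) by
        rw [crossInl, MonoidalCategory.tensorHom_def, rightUnitor_inv_naturality_assoc,
          unitors_inv_equal])
      (twistMul_inl_inl (MonObj.mul_one B.obj) (unit_swapAct B)).symm)
    (@IsMonHom.mk C _ _ _ _ _ (smashMon B) _
      (show η[B.obj] ≫ crossInr η[A] B.obj = (λ_ (𝟙_ C)).inv ≫ (η[A] ⊗ₘ η[B.obj]) by
        rw [crossInr, tensorHom_def', leftUnitor_inv_naturality_assoc])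
      (twistMul_inr_inr (MonObj.mul_one A) (one_swapAct B.act B.act_one)).symm)
    (by
      rw [crossInl_mulMap_crossInr, Category.comp_id]
      exact twistMul_inr_inl (MonObj.one_mul A) (MonObj.mul_one B.obj))
    (by
      rw [crossInl_mulMap_crossInr]
      infer_instance)

end SmashMon

/-! ### Antipodes -/

section Antipode

variable {C : Type u} [Category.{v} C] [MonoidalCategory C]

/-- `S` is a convolution inverse of the identity. -/
structure IsAntipode {X : C} [MonObj X] [ComonObj X] (S : X ⟶ X) : Prop where
  left : Δ[X] ≫ (S ⊛ 𝟙 X) = ε[X] ≫ η[X]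
  right : Δ[X] ≫ (𝟙 X ⊛ S) = ε[X] ≫ η[X]

lemma conv_assoc {K M : C} [ComonObj K] [MonObj M] (f g k : K ⟶ M) :
    Δ[K] ≫ ((Δ[K] ≫ (f ⊛ g)) ⊛ k) = Δ[K] ≫ (f ⊛ (Δ[K] ≫ (g ⊛ k))) := by
  rw [← whiskerRight_mulMap, mulMap_assoc, ← whiskerLeft_mulMap,
    reassoc_of% ComonObj.comul_assoc K]

lemma one_conv {K M : C} [ComonObj K] [MonObj M] (f : K ⟶ M) :
    Δ[K] ≫ ((ε[K] ≫ η[M]) ⊛ f) = f := by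
  rw [← whiskerRight_mulMap, one_mulMap, reassoc_of% ComonObj.counit_comul K,
    Iso.inv_hom_id_assoc]

/-- A comonoid map `p` and a monoid map `i` transport a convolution inverse on `X` to one on maps
`K ⟶ K`. -/
lemma conv_inverse {K X : C} [ComonObj K] [MonObj K] [ComonObj X] [MonObj X] {i : X ⟶ K}
    {p : K ⟶ X} [IsMonHom i] (hp : Δ[K] ≫ (p ⊗ₘ p) = p ≫ Δ[X]) (hp' : p ≫ ε[X] = ε[K])
    {f g : X ⟶ X} (h : Δ[X] ≫ (f ⊛ g) = ε[X] ≫ η[X]) :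
    Δ[K] ≫ ((p ≫ f ≫ i) ⊛ (p ≫ g ≫ i)) = ε[K] ≫ η[K] := by
  rw [← tensorHom_mulMap, reassoc_of% hp, ← mulMap_comp, reassoc_of% h, IsMonHom.one_hom,
    reassoc_of% hp']

/-- If the identity of `K` is the convolution product of two maps that factor through objects with
antipodes, then `K` has an antipode: the inverse of a product is the product of the inverses in the
other order. -/
lemma isAntipode_conv {K X Y : C} [ComonObj K] [MonObj K] [ComonObj X] [MonObj X] [ComonObj Y]
    [MonObj Y] {i : X ⟶ K} {j : Y ⟶ K} {p : K ⟶ X} {q : K ⟶ Y} [IsMonHom i] [IsMonHom j]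
    (hp : Δ[K] ≫ (p ⊗ₘ p) = p ≫ Δ[X]) (hp' : p ≫ ε[X] = ε[K])
    (hq : Δ[K] ≫ (q ⊗ₘ q) = q ≫ Δ[Y]) (hq' : q ≫ ε[Y] = ε[K])
    (hid : Δ[K] ≫ ((p ≫ i) ⊛ (q ≫ j)) = 𝟙 K) {S : X ⟶ X} {T : Y ⟶ Y} (hS : IsAntipode S)
    (hT : IsAntipode T) : IsAntipode (Δ[K] ≫ ((q ≫ T ≫ j) ⊛ (p ≫ S ≫ i))) := by
  have h1 := conv_inverse hp hp' hS.left (i := i)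
  have h2 := conv_inverse hp hp' hS.right (i := i)
  have h3 := conv_inverse hq hq' hT.left (i := j)
  have h4 := conv_inverse hq hq' hT.right (i := j)
  rw [Category.id_comp] at h1 h2 h3 h4
  constructor
  · rw [← hid, conv_assoc, ← conv_assoc (p ≫ S ≫ i), h1, one_conv, h3]
  · rw [← hid, conv_assoc, ← conv_assoc (q ≫ j), h4, one_conv, h2]

lemma exists_hopfObj_iff [BraidedCategory C] {X : C} (b : BimonObj X) :
    (∃ H : HopfObj X, H.toBimonObj = b) ↔ ∃ S : X ⟶ X, IsAntipode S := by
  constructor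
  · rintro ⟨H, rfl⟩
    refine ⟨H.antipode, ?_, ?_⟩
    · rw [mulMap, tensorHom_id]; exact H.antipode_left
    · rw [mulMap, id_tensorHom]; exact H.antipode_right
  · rintro ⟨S, h⟩
    refine ⟨{ toBimonObj := b, antipode := S, antipode_left := ?_, antipode_right := ?_ }, rfl⟩
    · have := h.left
      rwa [mulMap, tensorHom_id] at this
    · have := h.right
      rwa [mulMap, id_tensorHom] at this

end Antipode

section Projections

variable {C : Type u} [Category.{v} C] [MonoidalCategory C] [BraidedCategory C] {A X : C}

lemma swapCoact_counit_left [MonObj A] {c : X ⟶ X ⊗ A} {e : X ⟶ 𝟙_ C}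
    (h : c ≫ e ▷ A = e ≫ η[A] ≫ (λ_ A).inv) :
    swapCoact μ[A] c ≫ e ▷ A ≫ (λ_ A).hom = A ◁ e ≫ (ρ_ A).hom := by
  have h1 : A ◁ η[A] ≫ μ[A] = (ρ_ A).hom := MonObj.mul_one A
  calc
    _ = 𝟙 _ ⊗≫ A ◁ c ⊗≫ ((β_ A X).hom ≫ e ▷ A) ▷ A ⊗≫ μ[A] := by
      simp only [swapCoact, Category.assoc, whisker_exchange_assoc]; monoidal
    _ = 𝟙 _ ⊗≫ A ◁ (c ≫ e ▷ A) ⊗≫ μ[A] := by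
      rw [← braiding_naturality_right, braiding_tensorUnit_right]; monoidal
    _ = 𝟙 _ ⊗≫ A ◁ e ⊗≫ (A ◁ η[A] ≫ μ[A]) := by
      rw [h]; monoidal
    _ = _ := by rw [h1]; monoidal

lemma swapCoact_counit_right [BimonObj A] {c : X ⟶ X ⊗ A} (h : c ≫ X ◁ ε[A] = (ρ_ X).inv) :
    swapCoact μ[A] c ≫ X ◁ ε[A] ≫ (ρ_ X).hom = ε[A] ▷ X ≫ (λ_ X).hom := by
  have h1 : μ[A] ≫ ε[A] = (ε[A] ⊗ₘ ε[A]) ≫ (λ_ (𝟙_ C)).hom := BimonObj.mul_counit A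
  calc
    _ = 𝟙 _ ⊗≫ A ◁ c ⊗≫ (β_ A X).hom ▷ A ⊗≫ X ◁ (μ[A] ≫ ε[A]) ⊗≫ 𝟙 _ := by
      simp only [swapCoact]; monoidal
    _ = 𝟙 _ ⊗≫ A ◁ c ⊗≫ ((β_ A X).hom ▷ A ≫ (X ⊗ A) ◁ ε[A]) ⊗≫ X ◁ ε[A] ⊗≫ 𝟙 _ := by
      rw [h1, tensorHom_def']; monoidal
    _ = 𝟙 _ ⊗≫ A ◁ (c ≫ X ◁ ε[A]) ⊗≫ ((β_ A X).hom ≫ X ◁ ε[A]) ⊗≫ 𝟙 _ := by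
      rw [← whisker_exchange]; monoidal
    _ = _ := by
      rw [h, ← braiding_naturality_left, braiding_tensorUnit_left]; monoidal

variable [BimonObj A] [ComonObj X] {c : X ⟶ X ⊗ A}

lemma crossComul_fst_fst (h : c ≫ ε[X] ▷ A = ε[X] ≫ η[A] ≫ (λ_ A).inv) :
    crossComul μ[A] Δ[A] c Δ[X] ≫ ((A ◁ ε[X] ≫ (ρ_ A).hom) ⊗ₘ (A ◁ ε[X] ≫ (ρ_ A).hom)) =
      (A ◁ ε[X] ≫ (ρ_ A).hom) ≫ Δ[A] := by
  have h1 : Δ[X] ≫ ε[X] ▷ X = (λ_ X).inv := ComonObj.counit_comul X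
  calc
    _ = 𝟙 _ ⊗≫ Δ[A] ▷ X ⊗≫ A ◁ A ◁ Δ[X] ⊗≫
          A ◁ (swapCoact μ[A] c ≫ ε[X] ▷ A ≫ (λ_ A).hom) ▷ X ⊗≫ A ◁ A ◁ ε[X] ⊗≫ 𝟙 _ := by
      simp only [crossComul, MonoidalCategory.tensorHom_def]; monoidal
    _ = 𝟙 _ ⊗≫ Δ[A] ▷ X ⊗≫ A ◁ A ◁ (Δ[X] ≫ ε[X] ▷ X) ⊗≫ A ◁ A ◁ ε[X] ⊗≫ 𝟙 _ := by
      rw [swapCoact_counit_left h]; monoidal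
    _ = 𝟙 _ ⊗≫ (Δ[A] ▷ X ≫ (A ⊗ A) ◁ ε[X]) ⊗≫ 𝟙 _ := by
      rw [h1]; monoidal
    _ = _ := by rw [← whisker_exchange]; monoidal

lemma crossComul_snd_snd (h : c ≫ X ◁ ε[A] = (ρ_ X).inv) :
    crossComul μ[A] Δ[A] c Δ[X] ≫ ((ε[A] ▷ X ≫ (λ_ X).hom) ⊗ₘ (ε[A] ▷ X ≫ (λ_ X).hom)) =
      (ε[A] ▷ X ≫ (λ_ X).hom) ≫ Δ[X] := by
  have h1 : Δ[A] ≫ A ◁ ε[A] = (ρ_ A).inv := ComonObj.comul_counit A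
  calc
    _ = 𝟙 _ ⊗≫ Δ[A] ▷ X ⊗≫ A ◁ A ◁ Δ[X] ⊗≫
          A ◁ (swapCoact μ[A] c ≫ X ◁ ε[A] ≫ (ρ_ X).hom) ▷ X ⊗≫ ε[A] ▷ X ▷ X ⊗≫ 𝟙 _ := by
      simp only [crossComul, MonoidalCategory.tensorHom_def Δ[A] Δ[X],
        tensorHom_def' (_ ≫ _) (_ ≫ _)]
      monoidal
    _ = 𝟙 _ ⊗≫ Δ[A] ▷ X ⊗≫ A ◁ (A ◁ Δ[X] ≫ ε[A] ▷ (X ⊗ X)) ⊗≫ ε[A] ▷ X ▷ X ⊗≫ 𝟙 _ := by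
      rw [swapCoact_counit_right h]; monoidal
    _ = 𝟙 _ ⊗≫ (Δ[A] ≫ A ◁ ε[A]) ▷ X ⊗≫ A ◁ Δ[X] ⊗≫ ε[A] ▷ (X ⊗ X) ⊗≫ 𝟙 _ := by
      rw [whisker_exchange ε[A] Δ[X]]; monoidal
    _ = 𝟙 _ ⊗≫ (A ◁ Δ[X] ≫ ε[A] ▷ (X ⊗ X)) ⊗≫ 𝟙 _ := by
      rw [h1]; monoidal
    _ = _ := by rw [whisker_exchange ε[A] Δ[X]]; monoidal

lemma crossComul_fst_snd (h : c ≫ X ◁ ε[A] = (ρ_ X).inv) :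
    crossComul μ[A] Δ[A] c Δ[X] ≫ ((A ◁ ε[X] ≫ (ρ_ A).hom) ⊗ₘ (ε[A] ▷ X ≫ (λ_ X).hom)) =
      𝟙 (A ⊗ X) := by
  have h1 : Δ[A] ≫ A ◁ ε[A] = (ρ_ A).inv := ComonObj.comul_counit A
  have h2 : Δ[X] ≫ ε[X] ▷ X = (λ_ X).inv := ComonObj.counit_comul X
  calc
    _ = 𝟙 _ ⊗≫ Δ[A] ▷ X ⊗≫ A ◁ A ◁ Δ[X] ⊗≫
          A ◁ (swapCoact μ[A] c ≫ X ◁ ε[A] ≫ (ρ_ X).hom) ▷ X ⊗≫ A ◁ ε[X] ▷ X ⊗≫ 𝟙 _ := by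
      simp only [crossComul, MonoidalCategory.tensorHom_def Δ[A] Δ[X],
        tensorHom_def' (_ ≫ _) (_ ≫ _)]
      monoidal
    _ = 𝟙 _ ⊗≫ Δ[A] ▷ X ⊗≫ A ◁ (A ◁ Δ[X] ≫ ε[A] ▷ (X ⊗ X)) ⊗≫ A ◁ ε[X] ▷ X ⊗≫ 𝟙 _ := by
      rw [swapCoact_counit_right h]; monoidal
    _ = 𝟙 _ ⊗≫ (Δ[A] ≫ A ◁ ε[A]) ▷ X ⊗≫ A ◁ (Δ[X] ≫ ε[X] ▷ X) ⊗≫ 𝟙 _ := by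
      rw [whisker_exchange]; monoidal
    _ = _ := by rw [h1, h2]; monoidal

end Projections

section Smash

variable {C : Type u} [Category.{v} C] [MonoidalCategory C] [BraidedCategory C]
  {A : C} [QA : QuasitriangularBialgebra A]

open ModO QuasitriangularBialgebra

namespace IsSmashProduct

variable {B : ModO A} [BimonObj B] {K : C} [MonObj K] {i : A ⟶ K} {j : B.obj ⟶ K}

/-- The projections `id ⊗ ε` and `ε ⊗ id` of `A ⊗ B ≅ K` are comonoid maps, and the identity of `K`
is the convolution product of the corresponding maps `K ⟶ A ⟶ K` and `K ⟶ B ⟶ K`. -/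
lemma exists_antipode (h : IsSmashProduct B i j) {S : A ⟶ A} {T : B.obj ⟶ B.obj}
    (hS : IsAntipode S) (hT : IsAntipode T) :
    ∃ S' : K ⟶ K, @IsAntipode C _ _ K _ h.bimonObj.toComonObj S' := by
  have := h.isIso
  have := h.hom_left
  have := h.hom_right
  let _ := h.bimonObj.toComonObj
  have e1 : (i ⊛ j) ≫ Δ[K] = _ := h.mulMap_comul
  have e2 : (i ⊛ j) ≫ ε[K] = _ := h.mulMap_counit
  refine ⟨_, isAntipode_conv (i := i) (j := j) (p := inv (i ⊛ j) ≫ A ◁ ε[B.obj] ≫ (ρ_ A).hom)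
    (q := inv (i ⊛ j) ≫ ε[A] ▷ B.obj ≫ (λ_ B.obj).hom) ?_ ?_ ?_ ?_ ?_ hS hT⟩
  · rw [← cancel_epi (i ⊛ j), reassoc_of% e1, tensorHom_comp_tensorHom, IsIso.hom_inv_id_assoc,
      crossComul_fst_fst (coact_counit_map B)]
    simp
  · rw [← cancel_epi (i ⊛ j), e2]
    simp [MonoidalCategory.tensorHom_def', unitors_equal]
  · rw [← cancel_epi (i ⊛ j), reassoc_of% e1, tensorHom_comp_tensorHom, IsIso.hom_inv_id_assoc,
      crossComul_snd_snd (coact_counit B)]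
    simp
  · rw [← cancel_epi (i ⊛ j), e2]
    simp [MonoidalCategory.tensorHom_def]
  · rw [← cancel_epi (i ⊛ j), reassoc_of% e1, tensorHom_mulMap]
    simp only [Category.assoc, IsIso.hom_inv_id_assoc]
    rw [← Category.assoc (A ◁ _), ← Category.assoc (_ ▷ B.obj), ← tensorHom_mulMap,
      reassoc_of% crossComul_fst_snd (coact_counit B)]
    simp

end IsSmashProduct

end Smash

section Hopf

variable {C : Type u} [Category.{v} C] [MonoidalCategory C] [BraidedCategory C]
  {A : C} [QA : QuasitriangularBialgebra A]

open ModO QuasitriangularBialgebra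

lemma ModO.isAntipode_hom {B : ModO A} [MonObj B] [ComonObj B] {T : B ⟶ B} (h : IsAntipode T) :
    IsAntipode T.hom where
  left := by
    have e : Δ[B] ≫ T ▷ B ≫ μ[B] = ε[B] ≫ η[B] := by
      rw [← tensorHom_id]; exact h.left
    have e' := congrArg Hom.hom e
    rw [mulMap, tensorHom_id]
    exact e'
  right := by
    have e : Δ[B] ≫ B ◁ T ≫ μ[B] = ε[B] ≫ η[B] := by
      rw [← id_tensorHom]; exact h.right
    have e' := congrArg Hom.hom e
    rw [mulMap, id_tensorHom]
    exact e'

lemma isAntipode_barComon {S : A ⟶ A}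
    (h : @IsAntipode C _ _ A QA.bar.toMonObj QA.bar.toComonObj S) :
    @IsAntipode C _ _ A _ (barComon A) S := by
  have e1 : QA.bar.comul ≫ (S ⊗ₘ 𝟙 A) ≫ QA.bar.mul = QA.bar.counit ≫ QA.bar.one :=
    @IsAntipode.left C _ _ A QA.bar.toMonObj QA.bar.toComonObj S h
  have e2 : QA.bar.comul ≫ (𝟙 A ⊗ₘ S) ≫ QA.bar.mul = QA.bar.counit ≫ QA.bar.one :=
    @IsAntipode.right C _ _ A QA.bar.toMonObj QA.bar.toComonObj S h
  rw [QA.bar_mul, QA.bar_one, QA.bar_counit] at e1 e2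
  exact @IsAntipode.mk C _ _ A _ (barComon A) S e1 e2

lemma IsSmashProduct.isHopf {B : ModO A} [QB : QuasitriangularBialgebra B] {K : C} [MonObj K]
    {i : A ⟶ K} {j : B.obj ⟶ K} (h : IsSmashProduct B i j) (hA : IsHopf A) (hB : IsHopf B) :
    @IsHopf C _ _ _ K h.quasitriangularBialgebra := by
  obtain ⟨S, hS⟩ := (exists_hopfObj_iff _).1 hA.1
  obtain ⟨T, hT⟩ := (exists_hopfObj_iff _).1 hB.1
  obtain ⟨S', hS'⟩ := (@exists_hopfObj_iff C _ _ (reverseBraiding C) A _).1 hA.2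
  obtain ⟨T', hT'⟩ := (@exists_hopfObj_iff (ModO A) _ _ (reverseBraiding (ModO A)) B _).1 hB.2
  refine ⟨(exists_hopfObj_iff _).2 (h.exists_antipode hS (isAntipode_hom hT)),
    (@exists_hopfObj_iff C _ _ (reverseBraiding C) K _).2 ?_⟩
  exact @IsSmashProduct.exists_antipode C _ _ (reverseBraiding C) A
    (QuasitriangularBialgebra.reverse A) B.reverse (reverseBimon B) K _ i j h.reverse S' T'.hom
    (isAntipode_barComon hS')
    (@isAntipode_hom C _ _ _ A _ B _ (barComon B) T' (isAntipode_barComon hT'))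

end Hopf

/-! ### The cross product -/

section Mono

variable {C : Type u} [Category.{v} C] [MonoidalCategory C] {A X : C}

lemma mono_crossInl {e : 𝟙_ C ⟶ X} {p : X ⟶ 𝟙_ C} (h : e ≫ p = 𝟙 _) : Mono (crossInl A e) :=
  have : crossInl A e ≫ A ◁ p ≫ (ρ_ A).hom = 𝟙 A := by
    rw [crossInl, Category.assoc, ← whiskerLeft_comp_assoc, h]; simp
  mono_of_mono_fac (h := 𝟙 A) this

lemma mono_crossInr {e : 𝟙_ C ⟶ A} {p : A ⟶ 𝟙_ C} (h : e ≫ p = 𝟙 _) : Mono (crossInr e X) :=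
  have : crossInr e X ≫ p ▷ X ≫ (λ_ X).hom = 𝟙 X := by
    rw [crossInr, Category.assoc, ← comp_whiskerRight_assoc, h]; simp
  mono_of_mono_fac (h := 𝟙 X) this

end Mono

section CrossProduct

variable {C : Type u} [Category.{v} C] [MonoidalCategory C] [BraidedCategory C]
  {A : C} [QA : QuasitriangularBialgebra A] (B : ModO A)

open ModO QuasitriangularBialgebra

lemma isCrossProduct_bimonObj [BimonObj B] :
    IsCrossProduct QA.toBimonObj B.act (coact B) μ[B.obj] η[B.obj] Δ[B.obj] ε[B.obj]
      (@IsSmashProduct.bimonObj C _ _ _ A _ B _ _ (smashMon B) _ _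
        (isSmashProduct_crossInl_crossInr B)) where
  mul := rfl
  one := rfl
  comul := by
    have e := @IsSmashProduct.mulMap_comul C _ _ _ A _ B _ (smashMon B) _ _ _
      (isSmashProduct_crossInl_crossInr B)
    rw [crossInl_mulMap_crossInr, Category.id_comp, id_tensorHom_id, Category.comp_id] at e
    exact e
  counit := by
    have e := @IsSmashProduct.mulMap_counit C _ _ _ A _ B _ (smashMon B) _ _ _
      (isSmashProduct_crossInl_crossInr B)
    rw [crossInl_mulMap_crossInr, Category.id_comp] at e
    exact e

lemma isCrossProduct_bimonObjBar [QB : QuasitriangularBialgebra B] :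
    @IsCrossProduct C _ _ (reverseBraiding C) A B.obj QA.bar B.act (coactBar B)
      QB.bar.mul.hom QB.bar.one.hom QB.bar.comul.hom QB.bar.counit.hom
      (@IsSmashProduct.bimonObjBar C _ _ _ A _ B _ _ (smashMon B) _ _
        (isSmashProduct_crossInl_crossInr B)) := by
  refine @IsCrossProduct.mk C _ _ (reverseBraiding C) A B.obj QA.bar B.act _ _ _ _ _ _ ?_ ?_ ?_ ?_
  · rw [QA.bar_mul, QB.bar_mul]
    exact congrArg (fun t => twistMul t μ[A] μ[B.obj]) B.swap_eq
  · rw [QA.bar_one, QB.bar_one]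
    rfl
  · have e := @IsSmashProduct.mulMap_comul C _ _ (reverseBraiding C) A
      (QuasitriangularBialgebra.reverse A) B.reverse _ (smashMon B) _ _ (reverseBimon B)
      (@IsSmashProduct.reverse C _ _ _ A _ B _ _ (smashMon B) _ _
        (isSmashProduct_crossInl_crossInr B))
    rw [crossInl_mulMap_crossInr, Category.id_comp, id_tensorHom_id, Category.comp_id] at e
    rw [QA.bar_mul]
    exact e
  · rw [QA.bar_counit, QB.bar_counit]
    exact (isCrossProduct_bimonObj B).counit

end CrossProduct

end BraidedQuantum

open BraidedQuantum

theorem mainTheorem7 {C : Type u} [Category.{v} C] [MonoidalCategory C] [BraidedCategory C]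
    (A : C) [QA : BraidedQuantum.QuasitriangularBialgebra A]
    (B : BraidedQuantum.ModO A) [QB : BraidedQuantum.QuasitriangularBialgebra B] :
    ∃ Q : BraidedQuantum.QuasitriangularBialgebra (A ⊗ B.obj),
      -- `A ⋉ B`, formed in `C`
      BraidedQuantum.IsCrossProduct QA.toBimonObj B.act (BraidedQuantum.ModO.coact B)
        QB.mul.hom QB.one.hom QB.comul.hom QB.counit.hom Q.toBimonObj ∧
      -- `Ā ⋉ B̄`, formed in `C` with inverse braiding
      @BraidedQuantum.IsCrossProduct C _ _ (reverseBraiding C) A B.obj QA.bar B.act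
        (BraidedQuantum.ModO.coactBar B)
        QB.bar.mul.hom QB.bar.one.hom QB.bar.comul.hom QB.bar.counit.hom Q.bar ∧
      -- the canonical morphisms `A ⟶ A ⋉ B` and `B ⟶ A ⋉ B` are algebra monomorphisms
      (let i : A ⟶ A ⊗ B.obj := BraidedQuantum.crossInl A QB.one.hom
       let j : B.obj ⟶ A ⊗ B.obj := BraidedQuantum.crossInr QA.one B.obj
       (Mono i ∧ QA.mul ≫ i = (i ⊗ₘ i) ≫ Q.mul ∧ QA.one ≫ i = Q.one) ∧
       (Mono j ∧ QB.mul.hom ≫ j = (j ⊗ₘ j) ≫ Q.mul ∧ QB.one.hom ≫ j = Q.one) ∧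
       -- the R-matrix
       Q.R = BraidedQuantum.crossR Q.mul i j QA.R QB.R.hom) ∧
      -- the Hopf algebra case
      (BraidedQuantum.IsHopf A → BraidedQuantum.IsHopf B →
        @BraidedQuantum.IsHopf C _ _ _ (A ⊗ B.obj) Q) := by
  have h := isSmashProduct_crossInl_crossInr B
  have hi := @IsSmashProduct.hom_left C _ _ _ A _ B _ _ (smashMon B) _ _ h
  have hj := @IsSmashProduct.hom_right C _ _ _ A _ B _ _ (smashMon B) _ _ h
  have hA : η[A] ≫ ε[A] = 𝟙 _ := BimonObj.one_counit A
  have hB : η[B.obj] ≫ ε[B.obj] = 𝟙 _ := congrArg ModO.Hom.hom (BimonObj.one_counit B)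
  exact ⟨@IsSmashProduct.quasitriangularBialgebra C _ _ _ A _ B _ _ (smashMon B) _ _ h,
    isCrossProduct_bimonObj B, isCrossProduct_bimonObjBar B,
    ⟨⟨mono_crossInl hB,
        @IsMonHom.mul_hom C _ _ _ _ _ (smashMon B) _ hi,
        @IsMonHom.one_hom C _ _ _ _ _ (smashMon B) _ hi⟩,
      ⟨mono_crossInr hA,
        @IsMonHom.mul_hom C _ _ _ _ _ (smashMon B) _ hj,
        @IsMonHom.one_hom C _ _ _ _ _ (smashMon B) _ hj⟩,
      @IsSmashProduct.crossElement_eq C _ _ _ A _ B _ (smashMon B) _ _ _ h (R₀ B)⟩,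
    @IsSmashProduct.isHopf C _ _ _ A _ B _ _ (smashMon B) _ _ h⟩
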